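/- **Model.** An instance $H$ has resource types $i\in[n]$, $n\ge 1$, with initial inventories $c_i\ge 0$ and $c_{\min}=\min_i c_i$; requests $j\in[m]$; and actions $k\in[K]$, each with a set $I_k\subseteq[n]$ of resource types it may consume, among them a trivial action $k_0$ with $I_{k_0}=\emptyset$. If $k$ is chosen for request $j$, it occupies $A_{ijk}(l)\in\{0,b_{ijk}(l)\}$ units of $i$ at each time $l\ge j$, where $b_{ijk}(l)\in[0,1]$, $b_{ijk}(l)=0$ for $i\notin I_k$, and $A_{ijk}(l)$ is non-increasing in $l$, and it yields random rewards $R_{ijk}\ge 0$ with finite mean, $i\in[n]$. The families $((A_{ijk}(l))_{i,l},(R_{ijk})_i)$ are independent over $(j,k)$. With request $j$ arrive $\zeta_i(j)\ge 0$ units of each $i$. The replenishment is adversarial (fixed, unknown) or stochastic (the $\zeta_i(j)$ are independent of each other and of everything else, with two-point laws on $\{0,w_{ij}\}$). Action $k$ may be chosen for $j$ only if, for every $i$ with $b_{ijk}(j)\ne 0$, the remaining inventory of $i$ (initial inventory plus replenishment so far minus units occupied at time $j$) is at least $b_{ijk}(j)$. Arrivals are adversarial: at request $j$ a (randomised) online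 algorithm knows $n$, the $c_i$, the actions and sets $I_k$, the quantities $b$, the laws and the replenishments of requests $1,\dots,j$, its own past actions, and the rewards and the consumption up to time $j$ that these have realised. It chooses one action per request. For fixed $\zeta$ the value of a policy is $\min_i \mathbb E\big[\sum_j R_{ijk(j)}\big]$; $\mathrm{OPT}(H)$ is the supremum of the values of all randomised policies that know the whole instance, including $\zeta$, in advance, but learn realised consumptions and rewards only as an online algorithm does. For stochastic $\zeta$, values of algorithms and OPT are averaged over the realisation of $\zeta$. An algorithm has competitive ratio at least $\rho$ on a family if $\mathrm{ALG}(H)\ge\rho\,\mathrm{OPT}(H)$ for all its members $H$. **Copies.** *Adding a copy of $i$ with inventory $x>0$, available from request $\tau$ on*, means: add a resource type $i'$ with $c_{i'}=x$ that counts the same rewards as $i$, and for every action $k$ with $i\in I_k$ a duplicate that uses $i'$ in place of $i$, with the rewards of $k$ at requests $j\ge\tau$ and no reward at requests $j<\tau$. **Families.** Let $\mathcal H$ be a family of instances with adversarial replenishment, $\mathcal H_0$ its members with $\zeta\equiv 0$, and $\mathcal H(c)$, $\mathcal H_0(c)$ the members of $\mathcal H$, $\mathcal H_0$ with $c_{\min}\ge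 c$. Assume that setting $\zeta\equiv0$ in a member of $\mathcal H$ gives a member of $\mathcal H_0$, that adding such a copy to a member of $\mathcal H_0$ gives a member of $\mathcal H_0$, and that every action uses at most $d\ge 1$ resource types at each request ($|\{i: b_{ijk}(j)\neq 0\}|\le d$). **Batching extension.** Given an online algorithm ALG for $\mathcal H_0$, ALG-B works as follows on $H$. For each $i$ it accumulates the replenishment; as soon as the accumulated amount reaches $\sqrt{c_{\min}}$, at some request $j$, it adds a copy of $i$ with the whole accumulated amount as inventory, available from $j$ on, and starts accumulating again from $0$. At each request it runs ALG on the replenishment-free instance with all copies added so far, and implements the original action from which the action chosen by ALG was duplicated. **Theorem.** There is a universal constant $C>0$ such that the following holds for all $\mathcal H$ and $d$ as above and all functions $\alpha:\mathbb R\to[0,\infty)$. Let ALG be an online algorithm with competitive ratio at least $\alpha(x)$ on $\mathcal H_0(x)$ for every $x>0$ such that, on $\mathcal H_0$, (i) it only chooses $k_0$ or actions with a nonzero reward for some resource type, and (ii) its choice at request $t$ is the same whether or not the instance description already contains a copy that is available only from a later request $\tau>t$ on. Then ALG-B is an online algorithm that only chooses implementable actions (almost surely), and for every $c\ge 2$ its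 competitive ratio on $\mathcal H(c)$ is at least $$\alpha(\sqrt c)\Big(1-C\sqrt{\tfrac{\log(cd)}{c}}\Big).$$ The same bound holds for every instance with stochastic replenishment and $c_{\min}\ge c$ whose realisations of positive probability belong to $\mathcal H$. -/

import Mathlib

open MeasureTheory
open scoped NNReal ENNReal

noncomputable section

namespace OnlineAllocation

/-- What is realised once an action has been chosen for a request, with `n` resource types:
`o.1 i l` is the amount of resource `i` that is in use because of this choice when request `l`
arrives, and `o.2 i` is the reward collected for resource type `i`. -/
abbrev Outcome (n : ℕ) : Type := (Fin n → ℕ → ℝ≥0) × (Fin n → ℝ≥0)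

/-- An instance with adversarial arrivals (request `j` is of type `j`) and a realised, deterministic
replenishment. Resource types, requests and actions are numbered; requests are numbered from `0`.
The consumption process of a request is indexed by all later times `l : ℕ`, so that its law does not
disclose the number `m` of requests. -/
structure Instance where
  /-- number of resource types -/
  n : ℕ
  /-- number of requests -/
  m : ℕ
  /-- number of actions -/
  K : ℕ
  n_pos : 0 < n
  /-- initial inventories -/
  c : Fin n → ℝ≥0
  /-- the trivial action -/
  k₀ : Fin K
  /-- `supp k` is the set of resource types that action `k` may consume -/
  supp : Fin K → Finset (Fin n)
  /-- `b j k i l` is the possible nonzero consumption of resource `i` at time `l ≥ j`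
  by action `k` chosen for request `j` -/
  b : Fin m → Fin K → Fin n → ℕ → ℝ≥0
  /-- `law j k` is the joint law of the consumption process and of the rewards
  of action `k` for request `j` -/
  law : Fin m → Fin K → Measure (Outcome n)
  /-- `zeta i j` units of resource `i` arrive together with request `j` -/
  zeta : Fin n → Fin m → ℝ≥0
  supp_trivial : supp k₀ = ∅
  b_le_one : ∀ j k i l, b j k i l ≤ 1
  b_eq_zero : ∀ j k i l, i ∉ supp k → b j k i l = 0
  law_prob : ∀ j k, IsProbabilityMeasure (law j k)
  /-- each consumption is a two-point random variable -/
  two_point : ∀ (j : Fin m) (k : Fin K), ∀ᵐ o ∂(law j k), ∀ (i : Fin n) (l : ℕ), (j : ℕ) ≤ l →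
    o.1 i l = 0 ∨ o.1 i l = b j k i l
  /-- consumption does not increase over time -/
  antitone : ∀ (j : Fin m) (k : Fin K), ∀ᵐ o ∂(law j k), ∀ (i : Fin n) (l l' : ℕ), (j : ℕ) ≤ l → l ≤ l' →
    o.1 i l' ≤ o.1 i l
  /-- rewards have a finite mean -/
  reward_integrable : ∀ j k i, ∫⁻ o, (o.2 i : ℝ≥0∞) ∂(law j k) ≠ ∞

attribute [instance] Instance.law_prob

namespace Instance

/-- The smallest initial inventory. -/
def cmin (H : Instance) : ℝ≥0 := ⨅ i, H.c i

/-- The instance as far as it is known when request number `T - 1` has arrived: its first `T`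
requests. -/
def upTo (H : Instance) (T : ℕ) (hT : T ≤ H.m) : Instance where
  n := H.n
  m := T
  K := H.K
  n_pos := H.n_pos
  c := H.c
  k₀ := H.k₀
  supp := H.supp
  b := fun j => H.b (Fin.castLE hT j)
  law := fun j => H.law (Fin.castLE hT j)
  zeta := fun i j => H.zeta i (Fin.castLE hT j)
  supp_trivial := H.supp_trivial
  b_le_one := fun _ => H.b_le_one _
  b_eq_zero := fun _ => H.b_eq_zero _
  law_prob := fun _ => H.law_prob _
  two_point := fun j => H.two_point (Fin.castLE hT j)
  antitone := fun j => H.antitone (Fin.castLE hT j)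
  reward_integrable := fun _ => H.reward_integrable _

/-- The same instance with another replenishment. -/
def withZeta (H : Instance) (z : Fin H.n → Fin H.m → ℝ≥0) : Instance :=
  { H with zeta := z }

/-- The same instance without replenishment. -/
def noRepl (H : Instance) : Instance := H.withZeta 0

/-! ### Histories, policies and the benchmark -/

/-- A history lists, for each past request, the chosen action and its outcome; the entries of
requests that have not yet been served carry a default value. -/
abbrev Hist (H : Instance) : Type := ℕ → Fin H.K × Outcome H.n

/-- The part of the outcome of request `s` that is visible when request `t` arrives: its rewards, and
its consumption at the times `s, …, t`. -/
def visible {n : ℕ} (s t : ℕ) (o : Outcome n) : Outcome n :=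
  (fun i l => if s ≤ l ∧ l ≤ t then o.1 i l else 0, o.2)

/-- The observed history when request `t` arrives. -/
def observe (H : Instance) (t : ℕ) (h : H.Hist) : H.Hist :=
  fun s => ((h s).1, visible s t (h s).2)

/-- The outcomes of all actions for all requests; they are independent. -/
abbrev Sample (H : Instance) : Type := Fin H.m × Fin H.K → Outcome H.n

def sampleMeasure (H : Instance) : Measure H.Sample :=
  Measure.pi fun p : Fin H.m × Fin H.K => H.law p.1 p.2

/-- The history just before request `t` is served, under the decision rule `δ`. -/
def hist (H : Instance) (δ : Fin H.m → H.Hist → Fin H.K) (ω : H.Sample) : ℕ → H.Hist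
  | 0 => fun _ => (H.k₀, 0)
  | t + 1 =>
    if ht : t < H.m then
      Function.update (H.hist δ ω t) t
        (δ ⟨t, ht⟩ (H.observe t (H.hist δ ω t)),
          ω (⟨t, ht⟩, δ ⟨t, ht⟩ (H.observe t (H.hist δ ω t))))
    else H.hist δ ω t

/-- The action chosen for request `t`. -/
def chosen (H : Instance) (δ : Fin H.m → H.Hist → Fin H.K) (ω : H.Sample) (t : Fin H.m) :
    Fin H.K :=
  δ t (H.observe t (H.hist δ ω t))

/-- Action `k` can be implemented for request `t` after the history `h`: for every resource type
that it uses, the remaining inventory is at least the possible consumption. -/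
def Implementable (H : Instance) (t : Fin H.m) (h : H.Hist) (k : Fin H.K) : Prop :=
  ∀ i, H.b t k i t ≠ 0 →
    H.b t k i t + ∑ s ∈ Finset.range t, (h s).2.1 i t ≤
      H.c i + ∑ l ∈ Finset.univ.filter (fun l : Fin H.m => l ≤ t), H.zeta i l

/-- A randomised non-anticipating policy for a known instance: a random seed is drawn once, and each
decision depends on the seed and on the observed history. -/
structure Policy (H : Instance) where
  S : Type
  [mS : MeasurableSpace S]
  σ : Measure S
  [σ_prob : IsProbabilityMeasure σ]
  act : Fin H.m → S → H.Hist → Fin H.K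

attribute [instance] Policy.mS Policy.σ_prob

namespace Policy

variable {H : Instance}

/-- The joint law of the seed and of all outcomes. -/
def joint (π : H.Policy) : Measure (π.S × H.Sample) := π.σ.prod H.sampleMeasure

/-- The action for request `t`, as a function of the seed and the outcomes. -/
def choice (π : H.Policy) (x : π.S × H.Sample) (t : Fin H.m) : Fin H.K :=
  H.chosen (fun t => π.act t x.1) x.2 t

/-- The policy is measurable and almost surely chooses implementable actions only. -/
def Admissible (π : H.Policy) : Prop :=
  (∀ t, Measurable fun p : π.S × H.Hist => π.act t p.1 p.2) ∧
  ∀ᵐ x ∂π.joint, ∀ t : Fin H.m,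
    H.Implementable t (H.hist (fun t => π.act t x.1) x.2 t) (π.choice x t)

/-- Almost surely, every chosen nontrivial action has a nonzero reward for some resource type. -/
def NonWasteful (π : H.Policy) : Prop :=
  ∀ᵐ x ∂π.joint, ∀ t : Fin H.m,
    π.choice x t = H.k₀ ∨ ∃ i, ∫⁻ o, (o.2 i : ℝ≥0∞) ∂(H.law t (π.choice x t)) ≠ 0

/-- The objective: the minimum over the resource types of the expected total reward. -/
def value (π : H.Policy) : ℝ≥0∞ :=
  ⨅ i, ∫⁻ x, ∑ t : Fin H.m, ((x.2 (t, π.choice x t)).2 i : ℝ≥0∞) ∂π.joint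

end Policy

/-- The benchmark: the best value of a policy that knows the whole instance (all requests, the laws
of consumptions and rewards, and the replenishment) in advance, but not the realised consumptions
and rewards. -/
def OPT (H : Instance) : ℝ≥0∞ :=
  ⨆ (π : H.Policy) (_ : π.Admissible), π.value

end Instance

/-! ### Online algorithms -/

/-- A randomised online algorithm. When a request arrives it is shown the instance up to and
including this request, and the observed history; it names an action for this request, which is the
last one of the instance `D` that it is shown. -/
structure OnlineAlg where
  S : Type
  [mS : MeasurableSpace S]
  σ : Measure S
  [σ_prob : IsProbabilityMeasure σ]
  act : (D : Instance) → S → D.Hist → Fin D.K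

attribute [instance] OnlineAlg.mS OnlineAlg.σ_prob

namespace OnlineAlg

/-- The policy that results from running the algorithm on `H`. -/
def run (A : OnlineAlg) (H : Instance) : H.Policy where
  S := A.S
  σ := A.σ
  act := fun t s h => A.act (H.upTo (t + 1) t.isLt) s h

/-- `A` achieves a competitive ratio of at least `ρ` on the instances of `F`. -/
def HasRatio (A : OnlineAlg) (F : Set Instance) (ρ : ℝ≥0∞) : Prop :=
  ∀ H ∈ F, (A.run H).Admissible ∧ ρ * H.OPT ≤ (A.run H).value

end OnlineAlg

/-! ### Adding a copy of a resource type -/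

namespace Instance

/-- The actions that may consume resource `i`. -/
def users (H : Instance) (i : Fin H.n) : Finset (Fin H.K) :=
  Finset.univ.filter fun k => i ∈ H.supp k

/-- When a copy of resource `i` is added, the actions of `H` keep their numbers, and every action
that may consume `i` gets a duplicate with a number `≥ H.K`. This is the action of `H` from which an
action stems. -/
def origAct (H : Instance) (i : Fin H.n) : Fin (H.K + (H.users i).card) → Fin H.K :=
  Fin.addCases (fun k => k) (fun q => (H.users i).orderEmbOfFin rfl q)

/-- The consumption of a duplicate action is that of the original action, with the use of `i`
replaced by a use of the copy (which is the last resource type). -/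
def useRow {n : ℕ} {β : Type} [Zero β] (i : Fin n) (dup : Prop) [Decidable dup] (x : Fin n → β) :
    Fin (n + 1) → β :=
  if dup then Fin.snoc (α := fun _ => β) (Function.update x i 0) (x i)
  else Fin.snoc (α := fun _ => β) x 0

/-- The copy of `i` counts the same rewards as `i`. -/
def rewardRow {n : ℕ} (i : Fin n) (hidden : Prop) [Decidable hidden] (x : Fin n → ℝ≥0) :
    Fin (n + 1) → ℝ≥0 :=
  if hidden then 0 else Fin.snoc (α := fun _ => ℝ≥0) x (x i)

/-- The outcome of action `k` for request `t` after a copy of resource `i` has been added, in terms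
of the outcome of the action from which `k` stems. Duplicate actions have no reward at the
requests before `τ`. -/
def copyOutcome (H : Instance) (i : Fin H.n) (τ t : ℕ) (k : Fin (H.K + (H.users i).card))
    (o : Outcome H.n) : Outcome (H.n + 1) :=
  (useRow i (H.K ≤ (k : ℕ)) o.1, rewardRow i (H.K ≤ (k : ℕ) ∧ t < τ) o.2)

theorem measurable_copyOutcome (H : Instance) (i : Fin H.n) (τ t : ℕ)
    (k : Fin (H.K + (H.users i).card)) : Measurable (H.copyOutcome i τ t k) := by
  refine Measurable.prodMk ?_ ?_
  · refine measurable_pi_lambda _ fun r => ?_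
    unfold useRow
    split_ifs
    · refine Fin.lastCases ?_ (fun r => ?_) r
      · simp only [Fin.snoc_last]; fun_prop
      · simp only [Fin.snoc_castSucc]
        by_cases h : r = i
        · subst h; simp
        · simp only [Function.update_of_ne h]; fun_prop
    · refine Fin.lastCases ?_ (fun r => ?_) r
      · simp only [Fin.snoc_last]; fun_prop
      · simp only [Fin.snoc_castSucc]; fun_prop
  · refine measurable_pi_lambda _ fun r => ?_
    unfold rewardRow
    split_ifs
    · simp
    · refine Fin.lastCases ?_ (fun r => ?_) r
      · simp only [Fin.snoc_last]; fun_prop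
      · simp only [Fin.snoc_castSucc]; fun_prop

theorem useRow_forall {n : ℕ} {β γ : Type} [Zero β] [Zero γ] (i : Fin n) (dup : Prop)
    [Decidable dup] (x : Fin n → β) (y : Fin n → γ) (P : β → γ → Prop) (h0 : P 0 0)
    (h : ∀ r, P (x r) (y r)) (r : Fin (n + 1)) : P (useRow i dup x r) (useRow i dup y r) := by
  unfold useRow
  split_ifs
  · refine Fin.lastCases ?_ (fun r => ?_) r
    · simpa using h i
    · simp only [Fin.snoc_castSucc]
      by_cases hr : r = i
      · subst hr; simpa using h0
      · simpa [Function.update_of_ne hr] using h r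
  · refine Fin.lastCases ?_ (fun r => ?_) r
    · simpa using h0
    · simpa using h r

/-- `H` with one more resource type: a copy of resource `i` with starting inventory `x`, together
with duplicates of the actions that may consume `i`. A duplicate uses the copy instead of `i`; it has
the original rewards from request `τ` on, and no reward before. The resource types and actions of `H`
keep their numbers, and the copy is the last resource type. -/
def addCopy (H : Instance) (i : Fin H.n) (τ : ℕ) (x : ℝ≥0) : Instance where
  n := H.n + 1
  m := H.m
  K := H.K + (H.users i).card
  n_pos := Nat.succ_pos _
  c := Fin.snoc (α := fun _ => ℝ≥0) H.c x
  k₀ := Fin.castAdd _ H.k₀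
  supp := fun k =>
    if H.K ≤ (k : ℕ) then
      insert (Fin.last H.n) (((H.supp (H.origAct i k)).erase i).map Fin.castSuccEmb)
    else (H.supp (H.origAct i k)).map Fin.castSuccEmb
  b := fun j k => useRow i (H.K ≤ (k : ℕ)) (H.b j (H.origAct i k))
  law := fun j k => (H.law j (H.origAct i k)).map (H.copyOutcome i τ j k)
  zeta := fun r j => Fin.snoc (α := fun _ => ℝ≥0) (fun i => H.zeta i j) 0 r
  supp_trivial := by
    simp [origAct, H.supp_trivial]
  b_le_one := fun j k r l =>
    useRow_forall i (H.K ≤ (k : ℕ)) (H.b j (H.origAct i k)) (H.b j (H.origAct i k))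
      (fun u _ => u l ≤ 1) (by simp) (fun r => H.b_le_one _ _ r l) r
  b_eq_zero := by
    intro j k r l hr
    unfold useRow
    split_ifs at hr ⊢ with hk
    · revert hr
      refine Fin.lastCases ?_ (fun r => ?_) r
      · simp
      · intro hr
        simp only [Fin.snoc_castSucc]
        by_cases h : r = i
        · subst h; simp
        · rw [Function.update_of_ne h]
          refine H.b_eq_zero _ _ _ _ fun hs => hr ?_
          simp [h, hs]
    · revert hr
      refine Fin.lastCases ?_ (fun r => ?_) r
      · simp
      · intro hr
        simp only [Fin.snoc_castSucc]
        refine H.b_eq_zero _ _ _ _ fun hs => hr ?_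
        simp [hs]
  law_prob := fun j k =>
    Measure.isProbabilityMeasure_map (H.measurable_copyOutcome i τ j k).aemeasurable
  two_point := by
    intro j k
    rw [ae_map_iff (H.measurable_copyOutcome i τ j k).aemeasurable]
    · filter_upwards [H.two_point j (H.origAct i k)] with o ho r l hl
      exact useRow_forall i (H.K ≤ (k : ℕ)) o.1 (H.b j (H.origAct i k))
        (fun u v => u l = 0 ∨ u l = v l) (by simp) (fun r => ho r l hl) r
    · simp only [Set.ofPred_forall]
      refine MeasurableSet.iInter fun r => MeasurableSet.iInter fun l =>
        MeasurableSet.iInter fun _ => ?_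
      exact (measurableSet_eq_fun (by fun_prop) measurable_const).union
        (measurableSet_eq_fun (by fun_prop) measurable_const)
  antitone := by
    intro j k
    rw [ae_map_iff (H.measurable_copyOutcome i τ j k).aemeasurable]
    · filter_upwards [H.antitone j (H.origAct i k)] with o ho r l l' hl hl'
      exact useRow_forall i (H.K ≤ (k : ℕ)) o.1 o.1
        (fun u _ => u l' ≤ u l) (by simp) (fun r => ho r l l' hl hl') r
    · simp only [Set.ofPred_forall]
      refine MeasurableSet.iInter fun r => MeasurableSet.iInter fun l =>
        MeasurableSet.iInter fun l' => MeasurableSet.iInter fun _ => MeasurableSet.iInter fun _ => ?_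
      exact measurableSet_le (by fun_prop) (by fun_prop)
  reward_integrable := by
    intro j k r
    rw [lintegral_map (by fun_prop) (H.measurable_copyOutcome i τ j k)]
    unfold copyOutcome rewardRow
    split_ifs
    · simp
    · refine Fin.lastCases ?_ (fun r => ?_) r
      · simpa using H.reward_integrable j (H.origAct i k) i
      · simpa using H.reward_integrable j (H.origAct i k) r

/-- A history of `H`, read as a history after a copy of resource `i` has been added: the copy has not
been used, and it counts the same rewards as `i`. -/
def copyHist (H : Instance) (i : Fin H.n) (τ : ℕ) (x : ℝ≥0) (h : H.Hist) :
    (H.addCopy i τ x).Hist :=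
  fun s => (Fin.castAdd _ (h s).1, H.copyOutcome i τ s (Fin.castAdd _ (h s).1) (h s).2)

/-! ### The batched instance -/

/-- The introduction of a new resource type: a copy of `res`, available from request `time` on, with
inventory `size`. -/
structure Event (n : ℕ) where
  res : Fin n
  time : ℕ
  size : ℝ≥0

/-- An enlargement of `H` by copies of resource types: the enlarged instance, the position in it of
the resource types of `H`, the action of `H` from which each of its actions stems, and its outcomes
in terms of the outcomes in `H`. -/
structure Ext (H : Instance) where
  inst : Instance
  pos : Fin H.n → Fin inst.n
  base : Fin inst.K → Fin H.K
  lift : ℕ → Fin inst.K → Outcome H.n → Outcome inst.n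

/-- `H` enlarged by the copies in the list, the last entry of the list being added first. -/
def extend (H : Instance) : List (Event H.n) → Ext H
  | [] => ⟨H, id, id, fun _ _ o => o⟩
  | e :: es =>
    let X := H.extend es
    { inst := X.inst.addCopy (X.pos e.res) e.time e.size
      pos := fun i => Fin.castSucc (X.pos i)
      base := fun k => X.base (X.inst.origAct (X.pos e.res) k)
      lift := fun t k o =>
        X.inst.copyOutcome (X.pos e.res) e.time t k
          (X.lift t (X.inst.origAct (X.pos e.res) k) o) }

/-- The batching threshold, the square root of the smallest initial inventory. -/
def threshold (H : Instance) : ℝ≥0 := NNReal.sqrt H.cmin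

/-- The replenishment of `i` at request `j`, and `0` after the last request. -/
def zetaAt (H : Instance) (i : Fin H.n) (j : ℕ) : ℝ≥0 :=
  if hj : j < H.m then H.zeta i ⟨j, hj⟩ else 0

/-- The replenishment of resource `i` that has arrived before request `j` and is not yet batched. -/
def pending (H : Instance) (i : Fin H.n) : ℕ → ℝ≥0
  | 0 => 0
  | j + 1 =>
    if H.threshold ≤ H.pending i j + H.zetaAt i j then 0 else H.pending i j + H.zetaAt i j

/-- The batches, latest first: whenever the accumulated replenishment of `i` reaches the threshold at
request `j`, all of it forms a new copy of `i`, available from request `j` on. -/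
def batches (H : Instance) : List (Event H.n) :=
  ((List.range H.m).flatMap fun j => (List.finRange H.n).filterMap fun i =>
    if H.threshold ≤ H.pending i j + H.zetaAt i j then
      some ⟨i, j, H.pending i j + H.zetaAt i j⟩
    else none).reverse

/-- The batched instance: no replenishment, one additional resource type for each batch. -/
def batched (H : Instance) : Ext H.noRepl := H.noRepl.extend H.batches

/-- The action with a given number. -/
def Ext.action {H : Instance} (X : Ext H) (v : ℕ) : Fin X.inst.K :=
  if hv : v < X.inst.K then ⟨v, hv⟩ else X.inst.k₀

/-- The history that is observed in the enlarged instance when request `t` arrives, if `past` lists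
the numbers of the actions chosen there and `h` is the history in `H`. -/
def Ext.history {H : Instance} (X : Ext H) (t : ℕ) (past : ℕ → ℕ) (h : H.Hist) : X.inst.Hist :=
  fun s =>
    if s < t then
      (X.action (past s), visible s t (X.lift s (X.action (past s)) (h s).2))
    else (X.inst.k₀, 0)

end Instance

/-! ### The batching extension -/

namespace OnlineAlg

/-- The number of the action that `A` chooses for request `t` on the batched instance as known at
request `t`, after the actions with the numbers `past`. -/
def batchChoice (A : OnlineAlg) (D : Instance) (s : A.S) (h : D.Hist) (t : ℕ) (past : ℕ → ℕ) : ℕ :=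
  if ht : t < D.m then
    let X := (D.upTo (t + 1) ht).batched
    (A.act X.inst s (X.history t past h)).val
  else 0

/-- The numbers of the actions that `A` has chosen on the batched instance before request `t`. -/
def batchPast (A : OnlineAlg) (D : Instance) (s : A.S) (h : D.Hist) : ℕ → ℕ → ℕ
  | 0 => fun _ => 0
  | t + 1 =>
    Function.update (A.batchPast D s h t) t (A.batchChoice D s h t (A.batchPast D s h t))

/-- The batching extension of `A`: at each request, run `A` on the batched instance built from the
replenishment seen so far, and implement the original action from which the action chosen by `A`
stems. -/
def batching (A : OnlineAlg) : OnlineAlg where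
  S := A.S
  σ := A.σ
  act := fun D s h =>
    if 0 < D.m then
      let X := D.batched
      X.base (X.action
        (A.batchChoice D s h (D.m - 1) (A.batchPast D s h (D.m - 1))))
    else D.k₀

end OnlineAlg

/-! ### Families of instances -/

/-- The members of a family that have no replenishment. -/
def noReplPart (F : Set Instance) : Set Instance := {H ∈ F | H.zeta = 0}

/-- The members of a family whose smallest initial inventory is at least `c`. -/
def atLeast (F : Set Instance) (c : ℝ) : Set Instance := {H ∈ F | c ≤ (H.cmin : ℝ)}

/-- Dropping the replenishment of a member gives a member, and adding a copy of a resource type to a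
member without replenishment gives a member. -/
structure ClosedFamily (F : Set Instance) : Prop where
  noRepl_mem : ∀ H ∈ F, H.noRepl ∈ F
  addCopy_mem : ∀ H ∈ noReplPart F, ∀ (i : Fin H.n) (τ : ℕ) (x : ℝ≥0), 0 < x →
    H.addCopy i τ x ∈ F

/-- Every action uses at most `d` resource types at each request. -/
def UsesAtMost (F : Set Instance) (d : ℕ) : Prop :=
  ∀ H ∈ F, ∀ (j : Fin H.m) (k : Fin H.K),
    (Finset.univ.filter fun i => H.b j k i j ≠ 0).card ≤ d

/-- The decision of `A` for request `t` on an instance without replenishment is not affected by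
an additional copy of a resource type all of whose actions have no reward up to
request `t`; that is, it is the same whether this copy is already part of the description or is
introduced after request `t`. -/
def OnlineAlg.Consistent (A : OnlineAlg) (F : Set Instance) : Prop :=
  ∀ H ∈ noReplPart F, ∀ (i : Fin H.n) (τ : ℕ) (x : ℝ≥0), 0 < x →
    ∀ (t : Fin H.m), (t : ℕ) < τ → ∀ (s : A.S) (h : H.Hist),
      A.act ((H.addCopy i τ x).upTo (t + 1) t.isLt) s (H.copyHist i τ x h) =
        Fin.castAdd _ (A.act (H.upTo (t + 1) t.isLt) s h)

/-! ### Stochastic replenishment -/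

/-- An instance with stochastic replenishment: the replenishment of `i` at request `j` equals
`zeta i j` with probability `p i j` and `0` otherwise, independently for all `i` and `j`. -/
structure StochInstance extends Instance where
  p : Fin n → Fin m → ℝ≥0
  p_le_one : ∀ i j, p i j ≤ 1

namespace StochInstance

/-- The instance for the realisation in which the replenishments marked by `z` occur. -/
def realize (G : StochInstance) (z : Fin G.n → Fin G.m → Bool) : Instance :=
  G.toInstance.withZeta fun i j => if z i j then G.zeta i j else 0

/-- The probability of a realisation. -/
def weight (G : StochInstance) (z : Fin G.n → Fin G.m → Bool) : ℝ≥0 :=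
  ∏ i, ∏ j, if z i j then G.p i j else 1 - G.p i j

/-- The expected value of the clairvoyant benchmark, which knows the realised replenishment. -/
def OPT (G : StochInstance) : ℝ≥0∞ := ∑ z, (G.weight z : ℝ≥0∞) * (G.realize z).OPT

/-- The expected value of an online algorithm. -/
def value (G : StochInstance) (A : OnlineAlg) : ℝ≥0∞ :=
  ∑ z, (G.weight z : ℝ≥0∞) * (A.run (G.realize z)).value

end StochInstance

end OnlineAllocation

end

/-! Two inequalities carry the theorem. Let `B` be the batched instance, with no replenishment and
one extra resource type per batch.

ALG-B does at least as well on `H` as ALG on `B`. By consistency, the choice on the part of `B`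
known at request `t` is the choice on all of `B`. The history in `B` that ALG-B simulates therefore
has the law of a genuine run of ALG (`lintegral_batchLift`), and each reward in `B` is the one in
`H` or zero (`value_le_batching`). A non-wasteful run never uses a copy before its batch has formed,
because such actions earn nothing. The available copies of `i` together hold no more than the
inventory of `i` that has arrived, so adding up their use shows that the original action is
implementable (`admissible_batching`).

Batching hardly hurts the benchmark: with `e = √(log (cd) / c)`, it retains the fraction `1 - 10 e`
of OPT(`H`) (`mul_OPT_le_OPT_batched`). Given a policy for `H`, an independent coin drops each
request with probability `δ = 8 e`. The policy for `B` simulates the given one throughout; outcomes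
of choices that are not implemented come from an independent sample drawn with the seed. The
simulated run then has the law of the given policy whatever the coins show (`lintegral_simHist`), so
coins and run are independent. For a fixed run, the use of a needed type is at most the arrived
inventory `L ≥ c`, and a Chernoff bound puts the kept part below `(1 - δ/2) L`, except with
probability `exp (-δ² c / 16)`.

The slack `δ L / 2` pays for the two losses from batching. One is the pending replenishment, at most
`√c_min`. The other is one unit per copy: a use of at most one unit fits into some copy once the
total free room is at least the number of copies (`reward_le_of_fits`), and there are few copies
since each holds at least `√c_min`. A union bound over the at most `d` types in use shows that each
request of the run is served with probability at least `1 - 10 e` (`le_measure_fits`).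

All inventories in `B` are at least `√c_min`, which explains `α (√c)`. Stochastic replenishment
follows by averaging over its realisations. -/

noncomputable section

/-! ### Iterated copying of resource types in closed form -/

namespace OnlineAllocation

/-- `B` arises from `H` by dropping the replenishment and adding copies of resource types. Resource
`r` of `B` is a copy of `orig r` that is available from request `tau r` on, and `pos i` is `i` itself;
action `k` of `B` stems from `base k` and uses the copy `sel k i` in place of `i`. -/
structure Copying (H B : Instance) where
  orig : Fin B.n → Fin H.n
  tau : Fin B.n → ℕ
  pos : Fin H.n → Fin B.n
  base : Fin B.K → Fin H.K
  sel : Fin B.K → Fin H.n → Fin B.n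
  m_eq : B.m = H.m
  zeta_eq : B.zeta = 0
  orig_sel : ∀ k i, orig (sel k i) = i
  orig_pos : ∀ i, orig (pos i) = i
  tau_pos : ∀ i, tau (pos i) = 0
  base_triv : base B.k₀ = H.k₀
  sel_of_notMem : ∀ k i, i ∉ H.supp (base k) → sel k i = pos i
  mem_supp : ∀ k r, r ∈ B.supp k ↔ orig r ∈ H.supp (base k) ∧ sel k (orig r) = r
  b_eq : ∀ t (ht : t < B.m) (ht' : t < H.m) k r l,
    B.b ⟨t, ht⟩ k r l = if sel k (orig r) = r then H.b ⟨t, ht'⟩ (base k) (orig r) l else 0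
  law_eq : ∀ t (ht : t < B.m) (ht' : t < H.m) k,
    B.law ⟨t, ht⟩ k = (H.law ⟨t, ht'⟩ (base k)).map fun o =>
      (fun r => if sel k (orig r) = r then o.1 (orig r) else 0,
        fun r => if ∃ i, t < tau (sel k i) then 0 else o.2 (orig r))
  exists_act : ∀ (k : Fin H.K) (f : Fin H.n → Fin B.n), (∀ i, orig (f i) = i) →
    ∃ k', base k' = k ∧ ∀ i ∈ H.supp k, sel k' i = f i

namespace Copying

variable {H B : Instance}

/-- At request `t`, action `k` uses a copy that is not yet available. -/
def Hidden (D : Copying H B) (t : ℕ) (k : Fin B.K) : Prop := ∃ i, t < D.tau (D.sel k i)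

instance decidableHidden (D : Copying H B) (t : ℕ) (k : Fin B.K) :
    Decidable (D.Hidden t k) := by
  unfold Hidden; infer_instance

/-- The outcome in `B` of action `k`, in terms of the outcome of the original action in `H`. -/
def lift (D : Copying H B) (t : ℕ) (k : Fin B.K) (o : Outcome H.n) : Outcome B.n :=
  (fun r => if D.sel k (D.orig r) = r then o.1 (D.orig r) else 0,
    fun r => if D.Hidden t k then 0 else o.2 (D.orig r))

theorem law_eq_map_lift (D : Copying H B) {t : ℕ} (ht : t < B.m) (ht' : t < H.m) (k : Fin B.K) :
    B.law ⟨t, ht⟩ k = (H.law ⟨t, ht'⟩ (D.base k)).map (D.lift t k) :=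
  D.law_eq t ht ht' k

theorem measurable_lift (D : Copying H B) (t : ℕ) (k : Fin B.K) : Measurable (D.lift t k) := by
  unfold lift
  refine Measurable.prodMk ?_ ?_
  · refine measurable_pi_lambda _ fun r => ?_
    split_ifs <;> fun_prop
  · refine measurable_pi_lambda _ fun r => ?_
    split_ifs <;> fun_prop

/-- The instance itself, without its replenishment. -/
def refl (H : Instance) : Copying H H.noRepl where
  orig := id
  tau := fun _ => 0
  pos := id
  base := id
  sel := fun _ i => i
  m_eq := rfl
  zeta_eq := rfl
  orig_sel := fun _ _ => rfl
  orig_pos := fun _ => rfl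
  tau_pos := fun _ => rfl
  base_triv := rfl
  sel_of_notMem := fun _ _ _ => rfl
  mem_supp := fun _ _ => ⟨fun h => ⟨h, rfl⟩, fun h => h.1⟩
  b_eq := fun _ _ _ _ _ _ => (if_pos rfl).symm
  law_eq := fun t ht ht' k => by
    refine (Measure.map_id (μ := H.law ⟨t, ht'⟩ k)).symm.trans ?_
    congr 1
    funext o
    exact Prod.ext (funext fun r => (if_pos rfl).symm) (funext fun r => (if_neg (by simp)).symm)
  exists_act := fun k f hf => ⟨k, rfl, fun i _ => (hf i).symm⟩

theorem lift_refl (H : Instance) (t : ℕ) (k : Fin H.noRepl.K) (o : Outcome H.n) :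
    (refl H).lift t k o = o := by
  ext <;> simp [lift, refl, Hidden]

section AddCopy

variable (D : Copying H B) (a : Fin H.n) (τ : ℕ) (x : ℝ≥0)

theorem mem_supp_origAct {k : Fin (B.K + (B.users (D.pos a)).card)} (hk : B.K ≤ (k : ℕ)) :
    D.pos a ∈ B.supp (B.origAct (D.pos a) k) := by
  induction k using Fin.addCases with
  | left k => exact absurd hk (by simp [k.isLt])
  | right q =>
    have h := Finset.orderEmbOfFin_mem (B.users (D.pos a)) rfl q
    have ho : B.origAct (D.pos a) (Fin.natAdd _ q) = (B.users (D.pos a)).orderEmbOfFin rfl q := by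
      simp [Instance.origAct]
    rw [ho]
    exact (Finset.mem_filter.1 h).2

/-- Only users of the original resource `pos a` itself get a duplicate. An action that draws `a`
from an older copy gets none, so each action has one well-defined copy in place of `a`. -/
theorem sel_origAct {k : Fin (B.K + (B.users (D.pos a)).card)} (hk : B.K ≤ (k : ℕ)) :
    D.sel (B.origAct (D.pos a) k) a = D.pos a := by
  simpa [D.orig_pos] using ((D.mem_supp _ _).1 (D.mem_supp_origAct a hk)).2

/-- The original resource types after adding a copy of `a`. -/
def addOrig : Fin (B.n + 1) → Fin H.n := Fin.snoc (α := fun _ => Fin H.n) D.orig a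

def addTau : Fin (B.n + 1) → ℕ := Fin.snoc (α := fun _ => ℕ) D.tau τ

def addSel (k : Fin (B.K + (B.users (D.pos a)).card)) (i : Fin H.n) : Fin (B.n + 1) :=
  if B.K ≤ (k : ℕ) ∧ i = a then Fin.last _ else Fin.castSucc (D.sel (B.origAct (D.pos a) k) i)

@[simp] theorem addOrig_last : D.addOrig a (Fin.last _) = a := by simp [addOrig]
@[simp] theorem addOrig_castSucc (r : Fin B.n) : D.addOrig a r.castSucc = D.orig r := by
  simp [addOrig]
@[simp] theorem addTau_last : D.addTau τ (Fin.last _) = τ := by simp [addTau]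
@[simp] theorem addTau_castSucc (r : Fin B.n) : D.addTau τ r.castSucc = D.tau r := by
  simp [addTau]

theorem addOrig_addSel (k : Fin (B.K + (B.users (D.pos a)).card)) (i : Fin H.n) :
    D.addOrig a (D.addSel a k i) = i := by
  unfold addSel
  split_ifs with h
  · simp [h.2]
  · simp [D.orig_sel]

theorem useRow_eq {β : Type} [Zero β] (k : Fin (B.K + (B.users (D.pos a)).card))
    (u : Fin B.n → β) (v : Fin H.n → β)
    (huv : ∀ r, u r = if D.sel (B.origAct (D.pos a) k) (D.orig r) = r then v (D.orig r) else 0)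
    (r : Fin (B.n + 1)) :
    Instance.useRow (D.pos a) (B.K ≤ (k : ℕ)) u r =
      if D.addSel a k (D.addOrig a r) = r then v (D.addOrig a r) else 0 := by
  unfold Instance.useRow addSel
  by_cases hk : B.K ≤ (k : ℕ)
  · have hs := D.sel_origAct a hk
    refine Fin.lastCases ?_ (fun r => ?_) r
    · simp [hk, huv, D.orig_pos, hs]
    -- Among the old copies of `a`, `pos a` hands its use over to the new copy, and the others were
    -- not used by this action.
    · by_cases hr : D.orig r = a
      · by_cases hp : r = D.pos a
        · subst hp
          simp [hk, hr, (Fin.castSucc_lt_last _).ne']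
        · simp [hk, hr, huv, Function.update_of_ne hp, (Fin.castSucc_lt_last _).ne', hs, Ne.symm hp]
      · have hp : r ≠ D.pos a := fun h => hr (by rw [h, D.orig_pos])
        simp [hk, hr, huv, Function.update_of_ne hp]
  · refine Fin.lastCases ?_ (fun r => ?_) r
    · simp [hk, (Fin.castSucc_lt_last _).ne]
    · simp [hk, huv]

theorem hidden_addSel (t : ℕ) (k : Fin (B.K + (B.users (D.pos a)).card)) :
    (∃ i, t < D.addTau τ (D.addSel a k i)) ↔
      D.Hidden t (B.origAct (D.pos a) k) ∨ (B.K ≤ (k : ℕ) ∧ t < τ) := by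
  unfold addSel Hidden
  by_cases hk : B.K ≤ (k : ℕ)
  · have hs := D.sel_origAct a hk
    constructor
    · rintro ⟨i, hi⟩
      by_cases h : i = a
      · right; simpa [hk, h] using hi
      · left; exact ⟨i, by simpa [h] using hi⟩
    · rintro (⟨i, hi⟩ | h)
      -- The original of a duplicate draws `a` from `pos a`, which is available from the start, so
      -- `a` cannot be the reason for its being hidden.
      · have h : i ≠ a := by
          rintro rfl
          rw [hs, D.tau_pos] at hi
          omega
        exact ⟨i, by simpa [h] using hi⟩
      · exact ⟨a, by simpa [hk] using h.2⟩
  · simp [hk]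

/-- The inductive step behind `law_eq`: a lifted outcome stays in closed form when one more copy is
added, so all outcomes in the enlarged instance are read off from one outcome in `H`. -/
theorem copyOutcome_lift (t : ℕ) (k : Fin (B.K + (B.users (D.pos a)).card)) (o : Outcome H.n) :
    B.copyOutcome (D.pos a) τ t k (D.lift t (B.origAct (D.pos a) k) o) =
      (fun r => if D.addSel a k (D.addOrig a r) = r then o.1 (D.addOrig a r) else 0,
        fun r => if ∃ i, t < D.addTau τ (D.addSel a k i) then 0 else o.2 (D.addOrig a r)) := by
  unfold Instance.copyOutcome
  refine Prod.ext ?_ ?_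
  · funext r
    exact D.useRow_eq a k _ _ (fun r => rfl) r
  · funext r
    simp only [D.hidden_addSel, Instance.rewardRow]
    by_cases h : B.K ≤ (k : ℕ) ∧ t < τ
    · simp [h]
    · refine Fin.lastCases ?_ (fun r => ?_) r
      · simp [h, lift, D.orig_pos]
      · simp [h, lift]

theorem zeta_addCopy (hz : B.zeta = 0) (r : Fin (B.n + 1)) (j : Fin B.m) :
    Fin.snoc (α := fun _ => ℝ≥0) (fun i => B.zeta i j) 0 r = 0 := by
  refine Fin.lastCases ?_ (fun r => ?_) r
  · simp
  · simp [hz]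

theorem addSel_of_notMem (k : Fin (B.K + (B.users (D.pos a)).card)) (i : Fin H.n)
    (hi : i ∉ H.supp (D.base (B.origAct (D.pos a) k))) :
    D.addSel a k i = Fin.castSucc (D.pos i) := by
  unfold addSel
  rw [if_neg, D.sel_of_notMem _ _ hi]
  rintro ⟨hk, rfl⟩
  have := ((D.mem_supp _ _).1 (D.mem_supp_origAct i hk)).1
  rw [D.orig_pos] at this
  exact hi this

theorem mem_supp_addCopy (k : Fin (B.K + (B.users (D.pos a)).card)) (r : Fin (B.n + 1)) :
    r ∈ (if B.K ≤ (k : ℕ) then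
      insert (Fin.last B.n) (((B.supp (B.origAct (D.pos a) k)).erase (D.pos a)).map Fin.castSuccEmb)
      else (B.supp (B.origAct (D.pos a) k)).map Fin.castSuccEmb) ↔
    D.addOrig a r ∈ H.supp (D.base (B.origAct (D.pos a) k)) ∧ D.addSel a k (D.addOrig a r) = r := by
  unfold addSel
  by_cases hk : B.K ≤ (k : ℕ)
  · have hs := D.sel_origAct a hk
    have hm := ((D.mem_supp _ _).1 (D.mem_supp_origAct a hk)).1
    rw [D.orig_pos] at hm
    refine Fin.lastCases ?_ (fun r => ?_) r
    · simp [hk, hm]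
    · by_cases hr : D.orig r = a
      · have : r ∈ B.supp (B.origAct (D.pos a) k) → r = D.pos a := fun h => by
          have := ((D.mem_supp _ _).1 h).2
          rw [hr, hs] at this
          exact this.symm
        simp [hk, hr, (Fin.castSucc_lt_last _).ne, (Fin.castSucc_lt_last _).ne']
        tauto
      · have hp : r ≠ D.pos a := fun h => hr (by rw [h, D.orig_pos])
        simp [hk, hr, hp, D.mem_supp, (Fin.castSucc_lt_last _).ne]
  · refine Fin.lastCases ?_ (fun r => ?_) r
    · simp [hk, (Fin.castSucc_lt_last _).ne]
    · simp [hk, D.mem_supp]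

theorem b_addCopy {t : ℕ} (ht : t < B.m) (ht' : t < H.m)
    (k : Fin (B.K + (B.users (D.pos a)).card)) (r : Fin (B.n + 1)) (l : ℕ) :
    Instance.useRow (D.pos a) (B.K ≤ (k : ℕ)) (B.b ⟨t, ht⟩ (B.origAct (D.pos a) k)) r l =
      if D.addSel a k (D.addOrig a r) = r then
        H.b ⟨t, ht'⟩ (D.base (B.origAct (D.pos a) k)) (D.addOrig a r) l else 0 := by
  rw [D.useRow_eq a k (B.b ⟨t, ht⟩ (B.origAct (D.pos a) k))
    (H.b ⟨t, ht'⟩ (D.base (B.origAct (D.pos a) k)))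
    (fun r => by
      funext l
      rw [D.b_eq t ht ht']
      by_cases h : D.sel (B.origAct (D.pos a) k) (D.orig r) = r <;> simp [h]) r]
  by_cases h : D.addSel a k (D.addOrig a r) = r <;> simp [h]

theorem law_addCopy {t : ℕ} (ht : t < B.m) (ht' : t < H.m)
    (k : Fin (B.K + (B.users (D.pos a)).card)) :
    (B.law ⟨t, ht⟩ (B.origAct (D.pos a) k)).map (B.copyOutcome (D.pos a) τ t k) =
      (H.law ⟨t, ht'⟩ (D.base (B.origAct (D.pos a) k))).map fun o =>
        (fun r => if D.addSel a k (D.addOrig a r) = r then o.1 (D.addOrig a r) else 0,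
          fun r => if ∃ i, t < D.addTau τ (D.addSel a k i) then 0 else o.2 (D.addOrig a r)) := by
  rw [D.law_eq_map_lift ht ht', Measure.map_map (B.measurable_copyOutcome _ _ _ _)
    (D.measurable_lift _ _)]
  congr 1
  funext o
  exact D.copyOutcome_lift a τ t k o

/-- A selection in the enlarged instance becomes one in `B` by sending the new copy back to `pos a`.
If the new copy was selected and `k` may consume `a`, the duplicate of the action found in `B` is
the right one. Otherwise that action itself is, as the selection outside the support is irrelevant.
-/
theorem exists_act_addCopy (k : Fin H.K) (f : Fin H.n → Fin (B.n + 1))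
    (hf : ∀ i, D.addOrig a (f i) = i) :
    ∃ k' : Fin (B.K + (B.users (D.pos a)).card), D.base (B.origAct (D.pos a) k') = k ∧
      ∀ i ∈ H.supp k, D.addSel a k' i = f i := by
  obtain ⟨k₁, hk₁, hs⟩ := D.exists_act k
    (fun i => Fin.lastCases (motive := fun _ => Fin B.n) (D.pos i) (fun r => r) (f i)) (fun i => by
      have := hf i
      revert this
      refine Fin.lastCases ?_ (fun r => ?_) (f i)
      · simp [D.orig_pos]
      · simp)
  have hs' : ∀ i ∈ H.supp k, f i ≠ Fin.last _ → Fin.castSucc (D.sel k₁ i) = f i := by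
    intro i hi hfi
    obtain ⟨r, hr⟩ := Fin.exists_castSucc_eq.2 hfi
    rw [hs i hi, ← hr]
    simp
  have hne : ∀ i, i ≠ a → f i ≠ Fin.last _ := by
    intro i hi hfi
    have := hf i
    rw [hfi, addOrig_last] at this
    exact hi this.symm
  by_cases hl : f a = Fin.last _ ∧ a ∈ H.supp k
  · have hmem : k₁ ∈ B.users (D.pos a) := by
      simp only [Instance.users, Finset.mem_filter, Finset.mem_univ, true_and, D.mem_supp, hk₁,
        D.orig_pos, hl.2]
      simp [hs a hl.2, hl.1]
    obtain ⟨q, hq⟩ : ∃ q, (B.users (D.pos a)).orderEmbOfFin rfl q = k₁ := by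
      have : k₁ ∈ Set.range ((B.users (D.pos a)).orderEmbOfFin rfl) := by
        rw [Finset.range_orderEmbOfFin]; exact hmem
      exact this
    have ho : B.origAct (D.pos a) (Fin.natAdd _ q) = k₁ := by simp [Instance.origAct, hq]
    refine ⟨Fin.natAdd _ q, by rw [ho, hk₁], fun i hi => ?_⟩
    unfold addSel
    by_cases hia : i = a
    · subst hia
      rw [if_pos ⟨by simp, rfl⟩, hl.1]
    · rw [if_neg (by tauto), ho]
      exact hs' i hi (hne i hia)
  · have ho : B.origAct (D.pos a) (Fin.castAdd _ k₁) = k₁ := by simp [Instance.origAct]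
    refine ⟨Fin.castAdd _ k₁, by rw [ho, hk₁], fun i hi => ?_⟩
    unfold addSel
    rw [if_neg (by simp), ho]
    refine hs' i hi fun hfi => ?_
    by_cases hia : i = a
    · subst hia
      exact hl ⟨hfi, hi⟩
    · exact hne i hia hfi

/-- Adding one more copy. -/
def addCopy : Copying H (B.addCopy (D.pos a) τ x) where
  orig := D.addOrig a
  tau := D.addTau τ
  pos := fun i => Fin.castSucc (D.pos i)
  base := fun k => D.base (B.origAct (D.pos a) k)
  sel := D.addSel a
  m_eq := D.m_eq
  zeta_eq := funext fun r => funext fun j => zeta_addCopy D.zeta_eq r j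
  orig_sel := D.addOrig_addSel a
  orig_pos := fun i => (D.addOrig_castSucc a _).trans (D.orig_pos i)
  tau_pos := fun i => (D.addTau_castSucc τ _).trans (D.tau_pos i)
  base_triv := by
    have : B.origAct (D.pos a) (Fin.castAdd _ B.k₀) = B.k₀ := by simp [Instance.origAct]
    exact (congrArg D.base this).trans D.base_triv
  sel_of_notMem := D.addSel_of_notMem a
  mem_supp := D.mem_supp_addCopy a
  b_eq := fun _ => D.b_addCopy a
  law_eq := fun _ => D.law_addCopy a τ
  exists_act := D.exists_act_addCopy a

end AddCopy

end Copying

/-! ### Enlarging an instance by a list of copies -/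

namespace Instance

namespace Ext

variable {N : Instance}

/-- One more copy. -/
def cons (X : Ext N) (e : Event N.n) : Ext N where
  inst := X.inst.addCopy (X.pos e.res) e.time e.size
  pos := fun i => Fin.castSucc (X.pos i)
  base := fun k => X.base (X.inst.origAct (X.pos e.res) k)
  lift := fun t k o =>
    X.inst.copyOutcome (X.pos e.res) e.time t k (X.lift t (X.inst.origAct (X.pos e.res) k) o)

theorem K_le_cons (X : Ext N) (e : Event N.n) : X.inst.K ≤ (X.cons e).inst.K :=
  Nat.le_add_right _ _

theorem action_cons (X : Ext N) (e : Event N.n) {v : ℕ} (hv : v < X.inst.K) :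
    (X.cons e).action v = Fin.castAdd (X.inst.users (X.pos e.res)).card (X.action v) := by
  have hv' : v < (X.cons e).inst.K := hv.trans_le (X.K_le_cons e)
  unfold action
  rw [dif_pos hv, dif_pos hv']
  rfl

theorem base_cons (X : Ext N) (e : Event N.n) {v : ℕ} (hv : v < X.inst.K) :
    (X.cons e).base ((X.cons e).action v) = X.base (X.action v) := by
  rw [X.action_cons e hv]
  change X.base (X.inst.origAct _ (Fin.castAdd _ _)) = _
  simp [origAct]

theorem visible_copyOutcome (B : Instance) (i : Fin B.n) (τ s t : ℕ) (k : Fin B.K)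
    (o : Outcome B.n) :
    visible s t (B.copyOutcome i τ s (Fin.castAdd (B.users i).card k) o) =
      B.copyOutcome i τ s (Fin.castAdd _ k) (visible s t o) := by
  have hk : ¬ B.K ≤ (k : ℕ) := by simp
  refine Prod.ext ?_ ?_
  · funext r l
    refine Fin.lastCases ?_ (fun r => ?_) r
    · simp [visible, copyOutcome, useRow, hk]
    · simp [visible, copyOutcome, useRow, hk]
  · funext r
    simp [visible, copyOutcome]

/-- Old actions keep their numbers, so past choices with old numbers give the same history with an
unused copy attached. This is the form in which `OnlineAlg.Consistent` presents histories. -/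
theorem history_cons (X : Ext N) (e : Event N.n) (t : ℕ) (past : ℕ → ℕ) (h : N.Hist)
    (hp : ∀ s < t, past s < X.inst.K) :
    (X.cons e).history t past h =
      X.inst.copyHist (X.pos e.res) e.time e.size (X.history t past h) := by
  funext s
  unfold history copyHist
  by_cases hs : s < t
  · simp only [if_pos hs]
    rw [X.action_cons e (hp s hs)]
    refine Prod.ext rfl ?_
    have : X.inst.origAct (X.pos e.res) (Fin.castAdd _ (X.action (past s))) = X.action (past s) := by
      simp [origAct]
    change visible s t (X.inst.copyOutcome _ _ _ _ (X.lift s (X.inst.origAct _ _) _)) = _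
    rw [this]
    exact visible_copyOutcome _ _ _ _ _ _ _
  -- Entries of requests not yet served are `(k₀, 0)` on both sides; the zero outcome remains zero
  -- after copying.
  · simp only [if_neg hs]
    refine Prod.ext rfl ?_
    have hk : ¬ X.inst.K ≤ ((Fin.castAdd (X.inst.users (X.pos e.res)).card X.inst.k₀ :
      Fin _) : ℕ) := by simp
    refine Prod.ext ?_ ?_
    · funext r
      refine Fin.lastCases ?_ (fun r => ?_) r
      · simp only [copyOutcome, useRow, hk, if_false]; simp; rfl
      · simp only [copyOutcome, useRow, hk, if_false]; simp; rfl
    · funext r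
      refine Fin.lastCases ?_ (fun r => ?_) r
      · simp only [copyOutcome, rewardRow, hk, if_false, false_and]; simp; rfl
      · simp only [copyOutcome, rewardRow, hk, if_false, false_and]; simp; rfl

/-- The copying relation `D` describes the extension `X` of `H.noRepl` by the events `es`. -/
structure Describes {H : Instance} (X : Ext H.noRepl) (es : List (Event H.n))
    (D : Copying H X.inst) : Prop where
  pos_eq : X.pos = D.pos
  base_eq : X.base = D.base
  lift_eq : X.lift = D.lift
  sum_c : ∀ i t, ∑ r with D.orig r = i ∧ D.tau r ≤ t, X.inst.c r =
    H.c i + (es.map fun e => if e.res = i ∧ e.time ≤ t then e.size else 0).sum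
  le_c : ∀ x : ℝ≥0, (∀ i, x ≤ H.c i) → (∀ e ∈ es, x ≤ e.size) → ∀ r, x ≤ X.inst.c r

theorem exists_describes_cons {H : Instance} (X : Ext H.noRepl) (es : List (Event H.n))
    (e : Event H.n) (h : ∃ D, X.Describes es D) : ∃ D, (X.cons e).Describes (e :: es) D := by
  obtain ⟨B, pos, base, lift⟩ := X
  obtain ⟨D, h⟩ := h
  change Copying H B at D
  -- Once the fields of `X` are those of `D`, positions and base actions of the larger extension
  -- agree with those of `D.addCopy` by definition.
  obtain rfl : pos = D.pos := h.pos_eq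
  obtain rfl : base = D.base := h.base_eq
  obtain rfl : lift = D.lift := h.lift_eq
  refine ⟨D.addCopy e.res e.time e.size, rfl, rfl, ?_, ?_, ?_⟩
  · funext t k o
    exact D.copyOutcome_lift e.res e.time t k o
  · intro i t
    have h1 := h.sum_c i t
    change ∑ r : Fin (B.n + 1) with D.addOrig e.res r = i ∧ D.addTau e.time r ≤ t,
      Fin.snoc (α := fun _ => ℝ≥0) B.c e.size r = _
    rw [Finset.sum_filter] at h1 ⊢
    rw [Fin.sum_univ_castSucc]
    simp only [Copying.addOrig_castSucc, Copying.addTau_castSucc, Fin.snoc_castSucc,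
      Copying.addOrig_last, Copying.addTau_last, Fin.snoc_last, List.map_cons, List.sum_cons]
    rw [h1, add_assoc, add_comm (List.sum _)]
  · intro x hx he r
    change x ≤ Fin.snoc (α := fun _ => ℝ≥0) B.c e.size r
    refine Fin.lastCases ?_ (fun r => ?_) r
    · simpa using he e (by simp)
    · simpa using h.le_c x hx (fun e' he' => he e' (by simp [he'])) r

end Ext

theorem exists_describes (H : Instance) (es : List (Event H.n)) :
    ∃ D, (H.noRepl.extend es).Describes es D := by
  induction es with
  | nil =>
    refine ⟨Copying.refl H, rfl, rfl, ?_, ?_, ?_⟩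
    · funext t k o
      exact (Copying.lift_refl H t k o).symm
    · intro i t
      change ∑ r : Fin H.n with r = i ∧ 0 ≤ t, H.c r = _
      simp [Finset.filter_eq']
    · exact fun x hx _ r => hx r
  | cons e es ih => exact Ext.exists_describes_cons _ es e ih

theorem extend_mem {F : Set Instance} (hF : ClosedFamily F) {N : Instance}
    (hN : N ∈ noReplPart F) (es : List (Event N.n)) (hes : ∀ e ∈ es, 0 < e.size) :
    (N.extend es).inst ∈ noReplPart F := by
  induction es with
  | nil => exact hN
  | cons e es ih =>
    have ih := ih fun e' he' => hes e' (by simp [he'])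
    exact ⟨hF.addCopy_mem _ ih _ _ _ (hes e (by simp)),
      funext fun r => funext fun j => Copying.zeta_addCopy ih.2 r j⟩

/-- Adding copies acts on each request separately, so it commutes with truncation. What ALG-B builds
from the requests seen so far is thus a truncation of an enlargement of the whole instance. -/
theorem extend_upTo (N : Instance) (es : List (Event N.n)) (T : ℕ) (hT : T ≤ N.m) :
    ∃ hT' : T ≤ (N.extend es).inst.m, (N.upTo T hT).extend es =
      ⟨(N.extend es).inst.upTo T hT', (N.extend es).pos, (N.extend es).base,
        (N.extend es).lift⟩ := by
  induction es with
  | nil => exact ⟨hT, rfl⟩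
  | cons e es ih =>
    obtain ⟨hT', ih⟩ := ih
    refine ⟨hT', ?_⟩
    change ((N.upTo T hT).extend es).cons e = _
    rw [ih]
    rfl

theorem K_le_extend_append (N : Instance) (es es' : List (Event N.n)) :
    (N.extend es).inst.K ≤ (N.extend (es' ++ es)).inst.K := by
  induction es' with
  | nil => exact le_rfl
  | cons e es' ih => exact ih.trans (Ext.K_le_cons _ e)

theorem base_extend_append (N : Instance) (es es' : List (Event N.n)) {v : ℕ}
    (hv : v < (N.extend es).inst.K) :
    (N.extend (es' ++ es)).base ((N.extend (es' ++ es)).action v) =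
      (N.extend es).base ((N.extend es).action v) := by
  induction es' with
  | nil => rfl
  | cons e es' ih =>
    exact (Ext.base_cons _ e (hv.trans_le (N.K_le_extend_append es es'))).trans ih

/-- Batches are listed latest first, so the copies unknown at request `t` form a prefix of the list.
Consistency peels them off one at a time. -/
theorem act_extend_append {A : OnlineAlg} {F : Set Instance} (hF : ClosedFamily F)
    (hA : A.Consistent F) {N : Instance} (hN : N ∈ noReplPart F) (es es' : List (Event N.n))
    (hes : ∀ e ∈ es' ++ es, 0 < e.size) {t : ℕ} (het : ∀ e ∈ es', t < e.time)
    (ht : t + 1 ≤ (N.extend es).inst.m) (ht' : t + 1 ≤ (N.extend (es' ++ es)).inst.m) (s : A.S)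
    (past : ℕ → ℕ) (hp : ∀ s < t, past s < (N.extend es).inst.K) (h : N.Hist) :
    (A.act ((N.extend (es' ++ es)).inst.upTo (t + 1) ht') s
        ((N.extend (es' ++ es)).history t past h) : ℕ) =
      A.act ((N.extend es).inst.upTo (t + 1) ht) s ((N.extend es).history t past h) := by
  induction es' with
  | nil => rfl
  | cons e es' ih =>
    have hes' : ∀ e ∈ es' ++ es, 0 < e.size := fun e' he' => hes e' (by
      rw [List.cons_append]; exact List.mem_cons_of_mem _ he')
    rw [← ih hes' (fun e' he' => het e' (by simp [he'])) ht']
    have hh := Ext.history_cons (N.extend (es' ++ es)) e t past h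
      (fun s hs => (hp s hs).trans_le (N.K_le_extend_append es es'))
    have hc := hA _ (extend_mem hF hN _ hes') ((N.extend (es' ++ es)).pos e.res) e.time e.size
      (hes e (by simp)) ⟨t, ht'⟩ (het e (by simp)) s ((N.extend (es' ++ es)).history t past h)
    rw [← hh] at hc
    exact congrArg Fin.val hc

end Instance

/-! ### Resampling -/

/-- This takes the place of conditional expectations: a quantity that does not change when one
coordinate is redrawn is independent of that coordinate. The preimage of a box is again a box, with
coordinate `i` freed and the new draw constrained in its stead. -/
theorem measurePreserving_resample {ι : Type*} [Fintype ι] [DecidableEq ι] {α : ι → Type*}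
    [∀ i, MeasurableSpace (α i)] (μ : ∀ i, Measure (α i)) [∀ i, IsProbabilityMeasure (μ i)]
    (i : ι) :
    MeasurePreserving (fun p : (∀ i, α i) × α i => Function.update p.1 i p.2)
      ((Measure.pi μ).prod (μ i)) (Measure.pi μ) := by
  have hm : Measurable (fun p : (∀ i, α i) × α i => Function.update p.1 i p.2) := by
    refine measurable_pi_lambda _ fun j => ?_
    by_cases h : j = i
    · subst h; simpa using measurable_snd
    · simp only [Function.update_of_ne h]; fun_prop
  refine ⟨hm, (Measure.pi_eq fun s hs => ?_).symm⟩
  rw [Measure.map_apply hm (MeasurableSet.univ_pi hs)]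
  have : (fun p : (∀ i, α i) × α i => Function.update p.1 i p.2) ⁻¹' Set.univ.pi s =
      (Set.univ.pi (Function.update s i Set.univ)) ×ˢ s i := by
    ext p
    simp only [Set.mem_preimage, Set.mem_univ_pi, Set.mem_prod]
    constructor
    · intro h
      refine ⟨fun j => ?_, by simpa using h i⟩
      by_cases hj : j = i
      · subst hj; simp
      · simpa [hj] using h j
    · rintro ⟨h1, h2⟩ j
      by_cases hj : j = i
      · subst hj; simpa using h2
      · simpa [hj] using h1 j
  rw [this, Measure.prod_prod, Measure.pi_pi, ← Finset.mul_prod_erase _ _ (Finset.mem_univ i),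
    ← Finset.mul_prod_erase (Finset.univ) (fun j => μ j (s j)) (Finset.mem_univ i)]
  simp only [Function.update_self, measure_univ, one_mul]
  rw [mul_comm]
  congr 1
  refine Finset.prod_congr rfl fun j hj => ?_
  rw [Function.update_of_ne (Finset.ne_of_mem_erase hj)]

/-- `W` is independent of `Z` and has the law `ν`. -/
def Fresh {Ω E O : Type*} [MeasurableSpace Ω] [MeasurableSpace E] [MeasurableSpace O]
    (P : Measure Ω) (Z : Ω → E) (W : Ω → O) (ν : Measure O) : Prop :=
  ∀ f : E × O → ℝ≥0∞, Measurable f → ∫⁻ ω, f (Z ω, W ω) ∂P = ∫⁻ ω, ∫⁻ o, f (Z ω, o) ∂ν ∂P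

section Fresh

variable {Ω E O : Type*} [MeasurableSpace Ω] [MeasurableSpace E] [MeasurableSpace O]
  {P : Measure Ω} {Z : Ω → E} {W : Ω → O}

theorem fresh_of_resample {ν : Measure O} [SFinite ν] {U : Ω × O → Ω}
    (hU : MeasurePreserving U (P.prod ν) P) (hZ : Measurable Z) (hW : Measurable W)
    (hZU : ∀ ω o, Z (U (ω, o)) = Z ω) (hWU : ∀ ω o, W (U (ω, o)) = o) : Fresh P Z W ν := by
  intro f hf
  have hfm : Measurable fun ω => f (Z ω, W ω) := hf.comp (hZ.prodMk hW)
  rw [← hU.lintegral_comp hfm, lintegral_prod]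
  · simp only [hZU, hWU]
  · exact (hfm.comp hU.measurable).aemeasurable

theorem Fresh.map {ν : Measure O} (h : Fresh P Z W ν) {O' : Type*} [MeasurableSpace O']
    {g : O → O'} (hg : Measurable g) : Fresh P Z (fun ω => g (W ω)) (ν.map g) := by
  intro f hf
  refine (h (fun p => f (p.1, g p.2)) (by fun_prop)).trans (lintegral_congr fun ω => ?_)
  rw [lintegral_map (by fun_prop) hg]

theorem fresh_prod_right {Ω' : Type*} [MeasurableSpace Ω'] {P' : Measure Ω'} [SFinite P]
    {Z : Ω' × Ω → E} {ν : Measure O} [SFinite ν] (hZ : Measurable Z) (hW : Measurable W)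
    (h : ∀ ω', Fresh P (fun ω => Z (ω', ω)) W ν) : Fresh (P'.prod P) Z (fun p => W p.2) ν := by
  intro f hf
  have hg : Measurable fun z => ∫⁻ o, f (Z z, o) ∂ν := hf.lintegral_prod_right'.comp hZ
  rw [lintegral_prod _ (by fun_prop), lintegral_prod _ hg.aemeasurable]
  exact lintegral_congr fun ω' => h ω' f hf

theorem fresh_prod_left {Ω' : Type*} [MeasurableSpace Ω'] {P' : Measure Ω'} [SFinite P]
    [SFinite P'] {Z : Ω × Ω' → E} {ν : Measure O} [SFinite ν] (hZ : Measurable Z)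
    (hW : Measurable W) (h : ∀ ω', Fresh P (fun ω => Z (ω, ω')) W ν) :
    Fresh (P.prod P') Z (fun p => W p.1) ν := by
  intro f hf
  have hg : Measurable fun z => ∫⁻ o, f (Z z, o) ∂ν := hf.lintegral_prod_right'.comp hZ
  rw [lintegral_prod_symm _ (by fun_prop), lintegral_prod_symm _ hg.aemeasurable]
  exact lintegral_congr fun ω' => h ω' f hf

/-- A random selection, based on `Z`, among finitely many fresh random variables. -/
theorem lintegral_fresh_select {J : Type*} [Fintype J] [MeasurableSpace J]
    [MeasurableSingletonClass J] (hZ : Measurable Z) {V : J → Ω → O} (hV : ∀ j, Measurable (V j))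
    {ν : J → Measure O} [∀ j, SFinite (ν j)] (hfresh : ∀ j, Fresh P Z (V j) (ν j))
    {sel : E → J} (hsel : Measurable sel) {f : E × O → ℝ≥0∞} (hf : Measurable f) :
    ∫⁻ ω, f (Z ω, V (sel (Z ω)) ω) ∂P = ∫⁻ ω, ∫⁻ o, f (Z ω, o) ∂(ν (sel (Z ω))) ∂P := by
  classical
  -- The integral is split according to the selected index. For each index a single fixed variable
  -- is involved, and its freshness applies.
  let g : J → E × O → ℝ≥0∞ := fun j p => if sel p.1 = j then f p else 0
  have hg : ∀ j, Measurable (g j) := fun j =>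
    Measurable.ite ((hsel.comp measurable_fst) (measurableSet_singleton j)) hf measurable_const
  calc ∫⁻ ω, f (Z ω, V (sel (Z ω)) ω) ∂P = ∫⁻ ω, ∑ j, g j (Z ω, V j ω) ∂P := by
        refine lintegral_congr fun ω => ?_
        simp [g]
    _ = ∑ j, ∫⁻ ω, g j (Z ω, V j ω) ∂P :=
        lintegral_finsetSum _ fun j _ => (hg j).comp (hZ.prodMk (hV j))
    _ = ∑ j, ∫⁻ ω, ∫⁻ o, g j (Z ω, o) ∂(ν j) ∂P :=
        Finset.sum_congr rfl fun j _ => hfresh j _ (hg j)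
    _ = ∫⁻ ω, ∑ j, ∫⁻ o, g j (Z ω, o) ∂(ν j) ∂P :=
        (lintegral_finsetSum _ fun j _ => ((hg j).lintegral_prod_right').comp hZ).symm
    _ = _ := by
        refine lintegral_congr fun ω => ?_
        rw [Finset.sum_eq_single (sel (Z ω))]
        · simp [g]
        · intro j _ hj
          simp [g, hj.symm]
        · simp

end Fresh

/-! ### Histories -/

namespace Instance

variable {H : Instance}

instance : IsProbabilityMeasure H.sampleMeasure := by
  unfold sampleMeasure; infer_instance

theorem measurable_visible {n : ℕ} (s t : ℕ) : Measurable (visible (n := n) s t) := by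
  unfold visible
  refine Measurable.prodMk ?_ measurable_snd
  refine measurable_pi_lambda _ fun i => measurable_pi_lambda _ fun l => ?_
  split_ifs <;> fun_prop

theorem measurable_observe (H : Instance) (t : ℕ) : Measurable (H.observe t) := by
  unfold observe
  refine measurable_pi_lambda _ fun s => ?_
  exact (by fun_prop : Measurable fun h : H.Hist => (h s).1).prodMk
    ((measurable_visible s t).comp (by fun_prop))

theorem visible_visible {n : ℕ} {s t t' : ℕ} (h : t ≤ t') (o : Outcome n) :
    visible s t (visible s t' o) = visible s t o := by
  refine Prod.ext ?_ rfl
  funext i l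
  simp only [visible]
  split_ifs with h1 h2
  · rfl
  · omega
  · rfl

theorem observe_observe (H : Instance) {t t' : ℕ} (h : t ≤ t') (x : H.Hist) :
    H.observe t (H.observe t' x) = H.observe t x := by
  funext s
  exact Prod.ext rfl (visible_visible h _)

theorem hist_succ (δ : Fin H.m → H.Hist → Fin H.K) (ω : H.Sample) {t : ℕ} (ht : t < H.m) :
    H.hist δ ω (t + 1) = Function.update (H.hist δ ω t) t
        (H.chosen δ ω ⟨t, ht⟩, ω (⟨t, ht⟩, H.chosen δ ω ⟨t, ht⟩)) := by
  rw [hist, dif_pos ht]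
  rfl

theorem hist_apply (δ : Fin H.m → H.Hist → Fin H.K) (ω : H.Sample) {s t : ℕ} (hst : s < t)
    (htm : t ≤ H.m) :
    H.hist δ ω t s = (H.chosen δ ω ⟨s, hst.trans_le htm⟩,
      ω (⟨s, hst.trans_le htm⟩, H.chosen δ ω ⟨s, hst.trans_le htm⟩)) := by
  induction t with
  | zero => omega
  | succ t ih =>
    rw [hist_succ δ ω (by omega)]
    by_cases h : s = t
    · subst h; simp
    · rw [Function.update_of_ne h]
      exact ih (by omega) (by omega)

/-- The outcomes of request `p.1` enter the history only at time `p.1 + 1`. With resampling, this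
makes them fresh relative to the history before the request. -/
theorem hist_update_sample (δ : Fin H.m → H.Hist → Fin H.K) (ω : H.Sample) (p : Fin H.m × Fin H.K)
    (o : Outcome H.n) {t : ℕ} (ht : t ≤ p.1) :
    H.hist δ (Function.update ω p o) t = H.hist δ ω t := by
  induction t with
  | zero => rfl
  | succ t ih =>
    have h' : t < H.m := by omega
    rw [hist_succ _ _ h', hist_succ _ _ h']
    have hc : H.chosen δ (Function.update ω p o) ⟨t, h'⟩ = H.chosen δ ω ⟨t, h'⟩ := by
      unfold chosen
      rw [ih (by omega)]
    rw [hc, ih (by omega), Function.update_of_ne]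
    rintro rfl
    simp at ht

theorem measurable_eval_sample (t : Fin H.m) :
    Measurable fun p : H.Sample × Fin H.K => p.1 (t, p.2) :=
  measurable_from_prod_countable_left fun k => measurable_pi_apply (t, k)

theorem measurable_update_hist (t : ℕ) :
    Measurable fun p : H.Hist × (Fin H.K × Outcome H.n) => Function.update p.1 t p.2 := by
  refine measurable_pi_lambda _ fun s => ?_
  by_cases h : s = t
  · subst h; simpa using measurable_snd
  · simp only [Function.update_of_ne h]; fun_prop

section Measurability

variable {S : Type*} [MeasurableSpace S] {act : Fin H.m → S → H.Hist → Fin H.K}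

theorem measurable_hist (hact : ∀ t, Measurable fun p : S × H.Hist => act t p.1 p.2) (t : ℕ) :
    Measurable fun p : S × H.Sample => H.hist (fun t => act t p.1) p.2 t := by
  induction t with
  | zero => exact measurable_const
  | succ t ih =>
    simp only [hist]
    split_ifs with ht
    · have hk : Measurable fun p : S × H.Sample =>
          act ⟨t, ht⟩ p.1 (H.observe t (H.hist (fun t => act t p.1) p.2 t)) :=
        (hact ⟨t, ht⟩).comp (measurable_fst.prodMk ((H.measurable_observe t).comp ih))
      exact (measurable_update_hist t).comp (ih.prodMk (hk.prodMk
        ((measurable_eval_sample ⟨t, ht⟩).comp (measurable_snd.prodMk hk))))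
    · exact ih

end Measurability

theorem measurable_hist_of {δ : Fin H.m → H.Hist → Fin H.K} (hδ : ∀ t, Measurable (δ t)) (t : ℕ) :
    Measurable fun ω : H.Sample => H.hist δ ω t :=
  (measurable_hist (S := Unit) (act := fun t _ => δ t)
    (fun t => (hδ t).comp measurable_snd) t).comp ((measurable_const (a := ())).prodMk measurable_id)

theorem fresh_sample {E : Type*} [MeasurableSpace E] {Z : H.Sample → E} (hZ : Measurable Z)
    (p : Fin H.m × Fin H.K) (hZp : ∀ ω o, Z (Function.update ω p o) = Z ω) :
    Fresh H.sampleMeasure Z (fun ω => ω p) (H.law p.1 p.2) := by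
  exact fresh_of_resample (measurePreserving_resample (fun p => H.law p.1 p.2) p) hZ
    (measurable_pi_apply p) hZp (fun ω o => by simp)

/-- Conditioning on the history before request `t`. -/
theorem lintegral_hist_succ {δ : Fin H.m → H.Hist → Fin H.K} (hδ : ∀ t, Measurable (δ t)) {t : ℕ}
    (ht : t < H.m) {f : H.Hist → ℝ≥0∞} (hf : Measurable f) :
    ∫⁻ ω, f (H.hist δ ω (t + 1)) ∂H.sampleMeasure =
      ∫⁻ ω, ∫⁻ o, f (Function.update (H.hist δ ω t) t (H.chosen δ ω ⟨t, ht⟩, o))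
        ∂(H.law ⟨t, ht⟩ (H.chosen δ ω ⟨t, ht⟩)) ∂H.sampleMeasure := by
  have hsel : Measurable fun h : H.Hist => δ ⟨t, ht⟩ (H.observe t h) :=
    (hδ _).comp (H.measurable_observe t)
  have h := lintegral_fresh_select (P := H.sampleMeasure) (Z := fun ω => H.hist δ ω t)
    (V := fun k ω => ω (⟨t, ht⟩, k)) (ν := fun k => H.law ⟨t, ht⟩ k)
    (measurable_hist_of hδ t) (fun k => measurable_pi_apply _)
    (fun k => fresh_sample (measurable_hist_of hδ t) (⟨t, ht⟩, k)
      fun ω o => hist_update_sample δ ω _ o le_rfl)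
    hsel (f := fun p => f (Function.update p.1 t (δ ⟨t, ht⟩ (H.observe t p.1), p.2)))
    (hf.comp ((measurable_update_hist t).comp (measurable_fst.prodMk
      ((hsel.comp measurable_fst).prodMk measurable_snd))))
  simp only [hist_succ δ _ ht]
  exact h

theorem measurable_lintegral_step {k : H.Hist → Fin H.K} (hk : Measurable k) (t : Fin H.m)
    {f : H.Hist → ℝ≥0∞} (hf : Measurable f) :
    Measurable fun h : H.Hist => ∫⁻ o, f (Function.update h t (k h, o)) ∂(H.law t (k h)) := by
  have : Measurable fun p : H.Hist × Fin H.K =>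
      ∫⁻ o, f (Function.update p.1 t (p.2, o)) ∂(H.law t p.2) := by
    refine measurable_from_prod_countable_left fun k => ?_
    refine Measurable.lintegral_prod_right' (ν := H.law t k) (f := fun p : H.Hist × Outcome H.n =>
      f (Function.update p.1 t (k, p.2))) ?_
    exact hf.comp ((measurable_update_hist t).comp (measurable_fst.prodMk
      (measurable_const.prodMk measurable_snd)))
  exact this.comp (measurable_id.prodMk hk)

/-- Rewards are read off from the final history because the couplings below compare laws of
histories, not of samples. -/
theorem Policy.value_eq (π : H.Policy) :
    π.value = ⨅ i, ∫⁻ x, ∑ t : Fin H.m,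
      (((H.hist (fun t => π.act t x.1) x.2 H.m t).2.2 i : ℝ≥0) : ℝ≥0∞) ∂π.joint := by
  unfold Policy.value
  refine iInf_congr fun i => lintegral_congr fun x => Finset.sum_congr rfl fun t _ => ?_
  rw [hist_apply _ _ t.isLt le_rfl]
  rfl

/-- Consumptions are almost surely two-point and non-increasing. -/
theorem ae_sample (H : Instance) : ∀ᵐ ω ∂H.sampleMeasure, ∀ (t : Fin H.m) (k : Fin H.K),
    (∀ (i : Fin H.n) (l : ℕ), (t : ℕ) ≤ l → (ω (t, k)).1 i l = 0 ∨ (ω (t, k)).1 i l = H.b t k i l) ∧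
    ∀ (i : Fin H.n) (l l' : ℕ), (t : ℕ) ≤ l → l ≤ l' → (ω (t, k)).1 i l' ≤ (ω (t, k)).1 i l := by
  rw [ae_all_iff]; intro t
  rw [ae_all_iff]; intro k
  have hp : MeasurePreserving (Function.eval (t, k)) H.sampleMeasure (H.law t k) :=
    measurePreserving_eval (fun p : Fin H.m × Fin H.K => H.law p.1 p.2) (t, k)
  have := hp.quasiMeasurePreserving.ae ((H.two_point t k).and (H.antitone t k))
  exact this

end Instance

/-! ### Imitating a decision rule for a copied instance -/

namespace Copying

variable {H B : Instance} (D : Copying H B)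

theorem lift_visible (s t : ℕ) (k : Fin B.K) (o : Outcome H.n) :
    D.lift s k (Instance.visible s t o) = Instance.visible s t (D.lift s k o) := by
  refine Prod.ext ?_ rfl
  funext r l
  simp only [lift, Instance.visible]
  by_cases h : D.sel k (D.orig r) = r <;> by_cases h' : s ≤ l ∧ l ≤ t <;> simp [h, h']

/-- If a decision rule for `H` imitates one for `B`, through a translation `L` of histories, then
the histories in `B` have the law of the translated histories in `H`. -/
theorem lintegral_hist_translate {δB : Fin B.m → B.Hist → Fin B.K} {δH : Fin H.m → H.Hist → Fin H.K}
    (hδB : ∀ t, Measurable (δB t)) (hδH : ∀ t, Measurable (δH t)) {L : ℕ → H.Hist → B.Hist}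
    (hLm : ∀ t, Measurable (L t)) (hL0 : L 0 (fun _ => (H.k₀, 0)) = fun _ => (B.k₀, 0))
    (hδ : ∀ t (ht : t < H.m) (ht' : t < B.m) (h : H.Hist),
      δH ⟨t, ht⟩ (H.observe t h) = D.base (δB ⟨t, ht'⟩ (B.observe t (L t h))))
    (hL : ∀ t (ht' : t < B.m) (h : H.Hist) (k : Fin H.K) (o : Outcome H.n),
      L (t + 1) (Function.update h t (k, o)) =
        Function.update (L t h) t (δB ⟨t, ht'⟩ (B.observe t (L t h)),
          D.lift t (δB ⟨t, ht'⟩ (B.observe t (L t h))) o))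
    {t : ℕ} (ht : t ≤ H.m) {f : B.Hist → ℝ≥0∞} (hf : Measurable f) :
    ∫⁻ ω, f (B.hist δB ω t) ∂B.sampleMeasure = ∫⁻ ω, f (L t (H.hist δH ω t)) ∂H.sampleMeasure := by
  induction t generalizing f with
  | zero =>
    simp [Instance.hist, hL0]
  | succ t ih =>
    have ht' : t < B.m := by rw [D.m_eq]; omega
    rw [Instance.lintegral_hist_succ hδB ht' hf,
      Instance.lintegral_hist_succ hδH ht (f := fun h => f (L (t + 1) h)) (hf.comp (hLm _))]
    -- The induction hypothesis is applied to the conditional expectation of `f` given the history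
    -- before request `t`, itself a measurable function of that history.
    refine (ih (by omega) (f := fun h => ∫⁻ o, f (Function.update h t
      (δB ⟨t, ht'⟩ (B.observe t h), o)) ∂(B.law ⟨t, ht'⟩ (δB ⟨t, ht'⟩ (B.observe t h))))
      (Instance.measurable_lintegral_step ((hδB _).comp (B.measurable_observe t)) _ hf)).trans ?_
    refine lintegral_congr fun ω => ?_
    rw [D.law_eq_map_lift ht' ht, lintegral_map _ (D.measurable_lift _ _)]
    · rw [show H.chosen δH ω ⟨t, ht⟩ = _ from hδ t ht ht' _]
      refine lintegral_congr fun o => ?_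
      rw [hL t ht']
    · exact hf.comp ((Instance.measurable_update_hist t).comp (measurable_const.prodMk
        (measurable_const.prodMk measurable_id)))

end Copying

namespace Instance

/-! ### Batches -/

variable (H : Instance)

/-- The batches formed before request `T`, latest first. -/
def batchesTo (T : ℕ) : List (Event H.n) :=
  ((List.range T).flatMap fun j => (List.finRange H.n).filterMap fun i =>
    if H.threshold ≤ H.pending i j + H.zetaAt i j then
      some ⟨i, j, H.pending i j + H.zetaAt i j⟩
    else none).reverse

theorem batchesTo_succ (T : ℕ) : H.batchesTo (T + 1) =
    ((List.finRange H.n).filterMap fun i =>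
      if H.threshold ≤ H.pending i T + H.zetaAt i T then
        some (⟨i, T, H.pending i T + H.zetaAt i T⟩ : Event H.n)
      else none).reverse ++ H.batchesTo T := by
  simp [batchesTo, List.range_succ, List.flatMap_append]

theorem le_size_of_mem_batchesTo {T : ℕ} {e : Event H.n} (he : e ∈ H.batchesTo T) :
    H.threshold ≤ e.size := by
  simp only [batchesTo, List.mem_reverse, List.mem_flatMap, List.mem_filterMap] at he
  obtain ⟨j, _, i, _, h⟩ := he
  split_ifs at h with hh
  cases h
  exact hh

theorem exists_batchesTo_eq {T T' : ℕ} (h : T ≤ T') :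
    ∃ es', H.batchesTo T' = es' ++ H.batchesTo T ∧ ∀ e ∈ es', T ≤ e.time := by
  induction T', h using Nat.le_induction with
  | base => exact ⟨[], rfl, by simp⟩
  | succ T' hT ih =>
    obtain ⟨es', h1, h2⟩ := ih
    refine ⟨_ ++ es', by rw [batchesTo_succ, h1, List.append_assoc], fun e he => ?_⟩
    rw [List.mem_append] at he
    rcases he with he | he
    · simp only [List.mem_reverse, List.mem_filterMap] at he
      obtain ⟨i, _, h⟩ := he
      split_ifs at h with hh
      cases h
      exact hT
    · exact h2 e he

theorem zetaAt_upTo {T j : ℕ} (hT : T ≤ H.m) (hj : j < T) (i : Fin H.n) :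
    (H.upTo T hT).zetaAt i j = H.zetaAt i j := by
  have h1 : j < (H.upTo T hT).m := hj
  unfold zetaAt
  rw [dif_pos h1, dif_pos (hj.trans_le hT)]
  rfl

/-- The recursion reads only earlier replenishment, and the threshold depends only on initial
inventories, so truncation has no effect. -/
theorem pending_upTo {T j : ℕ} (hT : T ≤ H.m) (hj : j ≤ T) (i : Fin H.n) :
    (H.upTo T hT).pending i j = H.pending i j := by
  induction j with
  | zero => rfl
  | succ j ih =>
    exact congrArg (fun y => if H.threshold ≤ y then 0 else y)
      (congrArg₂ (· + ·) (ih (by omega)) (H.zetaAt_upTo hT (by omega) i))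

theorem batches_upTo {T : ℕ} (hT : T ≤ H.m) : (H.upTo T hT).batches = H.batchesTo T := by
  unfold batches batchesTo
  congr 1
  refine List.flatMap_congr fun j hj => ?_
  have hj : j < T := List.mem_range.1 hj
  refine List.filterMap_congr fun i _ => ?_
  exact congrArg (fun y => if H.threshold ≤ y then some (⟨i, j, y⟩ : Event H.n) else none)
    (congrArg₂ (· + ·) (H.pending_upTo hT hj.le i) (H.zetaAt_upTo hT hj i))

theorem batched_upTo {T : ℕ} (hT : T ≤ H.m) :
    ∃ hT' : T ≤ (H.noRepl.extend (H.batchesTo T)).inst.m, (H.upTo T hT).batched =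
      ⟨(H.noRepl.extend (H.batchesTo T)).inst.upTo T hT', (H.noRepl.extend (H.batchesTo T)).pos,
        (H.noRepl.extend (H.batchesTo T)).base, (H.noRepl.extend (H.batchesTo T)).lift⟩ := by
  obtain ⟨hT', h⟩ := H.noRepl.extend_upTo (H.batchesTo T) T hT
  exact ⟨hT', (congrArg (fun es => (H.upTo T hT).noRepl.extend es) (H.batches_upTo hT)).trans h⟩

end Instance

namespace Instance

theorem history_observe (H : Instance) {t t' : ℕ} (h : t ≤ t') (past : ℕ → ℕ) (x : H.Hist) :
    H.batched.history t past (H.observe t' x) = H.batched.history t past x := by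
  obtain ⟨D, hD⟩ := H.exists_describes H.batches
  have hl : H.batched.lift = D.lift := hD.lift_eq
  funext s
  unfold Ext.history
  split_ifs with hs
  · refine Prod.ext rfl ?_
    change visible s t (H.batched.lift s _ (visible s t' (x s).2)) = visible s t _
    rw [hl]
    erw [D.lift_visible]
    exact visible_visible h _
  · rfl

end Instance

/-! ### ALG-B makes the choices of ALG on the complete batched instance -/

namespace OnlineAlg

open Instance

variable (A : OnlineAlg) {F : Set Instance} {H : Instance}

theorem batchPast_apply (H : Instance) (σ : A.S) (h : H.Hist) {t s : ℕ} (hts : s < t) :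
    A.batchPast H σ h t s = A.batchChoice H σ h s (A.batchPast H σ h s) := by
  induction t with
  | zero => omega
  | succ t ih =>
    rw [batchPast]
    by_cases hs : s = t
    · subst hs; simp
    · rw [Function.update_of_ne hs]
      exact ih (by omega)

theorem batchChoice_congr (H : Instance) (σ : A.S) {h h' : H.Hist} {t : ℕ} (past : ℕ → ℕ)
    (hh : ∀ s < t, h s = h' s) : A.batchChoice H σ h t past = A.batchChoice H σ h' t past := by
  unfold batchChoice
  split_ifs with ht
  · have : (H.upTo (t + 1) ht).batched.history t past h =
        (H.upTo (t + 1) ht).batched.history t past h' := by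
      funext s
      unfold Ext.history
      split_ifs with hs
      · rw [hh s hs]
      · rfl
    exact congrArg (fun x => (A.act _ σ x : ℕ)) this
  · rfl

theorem batchPast_congr (H : Instance) (σ : A.S) {h h' : H.Hist} {t : ℕ}
    (hh : ∀ s < t, h s = h' s) : A.batchPast H σ h t = A.batchPast H σ h' t := by
  induction t with
  | zero => rfl
  | succ t ih =>
    rw [batchPast, batchPast, ih fun s hs => hh s (by omega),
      A.batchChoice_congr H σ _ fun s hs => hh s (by omega)]

/-- At every request ALG-B recomputes all its earlier choices from the truncated instance and the
observed history. The recomputation is harmless: it involves only requests and outcomes that were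
already visible when the choice was made. -/
theorem batchChoice_upTo {T : ℕ} (hT : T ≤ H.m) (σ : A.S) {h h' : H.Hist} {t t' : ℕ} (ht : t < T)
    (ht' : t ≤ t') (hh : H.observe t' h' = H.observe t' h) (past : ℕ → ℕ) :
    A.batchChoice (H.upTo T hT) σ h' t past = A.batchChoice H σ h t past := by
  have h1 : t < (H.upTo T hT).m := ht
  have h2 : t < H.m := ht.trans_le hT
  unfold batchChoice
  rw [dif_pos h1, dif_pos h2]
  refine congrArg (fun x => (A.act (H.upTo (t + 1) h2).batched.inst σ x : ℕ)) ?_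
  refine ((H.upTo (t + 1) h2).history_observe ht' past h').symm.trans ?_
  refine Eq.trans ?_ ((H.upTo (t + 1) h2).history_observe ht' past h)
  exact congrArg ((H.upTo (t + 1) h2).batched.history t past) hh

theorem batchPast_upTo {T : ℕ} (hT : T ≤ H.m) (σ : A.S) {h h' : H.Hist} {t t' : ℕ} (ht : t ≤ T)
    (ht' : t ≤ t' + 1) (hh : H.observe t' h' = H.observe t' h) :
    A.batchPast (H.upTo T hT) σ h' t = A.batchPast H σ h t := by
  induction t with
  | zero => rfl
  | succ t ih =>
    change Function.update (A.batchPast (H.upTo T hT) σ h' t) t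
      (A.batchChoice (H.upTo T hT) σ h' t (A.batchPast (H.upTo T hT) σ h' t)) =
      Function.update (A.batchPast H σ h t) t (A.batchChoice H σ h t (A.batchPast H σ h t))
    rw [ih (by omega) (by omega), A.batchChoice_upTo hT σ (by omega) (by omega) hh]

theorem batchChoice_lt (σ : A.S) (h : H.Hist) {t : ℕ} (ht : t < H.m) (past : ℕ → ℕ) :
    A.batchChoice H σ h t past < (H.noRepl.extend (H.batchesTo (t + 1))).inst.K := by
  obtain ⟨hT, hX⟩ := H.batched_upTo (T := t + 1) ht
  have hK : (H.upTo (t + 1) ht).batched.inst.K = (H.noRepl.extend (H.batchesTo (t + 1))).inst.K := by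
    rw [hX]; rfl
  rw [← hK]
  unfold batchChoice
  rw [dif_pos ht]
  exact Fin.isLt _

theorem K_mono {T T' : ℕ} (h : T ≤ T') : (H.noRepl.extend (H.batchesTo T)).inst.K ≤
    (H.noRepl.extend (H.batchesTo T')).inst.K := by
  obtain ⟨es', h1, _⟩ := H.exists_batchesTo_eq h
  rw [h1]
  exact H.noRepl.K_le_extend_append (H.batchesTo T) es'

theorem batchPast_lt (σ : A.S) (h : H.Hist) {t s : ℕ} (ht : t ≤ H.m) (hst : s < t) :
    A.batchPast H σ h t s < (H.noRepl.extend (H.batchesTo t)).inst.K := by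
  rw [A.batchPast_apply H σ h hst]
  exact (A.batchChoice_lt σ h (by omega) _).trans_le (K_mono (by omega))

/-- The choice on the batched instance as known at request `t` is the choice on the complete
batched instance. -/
theorem batchChoice_eq (hF : ClosedFamily F) (hA : A.Consistent F) (hH : H ∈ F)
    (hthr : 0 < H.threshold) (σ : A.S) (h : H.Hist) {t : ℕ} (ht : t < H.m)
    (ht' : t + 1 ≤ H.batched.inst.m) :
    A.batchChoice H σ h t (A.batchPast H σ h t) = A.act (H.batched.inst.upTo (t + 1) ht') σ
      (H.batched.history t (A.batchPast H σ h t) h) := by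
  obtain ⟨hT, hX⟩ := H.batched_upTo (T := t + 1) ht
  have h1 : A.batchChoice H σ h t (A.batchPast H σ h t) =
      A.act ((H.noRepl.extend (H.batchesTo (t + 1))).inst.upTo (t + 1) hT) σ
        ((H.noRepl.extend (H.batchesTo (t + 1))).history t (A.batchPast H σ h t) h) := by
    unfold batchChoice
    rw [dif_pos ht]
    exact congrArg (fun X : Ext (H.upTo (t + 1) ht).noRepl =>
      (A.act X.inst σ (X.history t (A.batchPast H σ h t) h) : ℕ)) hX
  rw [h1]
  -- The batches unknown at request `t` were formed at requests `≥ t + 1`, so consistency removes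
  -- them.
  obtain ⟨es', he, hes'⟩ := H.exists_batchesTo_eq (T := t + 1) (T' := H.m) ht
  have hN : H.noRepl ∈ noReplPart F := ⟨hF.noRepl_mem H hH, rfl⟩
  have h2 := act_extend_append (A := A) hF hA hN (H.batchesTo (t + 1)) es'
    (fun e hem => by
      have : e ∈ H.batchesTo H.m := by rw [he]; exact hem
      exact hthr.trans_le (H.le_size_of_mem_batchesTo this))
    (t := t) (fun e hem => hes' e hem) hT (ht'.trans_eq
      (congrArg (fun es : List (Event H.n) => (H.noRepl.extend es).inst.m) he)) σ (A.batchPast H σ h t)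
    (fun s hs => (A.batchPast_lt σ h ht.le hs).trans_le (K_mono (by omega))) h
  rw [← h2]
  -- The list is generalised so that the equation can be substituted in the types that depend on it.
  have : ∀ (es : List (Event H.n)) (_ : es = H.batches)
      (hes : t + 1 ≤ (H.noRepl.extend es).inst.m),
      (A.act ((H.noRepl.extend es).inst.upTo (t + 1) hes) σ
        ((H.noRepl.extend es).history t (A.batchPast H σ h t) h) : ℕ) =
      A.act (H.batched.inst.upTo (t + 1) ht') σ
        (H.batched.history t (A.batchPast H σ h t) h) := by
    rintro _ rfl _
    rfl
  exact this _ he.symm _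

theorem action_batchChoice (hF : ClosedFamily F) (hA : A.Consistent F) (hH : H ∈ F)
    (hthr : 0 < H.threshold) (σ : A.S) (h : H.Hist) {t : ℕ} (ht : t < H.m)
    (ht' : t + 1 ≤ H.batched.inst.m) :
    H.batched.action (A.batchChoice H σ h t (A.batchPast H σ h t)) =
      A.act (H.batched.inst.upTo (t + 1) ht') σ
        (H.batched.history t (A.batchPast H σ h t) h) := by
  rw [A.batchChoice_eq hF hA hH hthr σ h ht ht']
  exact (dif_pos (Fin.isLt _))

/-- The decision of the batching extension. -/
theorem batching_act (σ : A.S) {h h' : H.Hist} {t : ℕ} (ht : t < H.m)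
    (hh : H.observe t h' = H.observe t h) :
    A.batching.act (H.upTo (t + 1) ht) σ h' =
      H.batched.base (H.batched.action (A.batchChoice H σ h t (A.batchPast H σ h t))) := by
  have h0 : 0 < (H.upTo (t + 1) ht).m := Nat.succ_pos t
  have h1 : A.batching.act (H.upTo (t + 1) ht) σ h' =
      (H.upTo (t + 1) ht).batched.base ((H.upTo (t + 1) ht).batched.action
        (A.batchChoice (H.upTo (t + 1) ht) σ h' t
          (A.batchPast (H.upTo (t + 1) ht) σ h' t))) :=
    if_pos (e := (H.upTo (t + 1) ht).k₀) h0
  rw [h1, A.batchPast_upTo ht σ (by omega) (by omega) hh,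
    A.batchChoice_upTo ht σ (by omega) le_rfl hh]
  obtain ⟨hT, hX⟩ := H.batched_upTo (T := t + 1) ht
  have h2 : ∀ v, (H.upTo (t + 1) ht).batched.base ((H.upTo (t + 1) ht).batched.action v) =
      (H.noRepl.extend (H.batchesTo (t + 1))).base
        ((H.noRepl.extend (H.batchesTo (t + 1))).action v) := fun v =>
    congrArg (fun X : Ext (H.upTo (t + 1) ht).noRepl => X.base (X.action v)) hX
  rw [h2]
  obtain ⟨es', he, hes'⟩ := H.exists_batchesTo_eq (T := t + 1) (T' := H.m) ht
  have h3 := H.noRepl.base_extend_append (H.batchesTo (t + 1)) es'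
    (A.batchChoice_lt σ h ht (A.batchPast H σ h t))
  refine h3.symm.trans ?_
  exact congrArg (fun es : List (Event H.n) => (H.noRepl.extend es).base
    ((H.noRepl.extend es).action (A.batchChoice H σ h t (A.batchPast H σ h t)))) he.symm

end OnlineAlg

/-! ### Inventory held by the batches -/

theorem sum_map_filterMap {α β M : Type*} [AddCommMonoid M] (l : List α) (f : α → Option β)
    (g : β → M) : ((l.filterMap f).map g).sum = (l.map fun a => (f a).elim 0 g).sum := by
  induction l with
  | nil => rfl
  | cons a l ih =>
    cases h : f a <;> simp [h, ih]

namespace Instance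

variable (H : Instance)

theorem sum_batchesTo (i : Fin H.n) (t T : ℕ) :
    ((H.batchesTo T).map fun e => if e.res = i ∧ e.time ≤ t then e.size else 0).sum =
      ∑ j ∈ Finset.range T, if j ≤ t ∧ H.threshold ≤ H.pending i j + H.zetaAt i j then
        H.pending i j + H.zetaAt i j else 0 := by
  induction T with
  | zero => rfl
  | succ T ih =>
    rw [batchesTo_succ, List.map_append, List.sum_append, ih, Finset.sum_range_succ, add_comm]
    congr 1
    rw [List.map_reverse, List.sum_reverse, sum_map_filterMap, ← Fin.sum_univ_def,
      Finset.sum_eq_single i]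
    · by_cases h1 : H.threshold ≤ H.pending i T + H.zetaAt i T <;> by_cases h2 : T ≤ t <;>
        simp [h1, h2]
    · intro r _ hr
      split_ifs <;> simp [hr]
    · simp

/-- Conservation: a request adds its replenishment to the pending amount, and a batch moves the
whole pending amount into a copy. -/
theorem sum_range_add_pending (i : Fin H.n) (T : ℕ) :
    (∑ j ∈ Finset.range T, if H.threshold ≤ H.pending i j + H.zetaAt i j then
      H.pending i j + H.zetaAt i j else 0) + H.pending i T =
      ∑ j ∈ Finset.range T, H.zetaAt i j := by
  induction T with
  | zero => simp [pending]
  | succ T ih =>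
    rw [Finset.sum_range_succ, Finset.sum_range_succ, ← ih, pending]
    split_ifs
    · ring
    · ring

theorem pending_lt (hthr : 0 < H.threshold) (i : Fin H.n) (T : ℕ) :
    H.pending i T < H.threshold := by
  cases T with
  | zero => simpa [pending] using hthr
  | succ T =>
    rw [pending]
    split_ifs with h
    · exact hthr
    · exact not_le.1 h

theorem sum_zetaAt (i : Fin H.n) (t : Fin H.m) :
    ∑ j ∈ Finset.range (t + 1), H.zetaAt i j =
      ∑ l ∈ Finset.univ.filter (fun l : Fin H.m => l ≤ t), H.zeta i l := by
  symm
  refine Finset.sum_bij (fun l _ => (l : ℕ)) ?_ ?_ ?_ ?_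
  · intro l hl
    have hl : (l : ℕ) ≤ t := (Finset.mem_filter.1 hl).2
    exact Finset.mem_range.2 (by omega)
  · intro a _ b _ h
    exact Fin.ext h
  · intro j hj
    have hj : j < t + 1 := Finset.mem_range.1 hj
    have hjm : j < H.m := by omega
    have hjt : (⟨j, hjm⟩ : Fin H.m) ≤ t := Nat.le_of_lt_succ hj
    exact ⟨⟨j, hjm⟩, by simp [hjt], rfl⟩
  · intro l _
    simp [zetaAt]

/-- The inventory of the copies that are available at request `t` and the replenishment that has not
been batched amount to the inventory that has arrived up to request `t`. -/
theorem sum_c_add_pending {D : Copying H H.batched.inst} (hD : H.batched.Describes H.batches D)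
    (i : Fin H.n) (t : Fin H.m) :
    (∑ r with D.orig r = i ∧ D.tau r ≤ t, H.batched.inst.c r) + H.pending i (t + 1) =
      H.c i + ∑ l ∈ Finset.univ.filter (fun l : Fin H.m => l ≤ t), H.zeta i l := by
  rw [hD.sum_c, ← H.sum_zetaAt i t, ← H.sum_range_add_pending i (t + 1), add_assoc]
  congr 2
  refine (H.sum_batchesTo i t H.m).trans ?_
  -- Batches formed after `t` contribute zero, so only the requests up to `t` matter.
  rw [← Finset.sum_subset (s₁ := Finset.range (t + 1))]
  · refine Finset.sum_congr rfl fun j hj => ?_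
    have hj : j ≤ t := by simpa [Nat.lt_succ_iff] using hj
    simp [hj]
  · intro j hj
    simp only [Finset.mem_range] at hj ⊢
    omega
  · intro j _ hj
    rw [if_neg]
    simp only [Finset.mem_range] at hj
    omega

end Instance

/-- If every use fits at the time when it starts, then the total use never exceeds the capacity. -/
theorem sum_use_le {x : ℕ → ℕ → ℝ≥0} {b : ℕ → ℝ≥0} {C : ℝ≥0} {T : ℕ}
    (hfit : ∀ s < T, b s ≠ 0 → b s + ∑ s' ∈ Finset.range s, x s' s ≤ C)
    (hb : ∀ s < T, x s s ≤ b s)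
    (hanti : ∀ s < T, ∀ l l', s ≤ l → l ≤ l' → x s l' ≤ x s l) {t : ℕ} (ht : t ≤ T) {l : ℕ}
    (hl : t ≤ l + 1) : ∑ s ∈ Finset.range t, x s l ≤ C := by
  induction t generalizing l with
  | zero => simp
  | succ t ih =>
    rw [Finset.sum_range_succ]
    have h1 : x t l ≤ b t := (hanti t ht t l le_rfl (by omega)).trans (hb t ht)
    -- A request with `b t = 0` is not tested for room, but it uses nothing either. Otherwise the
    -- test at time `t` bounds the total, and use does not grow afterwards.
    by_cases h0 : b t = 0
    · rw [h0] at h1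
      rw [nonpos_iff_eq_zero.1 h1, add_zero]
      exact ih (by omega) (by omega)
    · refine le_trans ?_ (hfit t ht h0)
      rw [add_comm]
      refine add_le_add h1 (Finset.sum_le_sum fun s hs => ?_)
      have hs := Finset.mem_range.1 hs
      exact hanti s (by omega) t l (by omega) (by omega)

namespace Copying

variable {H B : Instance} (D : Copying H B)

/-- The copies of `i` that are available at request `t`. -/
def avail (i : Fin H.n) (t : ℕ) : Finset (Fin B.n) :=
  Finset.univ.filter fun r => D.orig r = i ∧ D.tau r ≤ t

theorem sel_mem_avail {s t : ℕ} (hst : s ≤ t) {k : Fin B.K} (hk : ¬ D.Hidden s k) (i : Fin H.n) :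
    D.sel k i ∈ D.avail i t := by
  simp only [avail, Finset.mem_filter, Finset.mem_univ, true_and, D.orig_sel]
  by_contra h
  exact hk ⟨i, by omega⟩

/-- The action draws `i` from the single copy `sel k i`, which is available because the action is
not hidden. -/
theorem sum_lift_avail {s t : ℕ} (hst : s ≤ t) {k : Fin B.K} (hk : ¬ D.Hidden s k) (i : Fin H.n)
    (o : Outcome H.n) (l : ℕ) : ∑ r ∈ D.avail i t, (D.lift s k o).1 r l = o.1 i l := by
  rw [Finset.sum_eq_single (D.sel k i)]
  · simp [lift, D.orig_sel]
  · intro r hr hne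
    have ho : D.orig r = i := ((Finset.mem_filter.1 hr).2).1
    simp [lift, ho, hne.symm]
  · exact fun h => absurd (D.sel_mem_avail hst hk i) h

/-- If all choices in `B` are implementable and use available copies, then the original action can be
implemented in `H`. -/
theorem implementable_base {t : ℕ} (ht : t < H.m) (hB : t < B.m) (k : ℕ → Fin B.K)
    (o : ℕ → Outcome H.n)
    (himp : ∀ s (hs : s ≤ t) (r : Fin B.n), B.b ⟨s, hs.trans_lt hB⟩ (k s) r s ≠ 0 →
      B.b ⟨s, hs.trans_lt hB⟩ (k s) r s +
        ∑ s' ∈ Finset.range s, (D.lift s' (k s') (o s')).1 r s ≤ B.c r)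
    (hhid : ∀ s ≤ t, ¬ D.Hidden s (k s))
    (htwo : ∀ s (hs : s < t) (i : Fin H.n),
      (o s).1 i s = 0 ∨ (o s).1 i s = H.b ⟨s, hs.trans ht⟩ (D.base (k s)) i s)
    (hanti : ∀ s < t, ∀ (i : Fin H.n) (l l' : ℕ), s ≤ l → l ≤ l' → (o s).1 i l' ≤ (o s).1 i l)
    (i : Fin H.n) (hi : H.b ⟨t, ht⟩ (D.base (k t)) i t ≠ 0) :
    H.b ⟨t, ht⟩ (D.base (k t)) i t + ∑ s ∈ Finset.range t, (o s).1 i t ≤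
      ∑ r ∈ D.avail i t, B.c r := by
  have h1 : ∑ s ∈ Finset.range t, (o s).1 i t =
      ∑ r ∈ D.avail i t, ∑ s ∈ Finset.range t, (D.lift s (k s) (o s)).1 r t := by
    rw [Finset.sum_comm]
    refine Finset.sum_congr rfl fun s hs => ?_
    have hs := Finset.mem_range.1 hs
    exact (D.sum_lift_avail hs.le (hhid s hs.le) i _ t).symm
  have hr0 := D.sel_mem_avail le_rfl (hhid t le_rfl) i
  have hb0 : B.b ⟨t, hB⟩ (k t) (D.sel (k t) i) t = H.b ⟨t, ht⟩ (D.base (k t)) i t := by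
    rw [D.b_eq t hB ht, D.orig_sel, if_pos rfl]
  rw [h1, ← Finset.add_sum_erase _ _ hr0, ← Finset.add_sum_erase _ (fun r => B.c r) hr0, ← add_assoc]
  -- The copy used by the current action has room by `himp`. The other available copies are not
  -- overfilled, since every earlier use of them fitted when it started.
  refine add_le_add ?_ (Finset.sum_le_sum fun r _ => ?_)
  · have := himp t le_rfl (D.sel (k t) i) (by rw [hb0]; exact hi)
    rwa [hb0] at this
  · refine sum_use_le (x := fun s l => (D.lift s (k s) (o s)).1 r l)
      (b := fun s => if hs : s < B.m then B.b ⟨s, hs⟩ (k s) r s else 0) (T := t) ?_ ?_ ?_ le_rfl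
      (by omega)
    · intro s hs
      have hs' : s < B.m := hs.trans hB
      simp only [dif_pos hs']
      exact himp s hs.le r
    · intro s hs
      have hs' : s < B.m := hs.trans hB
      simp only [dif_pos hs', D.b_eq s hs' (hs.trans ht), lift]
      by_cases h : D.sel (k s) (D.orig r) = r
      · simp only [h, if_true]
        rcases htwo s hs (D.orig r) with h' | h' <;> rw [h']
        exact zero_le
      · simp [h]
    · intro s hs l l' hl hl'
      simp only [lift]
      by_cases h : D.sel (k s) (D.orig r) = r
      · simpa [h] using hanti s hs (D.orig r) l l' hl hl'
      · simp [h]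

end Copying

theorem Copying.measurable_lift_uncurry {H B : Instance} (D : Copying H B) (t : ℕ) :
    Measurable fun p : Fin B.K × Outcome H.n => D.lift t p.1 p.2 :=
  measurable_from_prod_countable_right fun k => D.measurable_lift t k

/-! ### Coupling ALG-B with ALG on the batched instance -/

namespace OnlineAlg

open Instance

variable (A : OnlineAlg) {F : Set Instance} {H : Instance} (D : Copying H H.batched.inst)

/-- The history in the batched instance that the batching extension simulates. -/
def batchLift (σ : A.S) (t : ℕ) (h : H.Hist) : H.batched.inst.Hist := fun s =>
  if s < t then
    (H.batched.action (A.batchPast H σ h t s),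
      D.lift s (H.batched.action (A.batchPast H σ h t s)) (h s).2)
  else (H.batched.inst.k₀, 0)

variable {D}

theorem observe_batchLift (hD : H.batched.Describes H.batches D) (σ : A.S) (t : ℕ) (h : H.Hist) :
    H.batched.inst.observe t (A.batchLift D σ t h) =
      H.batched.history t (A.batchPast H σ h t) h := by
  have hl : H.batched.lift = D.lift := hD.lift_eq
  funext s
  unfold observe batchLift Ext.history
  split_ifs with hs
  · rw [hl]
  · refine Prod.ext rfl (Prod.ext ?_ rfl)
    funext r l
    change (if s ≤ l ∧ l ≤ t then (0 : ℝ≥0) else 0) = 0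
    split_ifs <;> rfl

theorem act_batchLift (hF : ClosedFamily F) (hA : A.Consistent F) (hH : H ∈ F)
    (hthr : 0 < H.threshold) (hD : H.batched.Describes H.batches D) (σ : A.S) (h : H.Hist) {t : ℕ}
    (ht : t < H.m) (ht' : t < H.batched.inst.m) :
    (A.run H.batched.inst).act ⟨t, ht'⟩ σ (H.batched.inst.observe t (A.batchLift D σ t h)) =
      H.batched.action (A.batchChoice H σ h t (A.batchPast H σ h t)) := by
  rw [A.action_batchChoice hF hA hH hthr σ h ht ht', A.observe_batchLift hD]
  rfl

theorem batching_act_eq (hF : ClosedFamily F) (hA : A.Consistent F) (hH : H ∈ F)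
    (hthr : 0 < H.threshold) (hD : H.batched.Describes H.batches D) (σ : A.S) {h h' : H.Hist}
    {t : ℕ} (ht : t < H.m) (ht' : t < H.batched.inst.m) (hh : H.observe t h' = H.observe t h) :
    (A.batching.run H).act ⟨t, ht⟩ σ h' =
      D.base ((A.run H.batched.inst).act ⟨t, ht'⟩ σ
        (H.batched.inst.observe t (A.batchLift D σ t h))) := by
  rw [A.act_batchLift hF hA hH hthr hD σ h ht ht', ← congrFun hD.base_eq]
  exact A.batching_act σ ht hh

theorem batchLift_congr (σ : A.S) {h h' : H.Hist} {t : ℕ} (hh : ∀ s < t, h s = h' s) :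
    A.batchLift D σ t h = A.batchLift D σ t h' := by
  funext s
  unfold batchLift
  rw [A.batchPast_congr H σ hh]
  split_ifs with hs
  · rw [hh s hs]
  · rfl

theorem batchLift_succ (hF : ClosedFamily F) (hA : A.Consistent F) (hH : H ∈ F)
    (hthr : 0 < H.threshold) (hD : H.batched.Describes H.batches D) (σ : A.S) (h : H.Hist)
    {t : ℕ} (ht : t < H.m) (ht' : t < H.batched.inst.m) :
    A.batchLift D σ (t + 1) h = Function.update (A.batchLift D σ t h) t
      ((A.run H.batched.inst).act ⟨t, ht'⟩ σ (H.batched.inst.observe t (A.batchLift D σ t h)),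
        D.lift t ((A.run H.batched.inst).act ⟨t, ht'⟩ σ
          (H.batched.inst.observe t (A.batchLift D σ t h))) (h t).2) := by
  rw [A.act_batchLift hF hA hH hthr hD σ h ht ht']
  funext s
  by_cases hst : s = t
  · subst hst
    rw [Function.update_self]
    simp only [batchLift, if_pos (Nat.lt_succ_self s), A.batchPast_apply H σ h (Nat.lt_succ_self s)]
  · rw [Function.update_of_ne hst]
    unfold batchLift
    by_cases hs : s < t
    · rw [if_pos hs, if_pos (by omega), A.batchPast_apply H σ h hs,
        A.batchPast_apply H σ h (by omega : s < t + 1)]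
    · rw [if_neg hs, if_neg (by omega)]

theorem batchLift_apply (hF : ClosedFamily F) (hA : A.Consistent F) (hH : H ∈ F)
    (hthr : 0 < H.threshold) (hD : H.batched.Describes H.batches D) (σ : A.S) (h : H.Hist)
    {s t : ℕ} (hst : s < t) (ht : t ≤ H.m) (hs' : s < H.batched.inst.m) :
    A.batchLift D σ t h s =
      ((A.run H.batched.inst).act ⟨s, hs'⟩ σ (H.batched.inst.observe s (A.batchLift D σ s h)),
        D.lift s ((A.run H.batched.inst).act ⟨s, hs'⟩ σ
          (H.batched.inst.observe s (A.batchLift D σ s h))) (h s).2) := by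
  rw [A.act_batchLift hF hA hH hthr hD σ h (by omega) hs']
  simp only [batchLift, if_pos hst, A.batchPast_apply H σ h hst]

theorem measurable_batchLift_of {t : ℕ}
    (h : Measurable fun p : A.S × H.Hist => A.batchPast H p.1 p.2 t) :
    Measurable fun p : A.S × H.Hist => A.batchLift D p.1 t p.2 := by
  refine measurable_pi_lambda _ fun s => ?_
  unfold batchLift
  split_ifs with hs
  · have h1 : Measurable fun p : A.S × H.Hist => H.batched.action (A.batchPast H p.1 p.2 t s) :=
      (measurable_of_countable H.batched.action).comp ((measurable_pi_apply s).comp h)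
    exact h1.prodMk ((D.measurable_lift_uncurry s).comp (h1.prodMk (by fun_prop)))
  · exact measurable_const

theorem measurable_batchPast (hF : ClosedFamily F) (hA : A.Consistent F) (hH : H ∈ F)
    (hthr : 0 < H.threshold) (hD : H.batched.Describes H.batches D)
    (hm : ∀ t, Measurable fun p : A.S × H.batched.inst.Hist =>
      (A.run H.batched.inst).act t p.1 p.2) (t : ℕ) :
    Measurable fun p : A.S × H.Hist => A.batchPast H p.1 p.2 t := by
  induction t with
  | zero => exact measurable_const
  | succ t ih =>
    refine measurable_pi_lambda _ fun s => ?_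
    simp only [batchPast]
    by_cases hst : s = t
    · subst hst
      simp only [Function.update_self]
      by_cases hs : s < H.m
      · have hs' : s < H.batched.inst.m := by rw [D.m_eq]; exact hs
        -- Measurability is assumed for the run on the complete batched instance, so the choice is
        -- expressed through that run.
        simp only [A.batchChoice_eq hF hA hH hthr _ _ hs hs', ← A.observe_batchLift hD]
        exact (measurable_of_countable (Fin.val : Fin H.batched.inst.K → ℕ)).comp
          ((hm ⟨s, hs'⟩).comp (measurable_fst.prodMk
            ((H.batched.inst.measurable_observe s).comp (A.measurable_batchLift_of (D := D) ih))))
      · simp only [batchChoice, dif_neg hs]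
        exact measurable_const
    · simp only [Function.update_of_ne hst]
      exact (measurable_pi_apply s).comp ih

theorem measurable_batchLift (hF : ClosedFamily F) (hA : A.Consistent F) (hH : H ∈ F)
    (hthr : 0 < H.threshold) (hD : H.batched.Describes H.batches D)
    (hm : ∀ t, Measurable fun p : A.S × H.batched.inst.Hist =>
      (A.run H.batched.inst).act t p.1 p.2) (t : ℕ) :
    Measurable fun p : A.S × H.Hist => A.batchLift D p.1 t p.2 :=
  A.measurable_batchLift_of (A.measurable_batchPast hF hA hH hthr hD hm t)

theorem measurable_batching (hF : ClosedFamily F) (hA : A.Consistent F) (hH : H ∈ F)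
    (hthr : 0 < H.threshold) (hD : H.batched.Describes H.batches D)
    (hm : ∀ t, Measurable fun p : A.S × H.batched.inst.Hist =>
      (A.run H.batched.inst).act t p.1 p.2) (t : Fin H.m) :
    Measurable fun p : A.S × H.Hist => (A.batching.run H).act t p.1 p.2 := by
  have ht' : (t : ℕ) < H.batched.inst.m := by rw [D.m_eq]; exact t.isLt
  have : (fun p : A.S × H.Hist => (A.batching.run H).act t p.1 p.2) = fun p =>
      D.base ((A.run H.batched.inst).act ⟨t, ht'⟩ p.1
        (H.batched.inst.observe t (A.batchLift D p.1 t p.2))) :=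
    funext fun p => A.batching_act_eq hF hA hH hthr hD p.1 t.isLt ht' rfl
  rw [this]
  exact (measurable_of_countable D.base).comp ((hm _).comp (measurable_fst.prodMk
    ((H.batched.inst.measurable_observe t).comp (A.measurable_batchLift hF hA hH hthr hD hm t))))

/-- The simulated history has the law of the history of `A` on the batched instance. -/
theorem lintegral_batchLift (hF : ClosedFamily F) (hA : A.Consistent F) (hH : H ∈ F)
    (hthr : 0 < H.threshold) (hD : H.batched.Describes H.batches D)
    (hm : ∀ t, Measurable fun p : A.S × H.batched.inst.Hist =>
      (A.run H.batched.inst).act t p.1 p.2) {t : ℕ} (ht : t ≤ H.m)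
    {f : A.S × H.batched.inst.Hist → ℝ≥0∞} (hf : Measurable f) :
    ∫⁻ x, f (x.1, H.batched.inst.hist (fun t => (A.run H.batched.inst).act t x.1) x.2 t)
        ∂(A.run H.batched.inst).joint =
      ∫⁻ x, f (x.1, A.batchLift D x.1 t (H.hist (fun t => (A.batching.run H).act t x.1) x.2 t))
        ∂(A.batching.run H).joint := by
  have hm' := A.measurable_batching hF hA hH hthr hD hm
  have hL := A.measurable_batchLift hF hA hH hthr hD hm
  have h1 : Measurable fun x : A.S × H.batched.inst.Sample =>
      f (x.1, H.batched.inst.hist (fun t => (A.run H.batched.inst).act t x.1) x.2 t) :=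
    hf.comp (measurable_fst.prodMk (measurable_hist hm t))
  have h2 : Measurable fun x : A.S × H.Sample =>
      f (x.1, A.batchLift D x.1 t (H.hist (fun t => (A.batching.run H).act t x.1) x.2 t)) :=
    hf.comp (measurable_fst.prodMk ((hL t).comp
      (measurable_fst.prodMk (measurable_hist (S := A.S) hm' t))))
  refine (lintegral_prod _ h1.aemeasurable).trans
    (Eq.trans ?_ (lintegral_prod _ h2.aemeasurable).symm)
  -- Both runs share the seed. Once it is fixed they follow deterministic rules, and histories can
  -- be translated.
  refine lintegral_congr fun σ => ?_
  refine D.lintegral_hist_translate (L := A.batchLift D σ)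
    (f := fun h => f (σ, h)) (fun t => (hm t).comp measurable_prodMk_left)
    (fun t => (hm' t).comp measurable_prodMk_left) (fun t => (hL t).comp measurable_prodMk_left)
    rfl ?_ ?_ ht (hf.comp measurable_prodMk_left)
  · intro s hs hs' h
    exact A.batching_act_eq hF hA hH hthr hD σ hs hs' (H.observe_observe le_rfl h)
  · intro s hs' h k o
    have hs : s < H.m := by rw [← D.m_eq]; exact hs'
    rw [A.batchLift_succ hF hA hH hthr hD σ _ hs hs',
      A.batchLift_congr (h' := h) σ (fun r hr => Function.update_of_ne hr.ne _ _),
      Function.update_self]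
    rfl

/-- The value of the batching extension is at least that of `A` on the batched instance. -/
theorem value_le_batching (hF : ClosedFamily F) (hA : A.Consistent F) (hH : H ∈ F)
    (hthr : 0 < H.threshold) (hD : H.batched.Describes H.batches D)
    (hm : ∀ t, Measurable fun p : A.S × H.batched.inst.Hist =>
      (A.run H.batched.inst).act t p.1 p.2) :
    (A.run H.batched.inst).value ≤ (A.batching.run H).value := by
  rw [Policy.value_eq, Policy.value_eq]
  -- Type `i` of `H` is compared with the original resource `pos i` of the batched instance, which
  -- counts the same rewards.
  refine le_iInf fun i => (iInf_le _ (D.pos i)).trans ?_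
  have hmB : H.batched.inst.m = H.m := D.m_eq
  have h1 := A.lintegral_batchLift hF hA hH hthr hD hm le_rfl
    (f := fun p => ∑ t : Fin H.batched.inst.m, (((p.2 t).2.2 (D.pos i) : ℝ≥0) : ℝ≥0∞))
    (by fun_prop)
  simp only [hmB]
  refine h1.le.trans (lintegral_mono fun x => ?_)
  have : ∀ g : ℕ → ℝ≥0∞, ∑ t : Fin H.batched.inst.m, g t = ∑ t : Fin H.m, g t := by
    intro g
    rw [Fin.sum_univ_eq_sum_range, Fin.sum_univ_eq_sum_range, hmB]
  refine (this fun t => (((A.batchLift D x.1 H.m (H.hist _ x.2 H.m) t).2.2 (D.pos i) : ℝ≥0) :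
    ℝ≥0∞)).le.trans (Finset.sum_le_sum fun t _ => ?_)
  -- A hidden action earns nothing in the batched instance but possibly something in `H`; for all
  -- other actions the rewards agree.
  simp only [batchLift, t.isLt, if_true, Copying.lift, D.orig_pos]
  split_ifs
  · simp
  · exact le_rfl

end OnlineAlg

/-! ### Feasibility of ALG-B -/

namespace Copying

variable {H B : Instance} (D : Copying H B)

theorem sel_triv {k : Fin B.K} (hk : D.base k = H.k₀) (i : Fin H.n) : D.sel k i = D.pos i :=
  D.sel_of_notMem _ _ (by simp [hk, H.supp_trivial])

theorem not_hidden_triv (t : ℕ) {k : Fin B.K} (hk : D.base k = H.k₀) : ¬ D.Hidden t k := by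
  rintro ⟨i, hi⟩
  rw [D.sel_triv hk, D.tau_pos] at hi
  omega

theorem reward_eq_zero_of_hidden {t : ℕ} (ht : t < B.m) {k : Fin B.K} (hk : D.Hidden t k)
    (r : Fin B.n) : ∫⁻ o, (o.2 r : ℝ≥0∞) ∂(B.law ⟨t, ht⟩ k) = 0 := by
  have ht' : t < H.m := by rw [← D.m_eq]; exact ht
  rw [D.law_eq_map_lift ht ht', lintegral_map (by fun_prop) (D.measurable_lift t k)]
  simp [lift, hk]

end Copying

namespace Instance

theorem measurableSet_implementable (B : Instance) (t : Fin B.m) :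
    MeasurableSet {p : Fin B.K × B.Hist | B.Implementable t p.2 p.1} := by
  have : {p : Fin B.K × B.Hist | B.Implementable t p.2 p.1} =
      ⋃ k, {k} ×ˢ {h : B.Hist | B.Implementable t h k} := by
    ext ⟨k, h⟩
    simp
  rw [this]
  refine MeasurableSet.iUnion fun k => (measurableSet_singleton k).prod ?_
  simp only [Implementable, Set.ofPred_forall]
  exact MeasurableSet.iInter fun i => MeasurableSet.iInter fun _ =>
    measurableSet_le (by fun_prop) measurable_const

theorem implementable_congr (H : Instance) {t : Fin H.m} {h h' : H.Hist} {k : Fin H.K}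
    (hh : H.observe t h = H.observe t h') :
    H.Implementable t h k ↔ H.Implementable t h' k := by
  have : ∀ s ∈ Finset.range t, ∀ i, (h s).2.1 i t = (h' s).2.1 i t := by
    intro s hs i
    have h1 := congrArg (fun x : H.Hist => (x s).2.1 i t) hh
    have hs : s ≤ t := (Finset.mem_range.1 hs).le
    simpa [observe, visible, hs] using h1
  unfold Implementable
  refine forall_congr' fun i => ?_
  rw [Finset.sum_congr rfl fun s hs => this s hs i]

end Instance

namespace OnlineAlg

open Instance

variable (A : OnlineAlg) {F : Set Instance} {H : Instance} {D : Copying H H.batched.inst}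

/-- The coupling is an equality of integrals. Applied to the indicator of the complement of `G`, it
transfers almost sure properties of the run of ALG. -/
theorem ae_batchLift (hF : ClosedFamily F) (hA : A.Consistent F) (hH : H ∈ F)
    (hthr : 0 < H.threshold) (hD : H.batched.Describes H.batches D)
    (hm : ∀ t, Measurable fun p : A.S × H.batched.inst.Hist =>
      (A.run H.batched.inst).act t p.1 p.2) {t : ℕ} (ht : t ≤ H.m)
    {G : Set (A.S × H.batched.inst.Hist)} (hG : MeasurableSet G)
    (h : ∀ᵐ x ∂(A.run H.batched.inst).joint,
      (x.1, H.batched.inst.hist (fun t => (A.run H.batched.inst).act t x.1) x.2 t) ∈ G) :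
    ∀ᵐ x ∂(A.batching.run H).joint,
      (x.1, A.batchLift D x.1 t (H.hist (fun t => (A.batching.run H).act t x.1) x.2 t)) ∈ G := by
  have hf : Measurable (Gᶜ.indicator fun _ => (1 : ℝ≥0∞)) := measurable_const.indicator hG.compl
  have h1 := A.lintegral_batchLift hF hA hH hthr hD hm ht hf
  have hm' := A.measurable_batching hF hA hH hthr hD hm
  have hL := A.measurable_batchLift hF hA hH hthr hD hm
  have h2 : Measurable fun x : A.S × H.Sample =>
      (x.1, A.batchLift D x.1 t (H.hist (fun t => (A.batching.run H).act t x.1) x.2 t)) :=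
    measurable_fst.prodMk ((hL t).comp
      (measurable_fst.prodMk (measurable_hist (S := A.S) hm' t)))
  have h3 : ∫⁻ x, Gᶜ.indicator (fun _ => (1 : ℝ≥0∞))
      (x.1, H.batched.inst.hist (fun t => (A.run H.batched.inst).act t x.1) x.2 t)
        ∂(A.run H.batched.inst).joint = 0 := by
    rw [lintegral_congr_ae (g := fun _ => 0), lintegral_zero]
    filter_upwards [h] with x hx
    simp [hx]
  rw [h3] at h1
  have h4 := (lintegral_eq_zero_iff (hf.comp h2)).1 h1.symm
  filter_upwards [h4] with x hx
  by_contra hc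
  exact one_ne_zero ((Set.indicator_of_mem (s := Gᶜ) hc fun _ => (1 : ℝ≥0∞)).symm.trans hx)

theorem admissible_batching (hF : ClosedFamily F) (hA : A.Consistent F) (hH : H ∈ F)
    (hthr : 0 < H.threshold) (hadm : (A.run H.batched.inst).Admissible)
    (hnw : (A.run H.batched.inst).NonWasteful) : (A.batching.run H).Admissible := by
  obtain ⟨D, hD⟩ : ∃ D, H.batched.Describes H.batches D := H.exists_describes H.batches
  obtain ⟨hm, himp⟩ := hadm
  have hm' := A.measurable_batching hF hA hH hthr hD hm
  refine ⟨hm', ?_⟩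
  have hmB : H.batched.inst.m = H.m := D.m_eq
  have key : ∀ t : Fin H.batched.inst.m, ∀ᵐ x ∂(A.batching.run H).joint,
      (fun p : A.S × H.batched.inst.Hist =>
        H.batched.inst.Implementable t p.2
          ((A.run H.batched.inst).act t p.1 (H.batched.inst.observe t p.2)) ∧
        ¬ D.Hidden t ((A.run H.batched.inst).act t p.1 (H.batched.inst.observe t p.2)))
      (x.1, A.batchLift D x.1 t (H.hist (fun t => (A.batching.run H).act t x.1) x.2 t)) := by
    intro t
    have hk : Measurable fun p : A.S × H.batched.inst.Hist =>
        (A.run H.batched.inst).act t p.1 (H.batched.inst.observe t p.2) :=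
      (hm t).comp (measurable_fst.prodMk
        ((H.batched.inst.measurable_observe t).comp measurable_snd))
    refine A.ae_batchLift hF hA hH hthr hD hm (t := t) (t.isLt.le.trans_eq hmB)
      (G := {p | H.batched.inst.Implementable t p.2
          ((A.run H.batched.inst).act t p.1 (H.batched.inst.observe t p.2)) ∧
        ¬ D.Hidden t ((A.run H.batched.inst).act t p.1 (H.batched.inst.observe t p.2))}) ?_ ?_
    · exact MeasurableSet.inter
        ((hk.prodMk measurable_snd) (H.batched.inst.measurableSet_implementable t))
        (hk (MeasurableSet.of_discrete (s := {k | ¬ D.Hidden t k})))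
    · filter_upwards [himp, hnw] with x hx hx'
      refine ⟨hx t, ?_⟩
      -- The trivial action uses no copy at all. Any other choice has a nonzero reward, which hidden
      -- actions lack.
      rcases hx' t with h | ⟨i, hi⟩
      · exact D.not_hidden_triv t (by
          rw [show (A.run H.batched.inst).act t x.1 _ = _ from h, D.base_triv])
      · exact fun hc => hi (D.reward_eq_zero_of_hidden t.isLt hc i)
  have hsample : ∀ᵐ x ∂(A.batching.run H).joint, ∀ (t : Fin H.m) (k : Fin H.K),
      (∀ (i : Fin H.n) (l : ℕ), (t : ℕ) ≤ l →
        (x.2 (t, k)).1 i l = 0 ∨ (x.2 (t, k)).1 i l = H.b t k i l) ∧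
      ∀ (i : Fin H.n) (l l' : ℕ), (t : ℕ) ≤ l → l ≤ l' →
        (x.2 (t, k)).1 i l' ≤ (x.2 (t, k)).1 i l :=
    Measure.quasiMeasurePreserving_snd.ae H.ae_sample
  filter_upwards [ae_all_iff.2 key, hsample] with x hx hs t
  set δ : Fin H.m → H.Hist → Fin H.K := fun t => (A.batching.run H).act t x.1 with hδ
  -- Earlier histories agree with the final one on the requests already served, so all choices are
  -- expressed through the single history `h`.
  set h := H.hist δ x.2 H.m with hh
  have hhist : ∀ s ≤ H.m, ∀ r < s, H.hist δ x.2 s r = h r := by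
    intro s hs r hr
    rw [hist_apply δ x.2 hr hs, hh, hist_apply δ x.2 (hr.trans_le hs) le_rfl]
  have hlift : ∀ s ≤ H.m, A.batchLift D x.1 s (H.hist δ x.2 s) = A.batchLift D x.1 s h :=
    fun s hs => A.batchLift_congr x.1 (hhist s hs)
  let k : ℕ → Fin H.batched.inst.K := fun s => if hs : s < H.batched.inst.m then
    (A.run H.batched.inst).act ⟨s, hs⟩ x.1 (H.batched.inst.observe s (A.batchLift D x.1 s h))
    else H.batched.inst.k₀
  have hchosen : ∀ s (hs : s < H.m), H.chosen δ x.2 ⟨s, hs⟩ = D.base (k s) := by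
    intro s hs
    have hs' : s < H.batched.inst.m := by omega
    simp only [k, dif_pos hs', ← hlift s hs.le]
    exact A.batching_act_eq hF hA hH hthr hD x.1 hs hs' (H.observe_observe le_rfl _)
  have htB : (t : ℕ) < H.batched.inst.m := by omega
  have hval : ∀ s (hs : s < H.m), h s = (D.base (k s), x.2 (⟨s, hs⟩, D.base (k s))) := by
    intro s hs
    rw [hh, hist_apply δ x.2 hs le_rfl, hchosen]
  have hkval : ∀ s (hs : s < H.batched.inst.m), (A.run H.batched.inst).act ⟨s, hs⟩ x.1
      (H.batched.inst.observe s (A.batchLift D x.1 s h)) = k s := fun s hs => by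
    simp only [k, dif_pos hs]
  intro i hi
  change H.b t (H.chosen δ x.2 t) i t ≠ 0 at hi
  change H.b t (H.chosen δ x.2 t) i t + ∑ s ∈ Finset.range t, (H.hist δ x.2 t s).2.1 i t ≤ _
  rw [hchosen t t.isLt] at hi ⊢
  have hmain := D.implementable_base t.isLt htB k (fun s => (h s).2) ?_ ?_ ?_ ?_ i hi
  · rw [Finset.sum_congr rfl fun s hs => by rw [hhist t t.isLt.le s (Finset.mem_range.1 hs)]]
    refine hmain.trans ?_
    -- The pending replenishment is inventory of `H` that no copy holds; it is simply left unused.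
    rw [← H.sum_c_add_pending hD i t]
    exact le_self_add
  · intro s hst r hr
    have hs' : s < H.batched.inst.m := hst.trans_lt htB
    have h1 := (hx ⟨s, hs'⟩).1
    simp only [hlift s (hst.trans t.isLt.le), hkval s hs'] at h1
    have h2 := h1 r hr
    have h0 : H.batched.inst.zeta = 0 := D.zeta_eq
    simp only [h0, Pi.zero_apply, Finset.sum_const_zero, add_zero] at h2
    refine le_trans (add_le_add le_rfl (Finset.sum_le_sum fun s' hs'' => ?_)) h2
    have hs'' := Finset.mem_range.1 hs''
    have hsm : s ≤ H.m := hst.trans t.isLt.le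
    rw [A.batchLift_apply hF hA hH hthr hD x.1 h hs'' hsm (hs''.trans hs'), hkval]
  · intro s hst
    have hs' : s < H.batched.inst.m := hst.trans_lt htB
    have h1 := (hx ⟨s, hs'⟩).2
    simpa only [hlift s (hst.trans t.isLt.le), hkval s hs'] using h1
  · intro s hst j
    simp only [hval s (hst.trans t.isLt)]
    exact (hs ⟨s, hst.trans t.isLt⟩ (D.base (k s))).1 j s le_rfl
  · intro s hst j l l' hl hl'
    simp only [hval s (hst.trans t.isLt)]
    exact (hs ⟨s, hst.trans t.isLt⟩ (D.base (k s))).2 j l l' hl hl'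

end OnlineAlg

/-! ### Simulating a policy for `H` in a copied instance -/

open Instance

theorem Instance.observe_update (H : Instance) (t s : ℕ) (h : H.Hist) (k : Fin H.K)
    (o : Outcome H.n) : H.observe t (Function.update h s (k, o)) =
      Function.update (H.observe t h) s (k, visible s t o) := by
  funext r
  unfold observe
  by_cases hr : r = s
  · subst hr; simp
  · simp [hr]

theorem Instance.implementable_triv (B : Instance) (t : Fin B.m) (h : B.Hist) :
    B.Implementable t h B.k₀ :=
  fun i hi => absurd (B.b_eq_zero t B.k₀ i t (by simp [B.supp_trivial])) hi

/-- An element of `S`, or `d` if there is none. -/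
def pick {α : Type*} (d : α) (S : Set α) : α :=
  open scoped Classical in if h : S.Nonempty then h.some else d

theorem pick_mem {α : Type*} (d : α) {S : Set α} (h : S.Nonempty) : pick d S ∈ S := by
  unfold pick
  rw [dif_pos h]
  exact h.some_mem

theorem pick_cases {α : Type*} (d : α) (S : Set α) : pick d S ∈ S ∨ pick d S = d := by
  unfold pick
  split_ifs with h
  · exact Or.inl h.some_mem
  · exact Or.inr rfl

namespace Copying

variable {H B : Instance} (D : Copying H B)

/-- The outcome in `H` that corresponds to an outcome of action `k` of `B`. -/
def proj (k : Fin B.K) (o : Outcome B.n) : Outcome H.n :=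
  (fun i => o.1 (D.sel k i), fun i => o.2 (D.pos i))

theorem measurable_proj (k : Fin B.K) : Measurable (D.proj k) := by
  unfold proj; fun_prop

theorem measurable_proj_uncurry : Measurable fun p : Fin B.K × Outcome B.n => D.proj p.1 p.2 :=
  measurable_from_prod_countable_right fun k => D.measurable_proj k

theorem proj_lift {t : ℕ} {k : Fin B.K} (hk : ¬ D.Hidden t k) (o : Outcome H.n) :
    D.proj k (D.lift t k o) = o := by
  refine Prod.ext ?_ ?_
  · funext i
    simp [proj, lift, D.orig_sel]
  · funext i
    simp [proj, lift, hk, D.orig_pos]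

/-- No information is lost when an action is not hidden: use is read off at the selected copies and
rewards at the original resources. Outcomes observed in `B` can thus replace draws in `H`. -/
theorem map_proj_law {t : ℕ} (ht : t < B.m) (ht' : t < H.m) {k : Fin B.K} (hk : ¬ D.Hidden t k) :
    (B.law ⟨t, ht⟩ k).map (D.proj k) = H.law ⟨t, ht'⟩ (D.base k) := by
  rw [D.law_eq_map_lift ht ht', Measure.map_map (D.measurable_proj k) (D.measurable_lift t k)]
  have : D.proj k ∘ D.lift t k = id := funext fun o => D.proj_lift hk o
  rw [this, Measure.map_id]

/-! ### Thinning a policy for `H` -/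

section Thin

variable (δ : Fin H.m → H.Hist → Fin H.K) (coin : Fin H.m → Bool)

/-- The simulated history in `H`: the outcome of a choice of `δ` that has been implemented in `B` is
read off from the history `g` in `B`, and the other outcomes are those of the sample `ω`. -/
def simHist (ω : H.Sample) (g : B.Hist) : ℕ → H.Hist
  | 0 => fun _ => (H.k₀, 0)
  | t + 1 =>
    if ht : t < H.m then
      Function.update (simHist ω g t) t
        (δ ⟨t, ht⟩ (H.observe t (simHist ω g t)),
          if D.base (g t).1 = δ ⟨t, ht⟩ (H.observe t (simHist ω g t)) ∧ ¬ D.Hidden t (g t).1 then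
            D.proj (g t).1 (g t).2
          else ω (⟨t, ht⟩, δ ⟨t, ht⟩ (H.observe t (simHist ω g t))))
    else simHist ω g t

/-- The actions of `B` that can be chosen for request `t` in place of action `k` of `H`. -/
def candidates (t : Fin B.m) (k : Fin H.K) (g : B.Hist) : Set (Fin B.K) :=
  {k' | D.base k' = k ∧ ¬ D.Hidden t k' ∧ B.Implementable t g k'}

/-- Implement `k` if the coin `c` says so and if this is possible. -/
def thinChoice (c : Bool) (t : Fin B.m) (k : Fin H.K) (g : B.Hist) : Fin B.K :=
  if c then pick B.k₀ (D.candidates t k g) else B.k₀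

/-- The thinned decision rule in `B`. -/
def thin (ω : H.Sample) (t : Fin B.m) (g : B.Hist) : Fin B.K :=
  D.thinChoice (coin (t.cast D.m_eq)) t
    (δ (t.cast D.m_eq) (H.observe t (D.simHist δ ω g t))) g

variable {δ coin}

theorem simHist_succ (ω : H.Sample) (g : B.Hist) {t : ℕ} (ht : t < H.m) :
    D.simHist δ ω g (t + 1) = Function.update (D.simHist δ ω g t) t
        (δ ⟨t, ht⟩ (H.observe t (D.simHist δ ω g t)),
          if D.base (g t).1 = δ ⟨t, ht⟩ (H.observe t (D.simHist δ ω g t)) ∧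
              ¬ D.Hidden t (g t).1 then
            D.proj (g t).1 (g t).2
          else ω (⟨t, ht⟩, δ ⟨t, ht⟩ (H.observe t (D.simHist δ ω g t)))) := by
  rw [simHist, dif_pos ht]

theorem simHist_congr (ω : H.Sample) {g g' : B.Hist} {t : ℕ} (hg : ∀ s < t, g s = g' s) :
    D.simHist δ ω g t = D.simHist δ ω g' t := by
  induction t with
  | zero => rfl
  | succ t ih =>
    rw [simHist, simHist, ih fun s hs => hg s (by omega), hg t (by omega)]

theorem simHist_apply (ω : H.Sample) (g : B.Hist) {s t : ℕ} (hst : s < t) (ht : t ≤ H.m) :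
    D.simHist δ ω g t s = D.simHist δ ω g (s + 1) s := by
  induction t with
  | zero => omega
  | succ t ih =>
    by_cases h : s = t
    · rw [h]
    · rw [D.simHist_succ ω g ht, Function.update_of_ne h]
      exact ih (by omega) (by omega)

theorem thin_congr (ω : H.Sample) (t : Fin B.m) {g g' : B.Hist} (hg : ∀ s < (t : ℕ), g s = g' s) :
    D.thin δ coin ω t g = D.thin δ coin ω t g' := by
  have : ∀ k, B.Implementable t g k ↔ B.Implementable t g' k := by
    intro k
    unfold Implementable
    refine forall_congr' fun i => ?_
    rw [Finset.sum_congr rfl fun s hs => by rw [hg s (Finset.mem_range.1 hs)]]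
  unfold thin thinChoice candidates
  rw [D.simHist_congr ω hg]
  simp only [this]

theorem simHist_update_sample (ω : H.Sample) (g : B.Hist) (p : Fin H.m × Fin H.K)
    (o : Outcome H.n) {t : ℕ} (ht : t ≤ p.1) :
    D.simHist δ (Function.update ω p o) g t = D.simHist δ ω g t := by
  induction t with
  | zero => rfl
  | succ t ih =>
    have h' : t < H.m := by omega
    rw [simHist_succ _ _ _ h', simHist_succ _ _ _ h', ih (by omega), Function.update_of_ne]
    rintro rfl
    simp at ht

theorem proj_visible (s t : ℕ) (k : Fin B.K) (o : Outcome B.n) :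
    D.proj k (visible s t o) = visible s t (D.proj k o) := rfl

/-- The simulation reads only what is visible at request `t`. Hence the thinned rule is
non-anticipating, and it may be evaluated on full histories. -/
theorem simHist_observe (ω : H.Sample) (g : B.Hist) {t t' : ℕ} (h : t' ≤ t) :
    H.observe t (D.simHist δ ω (B.observe t g) t') = H.observe t (D.simHist δ ω g t') := by
  induction t' with
  | zero => rfl
  | succ t' ih =>
    have ih := ih (by omega)
    by_cases ht' : t' < H.m
    · have hk : H.observe t' (D.simHist δ ω (B.observe t g) t') =
          H.observe t' (D.simHist δ ω g t') := by
        rw [← H.observe_observe (by omega : t' ≤ t), ih, H.observe_observe (by omega)]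
      rw [simHist_succ _ _ _ ht', simHist_succ _ _ _ ht', observe_update, observe_update, ih, hk]
      congr 2
      change visible t' t (if D.base (g t').1 = _ ∧ ¬ D.Hidden t' (g t').1 then
        D.proj (g t').1 (visible t' t (g t').2) else _) = _
      split_ifs
      · rw [proj_visible, visible_visible le_rfl]
      · rfl
    · rw [simHist, simHist, dif_neg ht', dif_neg ht']
      exact ih

theorem thin_observe (ω : H.Sample) (t : Fin B.m) (g : B.Hist) :
    D.thin δ coin ω t (B.observe t g) = D.thin δ coin ω t g := by
  unfold thin thinChoice candidates
  rw [D.simHist_observe ω g le_rfl]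
  have : ∀ k, B.Implementable t (B.observe t g) k ↔ B.Implementable t g k :=
    fun k => B.implementable_congr (B.observe_observe le_rfl g)
  simp only [this]

theorem thinChoice_cases (c : Bool) (t : Fin B.m) (k : Fin H.K) (g : B.Hist) :
    D.thinChoice c t k g ∈ D.candidates t k g ∨ D.thinChoice c t k g = B.k₀ := by
  unfold thinChoice
  split_ifs
  · exact pick_cases _ _
  · exact Or.inr rfl

theorem implementable_thin (ω : H.Sample) (t : Fin B.m) (g : B.Hist) :
    B.Implementable t g (D.thin δ coin ω t g) := by
  rcases D.thinChoice_cases (coin (t.cast D.m_eq)) t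
    (δ (t.cast D.m_eq) (H.observe t (D.simHist δ ω g t))) g with h | h
  · exact h.2.2
  · unfold thin
    rw [h]
    exact B.implementable_triv t g

theorem chosen_thin (ω : H.Sample) (ω' : B.Sample) (t : Fin B.m) :
    B.chosen (D.thin δ coin ω) ω' t = D.thin δ coin ω t (B.hist (D.thin δ coin ω) ω' t) :=
  D.thin_observe ω t _

/-- Up to time `p.1` the sample `ω` has been read only at earlier requests, so its outcomes for
request `p.1` are still fresh when one is needed. -/
theorem hist_thin_update_sample (ω : H.Sample) (ω' : B.Sample) (p : Fin H.m × Fin H.K)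
    (o : Outcome H.n) {t : ℕ} (ht : t ≤ p.1) :
    B.hist (D.thin δ coin (Function.update ω p o)) ω' t = B.hist (D.thin δ coin ω) ω' t := by
  induction t with
  | zero => rfl
  | succ t ih =>
    have h' : t < B.m := by rw [D.m_eq]; omega
    rw [hist_succ _ _ h', hist_succ _ _ h', chosen_thin, chosen_thin, ih (by omega)]
    unfold thin
    rw [D.simHist_update_sample ω _ p o (by simp; omega)]

/-! ### Measurability of the thinned policy -/

theorem measurable_thinChoice (c : Bool) (t : Fin B.m) :
    Measurable fun p : Fin H.K × B.Hist => D.thinChoice c t p.1 p.2 := by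
  cases c
  · exact measurable_const
  · have h1 : Measurable fun p : Fin H.K × B.Hist => D.candidates t p.1 p.2 := by
      refine measurable_set_iff.2 fun k' => ?_
      have h2 : Measurable fun p : Fin H.K × B.Hist => B.Implementable t p.2 k' :=
        measurableSet_setOfPred.1 ((measurable_const (a := k')).prodMk measurable_snd
          (B.measurableSet_implementable t))
      have h3 : Measurable fun p : Fin H.K × B.Hist => D.base k' = p.1 ∧ ¬ D.Hidden t k' :=
        (measurable_of_countable fun k : Fin H.K => D.base k' = k ∧ ¬ D.Hidden t k').comp
          measurable_fst
      simpa only [candidates, Set.mem_ofPred_eq, and_assoc] using h3.and h2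
    -- The set of candidates takes values in a countable space, so an arbitrary choice from it is
    -- measurable.
    exact (measurable_of_countable (pick B.k₀)).comp h1

section Joint

variable {X : Type*} [MeasurableSpace X] {act : Fin H.m → X → H.Hist → Fin H.K}

theorem measurable_simHist (hact : ∀ t, Measurable fun p : X × H.Hist => act t p.1 p.2) (t : ℕ) :
    Measurable fun p : X × H.Sample × B.Hist =>
      D.simHist (fun t => act t p.1) p.2.1 p.2.2 t := by
  induction t with
  | zero => exact measurable_const
  | succ t ih =>
    simp only [simHist]
    split_ifs with ht
    · have hk : Measurable fun p : X × H.Sample × B.Hist => act ⟨t, ht⟩ p.1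
          (H.observe t (D.simHist (fun t => act t p.1) p.2.1 p.2.2 t)) :=
        (hact ⟨t, ht⟩).comp (measurable_fst.prodMk ((H.measurable_observe t).comp ih))
      have hg : Measurable fun p : X × H.Sample × B.Hist => (p.2.2 t).1 := by fun_prop
      refine (measurable_update_hist t).comp (ih.prodMk (hk.prodMk (Measurable.ite ?_ ?_ ?_)))
      · exact (hg.prodMk hk) (MeasurableSet.of_discrete
          (s := {q : Fin B.K × Fin H.K | D.base q.1 = q.2 ∧ ¬ D.Hidden t q.1}))
      · exact D.measurable_proj_uncurry.comp (hg.prodMk (by fun_prop))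
      · exact (measurable_eval_sample ⟨t, ht⟩).comp
          ((measurable_fst.comp measurable_snd).prodMk hk)
    · exact ih

theorem measurable_thin (hact : ∀ t, Measurable fun p : X × H.Hist => act t p.1 p.2)
    (t : Fin B.m) :
    Measurable fun p : (X × (Fin H.m → Bool)) × H.Sample × B.Hist =>
      D.thin (fun t => act t p.1.1) p.1.2 p.2.1 t p.2.2 := by
  have h0 : Measurable fun q : Bool × Fin H.K × B.Hist => D.thinChoice q.1 t q.2.1 q.2.2 :=
    measurable_from_prod_countable_right fun c => D.measurable_thinChoice c t
  have h1 : Measurable fun p : (X × (Fin H.m → Bool)) × H.Sample × B.Hist =>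
      H.observe t (D.simHist (fun t => act t p.1.1) p.2.1 p.2.2 t) :=
    (H.measurable_observe t).comp ((D.measurable_simHist hact t).comp
      ((measurable_fst.comp measurable_fst).prodMk measurable_snd))
  refine h0.comp (Measurable.prodMk (by fun_prop) (Measurable.prodMk ?_ (by fun_prop)))
  exact (hact (t.cast D.m_eq)).comp ((measurable_fst.comp measurable_fst).prodMk h1)

end Joint

/-! ### The law of the simulated history -/

theorem measurable_simHist_thin (hδ : ∀ t, Measurable (δ t)) (t t' : ℕ) :
    Measurable fun p : H.Sample × B.Sample =>
      (D.simHist δ p.1 (B.hist (D.thin δ coin p.1) p.2 t') t,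
        B.hist (D.thin δ coin p.1) p.2 t') := by
  have hact : ∀ t, Measurable fun p : Unit × H.Hist => (fun t _ => δ t) t p.1 p.2 :=
    fun t => (hδ t).comp measurable_snd
  have h1 : ∀ t, Measurable fun p : H.Sample × B.Hist => D.thin δ coin p.1 t p.2 := fun t =>
    (D.measurable_thin (X := Unit) (act := fun t _ => δ t) hact t).comp
      ((measurable_const (a := (((), coin) : Unit × (Fin H.m → Bool)))).prodMk measurable_id)
  have h2 : Measurable fun p : H.Sample × B.Sample => B.hist (D.thin δ coin p.1) p.2 t' :=
    measurable_hist (act := fun t ω g => D.thin δ coin ω t g) h1 t'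
  exact ((D.measurable_simHist (X := Unit) (act := fun t _ => δ t) hact t).comp
    ((measurable_const (a := ())).prodMk (measurable_fst.prodMk h2))).prodMk h2

/-- The past and the coin decide whether an outcome is taken from `B` or from the seed sample. Both
sources are fresh and have the law of the simulated action, so each step has the conditional law of
a step of `δ`. The coins do not influence this law. -/
theorem lintegral_simHist (hδ : ∀ t, Measurable (δ t)) {t : ℕ} (ht : t ≤ H.m)
    {f : H.Hist → ℝ≥0∞} (hf : Measurable f) :
    ∫⁻ p, f (D.simHist δ p.1 (B.hist (D.thin δ coin p.1) p.2 t) t)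
        ∂(H.sampleMeasure.prod B.sampleMeasure) =
      ∫⁻ ω, f (H.hist δ ω t) ∂H.sampleMeasure := by
  induction t generalizing f with
  | zero => simp [simHist, hist]
  | succ t ih =>
    have ht' : t < B.m := by rw [D.m_eq]; omega
    have hk : Measurable fun h : H.Hist => δ ⟨t, ht⟩ (H.observe t h) :=
      (hδ _).comp (H.measurable_observe t)
    have hZ := D.measurable_simHist_thin (coin := coin) hδ t t
    -- `sel` pairs the choice of `δ` with the thinned choice in `B`. Given the pair `j`, the outcome
    -- is `V j`, whose law is that of `j.1` from either source.
    let sel : H.Hist × B.Hist → Fin H.K × Fin B.K := fun z =>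
      (δ ⟨t, ht⟩ (H.observe t z.1),
        D.thinChoice (coin ⟨t, ht⟩) ⟨t, ht'⟩ (δ ⟨t, ht⟩ (H.observe t z.1)) z.2)
    have hsel : Measurable sel := (hk.comp measurable_fst).prodMk
      ((D.measurable_thinChoice _ _).comp ((hk.comp measurable_fst).prodMk measurable_snd))
    let V : Fin H.K × Fin B.K → H.Sample × B.Sample → Outcome H.n := fun j p =>
      if D.base j.2 = j.1 ∧ ¬ D.Hidden t j.2 then D.proj j.2 (p.2 (⟨t, ht'⟩, j.2))
      else p.1 (⟨t, ht⟩, j.1)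
    have hV : ∀ j, Measurable (V j) := by
      intro j
      by_cases hj : D.base j.2 = j.1 ∧ ¬ D.Hidden t j.2
      · simp only [V, if_pos hj]
        exact (D.measurable_proj _).comp (by fun_prop)
      · simp only [V, if_neg hj]
        fun_prop
    have hfresh : ∀ j, Fresh (H.sampleMeasure.prod B.sampleMeasure)
        (fun p : H.Sample × B.Sample => (D.simHist δ p.1 (B.hist (D.thin δ coin p.1) p.2 t) t,
          B.hist (D.thin δ coin p.1) p.2 t)) (V j) (H.law ⟨t, ht⟩ j.1) := by
      intro j
      by_cases hj : D.base j.2 = j.1 ∧ ¬ D.Hidden t j.2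
      · have h1 : V j = fun p => D.proj j.2 (p.2 (⟨t, ht'⟩, j.2)) := by
          funext p; simp only [V, if_pos hj]
        rw [h1, ← hj.1, ← D.map_proj_law ht' ht hj.2]
        refine Fresh.map (fresh_prod_right (W := fun ω' : B.Sample => ω' (⟨t, ht'⟩, j.2)) hZ
          (by fun_prop) fun ω => ?_) (D.measurable_proj _)
        refine fresh_sample (hZ.comp measurable_prodMk_left) (⟨t, ht'⟩, j.2) fun ω' o => ?_
        simp only [Function.comp]
        rw [hist_update_sample _ _ _ _ le_rfl]
      · have h1 : V j = fun p => p.1 (⟨t, ht⟩, j.1) := by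
          funext p; simp only [V, if_neg hj]
        rw [h1]
        refine fresh_prod_left (W := fun ω : H.Sample => ω (⟨t, ht⟩, j.1)) hZ
          (by fun_prop) fun ω' => ?_
        refine fresh_sample (hZ.comp measurable_prodMk_right) (⟨t, ht⟩, j.1) fun ω o => ?_
        simp only [Function.comp]
        rw [D.hist_thin_update_sample _ _ _ _ le_rfl, D.simHist_update_sample _ _ _ _ le_rfl]
    have hsucc : ∀ p : H.Sample × B.Sample,
        D.simHist δ p.1 (B.hist (D.thin δ coin p.1) p.2 (t + 1)) (t + 1) =
          Function.update (D.simHist δ p.1 (B.hist (D.thin δ coin p.1) p.2 t) t) t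
            (δ ⟨t, ht⟩ (H.observe t (D.simHist δ p.1 (B.hist (D.thin δ coin p.1) p.2 t) t)),
              V (sel (D.simHist δ p.1 (B.hist (D.thin δ coin p.1) p.2 t) t,
                B.hist (D.thin δ coin p.1) p.2 t)) p) := by
      intro p
      have h1 : D.simHist δ p.1 (B.hist (D.thin δ coin p.1) p.2 (t + 1)) t =
          D.simHist δ p.1 (B.hist (D.thin δ coin p.1) p.2 t) t :=
        D.simHist_congr p.1 fun s hs => by
          rw [hist_succ _ _ ht', Function.update_of_ne (by omega)]
      rw [D.simHist_succ _ _ ht, h1, hist_succ _ _ ht', Function.update_self, chosen_thin]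
      rfl
    have hmain := lintegral_fresh_select hZ hV hfresh hsel
      (f := fun q => f (Function.update q.1.1 t (δ ⟨t, ht⟩ (H.observe t q.1.1), q.2)))
      (hf.comp ((measurable_update_hist t).comp ((measurable_fst.comp measurable_fst).prodMk
        ((hk.comp (measurable_fst.comp measurable_fst)).prodMk measurable_snd))))
    simp only [hsucc]
    refine hmain.trans ?_
    rw [lintegral_hist_succ hδ ht hf]
    exact ih (by omega) (f := fun h => ∫⁻ o, f (Function.update h t
      (δ ⟨t, ht⟩ (H.observe t h), o)) ∂(H.law ⟨t, ht⟩ (δ ⟨t, ht⟩ (H.observe t h))))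
      (measurable_lintegral_step hk ⟨t, ht⟩ hf)

end Thin

end Copying

/-! ### A Chernoff bound for random subsets -/

/-- The law of a coin that shows `false` with probability `δ`. -/
def coinMeasure (δ : ℝ≥0) : Measure Bool := (1 - δ) • Measure.dirac true + δ • Measure.dirac false

theorem isProbabilityMeasure_coinMeasure {δ : ℝ≥0} (hδ : δ ≤ 1) :
    IsProbabilityMeasure (coinMeasure δ) := by
  refine ⟨?_⟩
  simp only [coinMeasure, Measure.coe_add, Measure.coe_nnreal_smul_apply, Pi.add_apply,
    measure_univ, mul_one]
  rw [← ENNReal.coe_add, tsub_add_cancel_of_le hδ, ENNReal.coe_one]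

theorem integral_coinMeasure {δ : ℝ≥0} (hδ : δ ≤ 1) (f : Bool → ℝ) :
    ∫ x, f x ∂(coinMeasure δ) = (1 - δ) * f true + δ * f false := by
  unfold coinMeasure
  rw [integral_add_measure (Integrable.of_finite) (Integrable.of_finite), integral_smul_nnreal_measure,
    integral_smul_nnreal_measure, integral_dirac, integral_dirac]
  simp [NNReal.smul_def, NNReal.coe_sub hδ]

theorem coinMeasure_false (δ : ℝ≥0) : coinMeasure δ {false} = δ := by
  simp [coinMeasure]

/-- From `exp x ≤ 1 + x + x²` for `|x| ≤ 1` and `a² ≤ a`. A bound linear in `a` is needed, since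
only the sum of the summands is controlled. -/
theorem exp_sub_one_le_of_le_one {l a : ℝ} (hl : 0 ≤ l) (hl1 : l ≤ 1) (ha : 0 ≤ a) (ha1 : a ≤ 1) :
    Real.exp (l * a) - 1 ≤ (l + l ^ 2) * a := by
  have h0 : 0 ≤ l * a := mul_nonneg hl ha
  have h1 : l * a ≤ 1 := mul_le_one₀ hl1 ha ha1
  have h2 := Real.abs_exp_sub_one_sub_id_le (x := l * a) (by rwa [abs_of_nonneg h0])
  have h3 := (abs_le.1 h2).2
  have h4 : a ^ 2 ≤ a := by nlinarith
  have h5 : l ^ 2 * a ^ 2 ≤ l ^ 2 * a := mul_le_mul_of_nonneg_left h4 (sq_nonneg l)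
  nlinarith

/-- If every summand is kept with probability `1 - δ`, then the sum of those kept is unlikely to
exceed `1 - δ / 2` times a bound for the complete sum. -/
theorem coin_sum_tail {m : ℕ} {δ : ℝ≥0} (hδ : δ ≤ 1) (a : Fin m → ℝ) (ha : ∀ s, 0 ≤ a s)
    (ha1 : ∀ s, a s ≤ 1) {L : ℝ} (hL : ∑ s, a s ≤ L) :
    (Measure.pi fun _ : Fin m => coinMeasure δ).real
      {x | (1 - δ / 2) * L ≤ ∑ s, if x s = true then a s else 0} ≤
      Real.exp (-(δ ^ 2 * L / 16)) := by
  have := isProbabilityMeasure_coinMeasure hδ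
  have hδ0 : (0 : ℝ) ≤ δ := δ.2
  have hδ1 : (δ : ℝ) ≤ 1 := hδ
  have hL0 : 0 ≤ L := (Finset.sum_nonneg fun s _ => ha s).trans hL
  -- The final exponent is `(-(δ/2) l + (1 - δ) l²) L`. The choice `l = δ / 4` minimises `-(δ/2) l +
  -- l²`, with value `-δ² / 16`.
  set l : ℝ := δ / 4 with hl
  have hl0 : 0 ≤ l := by positivity
  have hl1 : l ≤ 1 := by linarith
  refine (ProbabilityTheory.measure_ge_le_exp_mul_mgf _ hl0 Integrable.of_finite).trans ?_
  have hmgf : ProbabilityTheory.mgf (fun x : Fin m → Bool => ∑ s, if x s = true then a s else 0)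
      (Measure.pi fun _ : Fin m => coinMeasure δ) l ≤ Real.exp ((1 - δ) * (l + l ^ 2) * L) := by
    unfold ProbabilityTheory.mgf
    simp only [Finset.mul_sum, Real.exp_sum]
    refine (integral_fintype_prod_eq_prod (μ := fun _ => coinMeasure δ) (fun (s : Fin m) (c : Bool) =>
      Real.exp (l * if c = true then a s else 0))).le.trans ?_
    have h2 : ∀ s, ∫ c, Real.exp (l * if c = true then a s else 0) ∂(coinMeasure δ) ≤
        Real.exp ((1 - δ) * (l + l ^ 2) * a s) := by
      intro s
      rw [integral_coinMeasure hδ]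
      have h3 := exp_sub_one_le_of_le_one hl0 hl1 (ha s) (ha1 s)
      have h4 := mul_le_mul_of_nonneg_left h3 (sub_nonneg.2 hδ1)
      have h5 := Real.add_one_le_exp ((1 - δ) * (l + l ^ 2) * a s)
      simp only [if_true, Bool.false_eq_true, if_false, mul_zero, Real.exp_zero, mul_one]
      linarith
    refine (Finset.prod_le_prod (fun s _ => integral_nonneg fun c => (Real.exp_pos _).le)
      fun s _ => h2 s).trans ?_
    rw [← Real.exp_sum, ← Finset.mul_sum]
    refine Real.exp_le_exp.2 (mul_le_mul_of_nonneg_left hL ?_)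
    exact mul_nonneg (sub_nonneg.2 hδ1) (by positivity)
  refine (mul_le_mul_of_nonneg_left hmgf (Real.exp_pos _).le).trans ?_
  rw [← Real.exp_add]
  refine Real.exp_le_exp.2 ?_
  rw [hl]
  -- The remaining term `-δ³ L / 16` of the exponent has a favourable sign.
  have : 0 ≤ (δ : ℝ) ^ 3 * L := by positivity
  nlinarith

/-! ### Room for the requests kept by the coins -/

namespace Copying

variable {H B : Instance} (D : Copying H B)

/-- Request `t` is kept by the coins, and the available copies of each resource type that it needs
have room left for it even if no copy is filled up completely. -/
def Fits (coin : Fin H.m → Bool) (t : Fin H.m) (y : H.Hist) : Prop :=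
  coin t = true ∧ ∀ i, H.b t (y t).1 i t ≠ 0 →
    (∑ s : Fin H.m, if s < t ∧ coin s = true then (y s).2.1 i t else 0) +
      ((D.avail i t).card : ℝ≥0) ≤ ∑ r ∈ D.avail i t, B.c r

theorem measurableSet_fits (coin : Fin H.m → Bool) (t : Fin H.m) :
    MeasurableSet {y : H.Hist | D.Fits coin t y} := by
  have h1 : ∀ i, MeasurableSet {y : H.Hist | H.b t (y t).1 i t ≠ 0} := fun i =>
    (show Measurable fun y : H.Hist => (y t).1 by fun_prop)
      (MeasurableSet.of_discrete (s := {k | H.b t k i t ≠ 0}))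
  have h2 : ∀ i, MeasurableSet {y : H.Hist |
      (∑ s : Fin H.m, if s < t ∧ coin s = true then (y s).2.1 i t else 0) +
        ((D.avail i t).card : ℝ≥0) ≤ ∑ r ∈ D.avail i t, B.c r} := fun i => by
    refine measurableSet_le (Measurable.add_const (Finset.measurable_sum _ fun s _ => ?_) _)
      measurable_const
    split_ifs <;> fun_prop
  have h3 : {y : H.Hist | D.Fits coin t y} = {_y : H.Hist | coin t = true} ∩
      ⋂ i, {y : H.Hist | H.b t (y t).1 i t ≠ 0 →
        (∑ s : Fin H.m, if s < t ∧ coin s = true then (y s).2.1 i t else 0) +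
          ((D.avail i t).card : ℝ≥0) ≤ ∑ r ∈ D.avail i t, B.c r} := by
    ext y
    simp [Fits]
  rw [h3]
  refine (MeasurableSet.const _).inter ?_
  exact MeasurableSet.iInter fun i => MeasurableSet.imp (h1 i) (h2 i)

theorem pos_mem_avail (i : Fin H.n) (t : ℕ) : D.pos i ∈ D.avail i t := by
  simp [avail, D.orig_pos, D.tau_pos]

/-- If each needed resource type has an available copy with enough room, then there is a candidate. -/
theorem candidates_nonempty {t : ℕ} (ht : t < B.m) (ht' : t < H.m) {k : Fin H.K} {g : B.Hist}
    (h : ∀ i, H.b ⟨t, ht'⟩ k i t ≠ 0 → ∃ r ∈ D.avail i t,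
      H.b ⟨t, ht'⟩ k i t + ∑ s ∈ Finset.range t, (g s).2.1 r t ≤ B.c r) :
    (D.candidates ⟨t, ht⟩ k g).Nonempty := by
  classical
  -- Types not used at time `t` are assigned the original resource, which is always available.
  have h' : ∀ i, ∃ r ∈ D.avail i t, H.b ⟨t, ht'⟩ k i t ≠ 0 →
      H.b ⟨t, ht'⟩ k i t + ∑ s ∈ Finset.range t, (g s).2.1 r t ≤ B.c r := by
    intro i
    by_cases hi : H.b ⟨t, ht'⟩ k i t = 0
    · exact ⟨D.pos i, D.pos_mem_avail i t, fun h => absurd hi h⟩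
    · obtain ⟨r, hr, hr'⟩ := h i hi
      exact ⟨r, hr, fun _ => hr'⟩
  choose f hf hf' using h'
  have hf1 : ∀ i, D.orig (f i) = i ∧ D.tau (f i) ≤ t := fun i => (Finset.mem_filter.1 (hf i)).2
  obtain ⟨k', hk', hs⟩ := D.exists_act k f fun i => (hf1 i).1
  refine ⟨k', hk', ?_, ?_⟩
  · rintro ⟨i, hi⟩
    by_cases hik : i ∈ H.supp k
    · rw [hs i hik] at hi
      have := (hf1 i).2
      dsimp only at hi
      omega
    · rw [D.sel_of_notMem k' i (by rwa [hk']), D.tau_pos] at hi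
      omega
  · intro r hr
    rw [D.b_eq t ht ht', hk'] at hr ⊢
    have hsel : D.sel k' (D.orig r) = r := by
      by_contra hc
      simp [hc] at hr
    rw [if_pos hsel] at hr ⊢
    have hmem : D.orig r ∈ H.supp k := by
      by_contra hc
      exact hr (H.b_eq_zero _ _ _ _ hc)
    have hfr : f (D.orig r) = r := (hs _ hmem).symm.trans hsel
    have := hf' (D.orig r) hr
    rw [hfr] at this
    exact this.trans le_self_add

/-- Almost surely, the outcomes of actions that are not hidden are determined by the outcomes of the
original actions. -/
theorem ae_lift_proj : ∀ᵐ ω ∂B.sampleMeasure, ∀ (t : Fin B.m) (k : Fin B.K), ¬ D.Hidden t k →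
    D.lift t k (D.proj k (ω (t, k))) = ω (t, k) := by
  rw [ae_all_iff]; intro t
  rw [ae_all_iff]; intro k
  by_cases hk : D.Hidden t k
  · exact Filter.Eventually.of_forall fun ω h => absurd hk h
  have hp : MeasurePreserving (Function.eval (t, k)) B.sampleMeasure (B.law t k) :=
    measurePreserving_eval (fun p : Fin B.m × Fin B.K => B.law p.1 p.2) (t, k)
  have ht' : (t : ℕ) < H.m := by rw [← D.m_eq]; exact t.isLt
  have h1 : ∀ᵐ o ∂(B.law t k), D.lift t k (D.proj k o) = o := by
    rw [D.law_eq_map_lift t.isLt ht', ae_map_iff (D.measurable_lift t k).aemeasurable]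
    · exact Filter.Eventually.of_forall fun o => by rw [D.proj_lift hk]
    · exact measurableSet_eq_fun ((D.measurable_lift t k).comp (D.measurable_proj k)) measurable_id
  filter_upwards [hp.quasiMeasurePreserving.ae h1] with ω hω _
  exact hω

section Thin

variable {δ : Fin H.m → H.Hist → Fin H.K} {coin : Fin H.m → Bool}

/-- The rewards of the thinned policy are at least those of the simulated policy at all requests that
fit. -/
theorem reward_le_of_fits {ω : H.Sample} {ω' : B.Sample}
    (hl : ∀ (t : Fin B.m) (k : Fin B.K), ¬ D.Hidden t k →
      D.lift t k (D.proj k (ω' (t, k))) = ω' (t, k))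
    (h0 : ∀ (t : Fin B.m) (i : Fin B.n) (l : ℕ), (t : ℕ) ≤ l → (ω' (t, B.k₀)).1 i l = 0)
    (t : Fin H.m)
    (hfit : D.Fits coin t (D.simHist δ ω (B.hist (D.thin δ coin ω) ω' B.m) H.m)) (r : Fin B.n) :
    (D.simHist δ ω (B.hist (D.thin δ coin ω) ω' B.m) H.m t).2.2 (D.orig r) ≤
      (B.hist (D.thin δ coin ω) ω' B.m t).2.2 r := by
  set g := B.hist (D.thin δ coin ω) ω' B.m with hg
  set y := D.simHist δ ω g H.m with hy
  have hm := D.m_eq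
  have hgt : ∀ s ≤ B.m, ∀ r < s, B.hist (D.thin δ coin ω) ω' s r = g r := by
    intro s hs r hr
    rw [hist_apply _ ω' hr hs, hg, hist_apply _ ω' (hr.trans_le hs) le_rfl]
  -- the choices in `B`
  let kB : ∀ s, s < B.m → Fin B.K := fun s hs => D.thin δ coin ω ⟨s, hs⟩ g
  have hthin : ∀ s (hs : s < B.m), B.chosen (D.thin δ coin ω) ω' ⟨s, hs⟩ = kB s hs := by
    intro s hs
    rw [chosen_thin]
    exact D.thin_congr ω ⟨s, hs⟩ (hgt s hs.le)
  have hgval : ∀ s (hs : s < B.m), g s = (kB s hs, ω' (⟨s, hs⟩, kB s hs)) := by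
    intro s hs
    rw [hg, hist_apply _ ω' hs le_rfl, hthin]
  -- the simulated choices
  have hyval : ∀ s (hs : s < H.m), y s =
      (δ ⟨s, hs⟩ (H.observe s (D.simHist δ ω g s)),
        if D.base (g s).1 = δ ⟨s, hs⟩ (H.observe s (D.simHist δ ω g s)) ∧
            ¬ D.Hidden s (g s).1 then D.proj (g s).1 (g s).2
          else ω (⟨s, hs⟩, δ ⟨s, hs⟩ (H.observe s (D.simHist δ ω g s)))) := by
    intro s hs
    rw [hy, D.simHist_apply ω g hs le_rfl, D.simHist_succ ω g hs, Function.update_self]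
  have hkB : ∀ s (hs : s < B.m) (hs' : s < H.m), kB s hs =
      D.thinChoice (coin ⟨s, hs'⟩) ⟨s, hs⟩ (y s).1 g := by
    intro s hs hs'
    rw [hyval s hs']
    rfl
  have hcand : ∀ s (hs : s < B.m) (hs' : s < H.m), kB s hs ∈ D.candidates ⟨s, hs⟩ (y s).1 g →
      (g s).2 = D.lift s (kB s hs) (y s).2 := by
    intro s hs hs' hc
    have hb : D.base (kB s hs) = (y s).1 := hc.1
    rw [hyval s hs'] at hb ⊢
    rw [hgval s hs]
    simp only at hb ⊢
    rw [if_pos ⟨hb, hc.2.1⟩]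
    exact (hl ⟨s, hs⟩ _ hc.2.1).symm
  -- An earlier request occupies copies only if its coin kept it and it was implemented; its total
  -- use is then that of the simulated request.
  have huse : ∀ s (hs : s < t.val) (i), ∑ r ∈ D.avail i t, (g s).2.1 r t ≤
      if coin ⟨s, hs.trans t.isLt⟩ = true then (y s).2.1 i t else 0 := by
    intro s hs i
    have hsB : s < B.m := by omega
    have hsH : s < H.m := by omega
    have hz : kB s hsB = B.k₀ → ∑ r ∈ D.avail i t, (g s).2.1 r t = 0 := by
      intro h
      refine Finset.sum_eq_zero fun r _ => ?_
      rw [hgval s hsB, h]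
      exact h0 ⟨s, hsB⟩ r t hs.le
    by_cases hc : coin ⟨s, hsH⟩ = true
    · rw [if_pos hc]
      rcases D.thinChoice_cases (coin ⟨s, hsH⟩) ⟨s, hsB⟩ (y s).1 g with h | h
      · rw [← hkB s hsB hsH] at h
        rw [hcand s hsB hsH h]
        exact (D.sum_lift_avail hs.le h.2.1 i _ _).le
      · rw [← hkB s hsB hsH] at h
        rw [hz h]
        exact zero_le
    · rw [if_neg hc, hz]
      rw [hkB s hsB hsH]
      unfold thinChoice
      rw [if_neg hc]
  have htB : (t : ℕ) < B.m := by omega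
  have hne : (D.candidates ⟨t, htB⟩ (y t).1 g).Nonempty := by
    refine D.candidates_nonempty htB t.isLt fun i hi => ?_
    -- Pigeonhole: if no copy had room, each would have less than one unit free, as `b ≤ 1`, and the
    -- total free room would be below the number of copies.
    by_contra hc
    push Not at hc
    have hsum := hfit.2 i hi
    have h1 : ∑ r ∈ D.avail i t, B.c r <
        ∑ r ∈ D.avail i t, (1 + ∑ s ∈ Finset.range t, (g s).2.1 r t) := by
      refine Finset.sum_lt_sum_of_nonempty ⟨_, D.pos_mem_avail i t⟩ fun r hr => ?_
      exact (hc r hr).trans_le (add_le_add (H.b_le_one _ _ _ _) le_rfl)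
    -- The right side also counts kept requests that could not be implemented. This makes `Fits` a
    -- condition on the coins and the simulated history alone.
    have h2 : ∑ r ∈ D.avail i t, ∑ s ∈ Finset.range t, (g s).2.1 r t ≤
        ∑ s : Fin H.m, if s < t ∧ coin s = true then (y s).2.1 i t else 0 := by
      rw [Finset.sum_comm]
      have h3 : ∑ s : Fin H.m, (if s < t ∧ coin s = true then (y s).2.1 i t else 0) =
          ∑ s ∈ Finset.range H.m, if hs : s < H.m then
            (if s < (t : ℕ) ∧ coin ⟨s, hs⟩ = true then (y s).2.1 i t else 0) else 0 := by
        rw [Finset.sum_range]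
        refine Finset.sum_congr rfl fun s _ => ?_
        rw [dif_pos s.isLt]
        rfl
      rw [h3]
      refine le_trans ?_ (Finset.sum_le_sum_of_subset (s := Finset.range t)
        (fun s hs => Finset.mem_range.2 ((Finset.mem_range.1 hs).trans t.isLt)))
      refine Finset.sum_le_sum fun s hs => ?_
      have hs := Finset.mem_range.1 hs
      refine (huse s hs i).trans ?_
      rw [dif_pos (hs.trans t.isLt)]
      simp only [hs, true_and]
      exact le_rfl
    rw [Finset.sum_add_distrib, Finset.sum_const, nsmul_eq_mul, mul_one, add_comm] at h1
    exact absurd (h1.trans_le ((add_le_add h2 le_rfl).trans hsum)) (lt_irrefl _)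
  have hkmem : kB t htB ∈ D.candidates ⟨t, htB⟩ (y t).1 g := by
    rw [hkB t htB t.isLt]
    unfold thinChoice
    rw [if_pos hfit.1]
    exact pick_mem _ hne
  rw [hcand t htB t.isLt hkmem]
  have hnh : ¬ D.Hidden t (kB t htB) := hkmem.2.1
  simp [lift, hnh]

end Thin

end Copying

/-! ### The benchmark of a copied instance -/

namespace Copying

variable {H B : Instance} (D : Copying H B)

/-- A request fits with high probability. -/
theorem le_measure_fits {δ : ℝ≥0} (hδ : δ ≤ 1) {d : ℕ} {c : ℝ} (t : Fin H.m) (y : H.Hist)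
    (L : Fin H.n → ℝ) (hL : ∀ i, (1 - δ / 2) * L i + (D.avail i t).card ≤
      ∑ r ∈ D.avail i t, (B.c r : ℝ)) (hcL : ∀ i, c ≤ L i)
    (hd : (Finset.univ.filter fun i => H.b t (y t).1 i t ≠ 0).card ≤ d)
    (hy1 : ∀ s : Fin H.m, s < t → ∀ i, (y s).2.1 i t ≤ 1)
    (hyL : ∀ i, H.b t (y t).1 i t ≠ 0 → ((∑ s ∈ Finset.range t, (y s).2.1 i t : ℝ≥0) : ℝ) ≤ L i) :
    ENNReal.ofReal (1 - δ - d * Real.exp (-(δ ^ 2 * c / 16))) ≤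
      (Measure.pi fun _ : Fin H.m => coinMeasure δ) {coin | D.Fits coin t y} := by
  have := isProbabilityMeasure_coinMeasure hδ
  set μ := Measure.pi fun _ : Fin H.m => coinMeasure δ with hμ
  set I := Finset.univ.filter fun i => H.b t (y t).1 i t ≠ 0 with hI
  let a : Fin H.n → Fin H.m → ℝ := fun i s => if s < t then (y s).2.1 i t else 0
  let bad : Fin H.n → Set (Fin H.m → Bool) := fun i =>
    {x | (1 - δ / 2) * L i ≤ ∑ s, if x s = true then a i s else 0}
  have hbad : ∀ i ∈ I, μ.real (bad i) ≤ Real.exp (-(δ ^ 2 * c / 16)) := by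
    intro i hi
    refine (coin_sum_tail hδ (a i) ?_ ?_ (L := L i) ?_).trans ?_
    · intro s
      simp only [a]
      split_ifs <;> simp
    · intro s
      simp only [a]
      split_ifs with h
      · exact_mod_cast hy1 s h i
      · simp
    · refine le_trans (le_of_eq ?_) (hyL i (Finset.mem_filter.1 hi).2)
      push_cast
      have h1 : ∑ s : Fin H.m, a i s =
          ∑ s ∈ Finset.range H.m, if s < (t : ℕ) then ((y s).2.1 i t : ℝ) else 0 := by
        rw [Finset.sum_range]
        rfl
      rw [h1, ← Finset.sum_filter]
      congr 1
      ext s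
      simp only [Finset.mem_filter, Finset.mem_range]
      have := t.isLt
      omega
    · refine Real.exp_le_exp.2 ?_
      have := mul_le_mul_of_nonneg_left (hcL i) (sq_nonneg (δ : ℝ))
      linarith
  have hfalse : μ.real {x | x t = false} = δ := by
    have hp : MeasurePreserving (Function.eval t) μ (coinMeasure δ) :=
      measurePreserving_eval (fun _ : Fin H.m => coinMeasure δ) t
    have h1 := hp.measure_preimage (MeasurableSet.of_discrete (s := {false})).nullMeasurableSet
    rw [coinMeasure_false] at h1
    have h2 : μ {x | x t = false} = δ := h1
    rw [measureReal_def, h2, ENNReal.coe_toReal]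
  -- If the coin keeps `t` and no needed type is in its Chernoff tail, the kept use is below `(1 -
  -- δ/2) L i`, and `hL` leaves one unit per copy.
  have hsub : {coin | D.Fits coin t y}ᶜ ⊆ {x | x t = false} ∪ ⋃ i ∈ I, bad i := by
    intro x hx
    by_contra hc
    simp only [Set.mem_union, Set.mem_ofPred_eq, Set.mem_iUnion, not_or, not_exists,
      Bool.not_eq_false] at hc
    refine hx ⟨hc.1, fun i hi => ?_⟩
    have h1 := hc.2 i (Finset.mem_filter.2 ⟨Finset.mem_univ i, hi⟩)
    simp only [bad, Set.mem_ofPred_eq, not_le] at h1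
    rw [← NNReal.coe_le_coe]
    push_cast
    have h2 : ∑ s, (if s < t ∧ x s = true then ((y s).2.1 i t : ℝ) else 0) =
        ∑ s, if x s = true then a i s else 0 := by
      refine Finset.sum_congr rfl fun s _ => ?_
      by_cases h3 : s < t <;> by_cases h4 : x s = true <;> simp [a, h3, h4]
    have h5 : ∀ s : Fin H.m, ((if s < t ∧ x s = true then (y s).2.1 i t else 0 : ℝ≥0) : ℝ) =
        if s < t ∧ x s = true then ((y s).2.1 i t : ℝ) else 0 := fun s => by
      split_ifs <;> simp
    simp only [h5, h2]
    linarith [hL i]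
  have hcompl : μ.real {coin | D.Fits coin t y}ᶜ ≤ δ + d * Real.exp (-(δ ^ 2 * c / 16)) := by
    refine (measureReal_mono hsub).trans ((measureReal_union_le _ _).trans ?_)
    rw [hfalse]
    refine add_le_add le_rfl ((measureReal_biUnion_finset_le _ _).trans ?_)
    refine (Finset.sum_le_sum hbad).trans ?_
    rw [Finset.sum_const, nsmul_eq_mul]
    exact mul_le_mul_of_nonneg_right (by exact_mod_cast hd) (Real.exp_pos _).le
  rw [probReal_compl_eq_one_sub MeasurableSet.of_discrete] at hcompl
  rw [← ofReal_measureReal (μ := μ)]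
  exact ENNReal.ofReal_le_ofReal (by linarith)

/-- The policy for `B` that thins a policy for `H`. -/
def thinPolicy (π : H.Policy) {δ : ℝ≥0} (hδ : δ ≤ 1) : B.Policy :=
  have := isProbabilityMeasure_coinMeasure hδ
  -- The seed holds the seed of `π`, the coins, and a sample that supplies the outcomes of choices
  -- not implemented.
  { S := (π.S × (Fin H.m → Bool)) × H.Sample
    σ := (π.σ.prod (Measure.pi fun _ => coinMeasure δ)).prod H.sampleMeasure
    act := fun t x g => D.thin (fun t => π.act t x.1.1) x.1.2 x.2 t g }

theorem measurable_thinPolicy {π : H.Policy}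
    (hπ : ∀ t, Measurable fun p : π.S × H.Hist => π.act t p.1 p.2) (t : Fin B.m) :
    Measurable fun p : ((π.S × (Fin H.m → Bool)) × H.Sample) × B.Hist =>
      D.thin (fun t => π.act t p.1.1.1) p.1.1.2 p.1.2 t p.2 :=
  (D.measurable_thin hπ t).comp ((measurable_fst.comp measurable_fst).prodMk
    ((measurable_snd.comp measurable_fst).prodMk measurable_snd))

theorem admissible_thinPolicy {π : H.Policy} (hπ : π.Admissible) {δ : ℝ≥0} (hδ : δ ≤ 1) :
    (D.thinPolicy π hδ).Admissible := by
  refine ⟨D.measurable_thinPolicy hπ.1, Filter.Eventually.of_forall fun x t => ?_⟩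
  change B.Implementable t _ (B.chosen (D.thin (fun t => π.act t x.1.1.1) x.1.1.2 x.1.2) x.2 t)
  rw [chosen_thin]
  exact D.implementable_thin _ _ _

open scoped Classical in
/-- The total reward for `i` at the requests that fit. -/
def fitReward (i : Fin H.n) (coin : Fin H.m → Bool) (y : H.Hist) : ℝ≥0∞ :=
  ∑ t : Fin H.m, if D.Fits coin t y then ((y t).2.2 i : ℝ≥0∞) else 0

theorem measurable_fitReward (i : Fin H.n) :
    Measurable fun p : (Fin H.m → Bool) × H.Hist => D.fitReward i p.1 p.2 := by
  refine measurable_from_prod_countable_right fun coin => ?_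
  refine Finset.measurable_sum _ fun t _ => ?_
  exact Measurable.ite (D.measurableSet_fits coin t) (by fun_prop) measurable_const

theorem lintegral_fitReward (i : Fin H.n) (μ : Measure (Fin H.m → Bool)) (y : H.Hist) :
    ∫⁻ coin, D.fitReward i coin y ∂μ =
      ∑ t : Fin H.m, μ {coin | D.Fits coin t y} * ((y t).2.2 i : ℝ≥0∞) := by
  classical
  unfold fitReward
  rw [lintegral_finsetSum _ fun t _ => Measurable.of_discrete]
  refine Finset.sum_congr rfl fun t _ => ?_
  have : ∀ coin, (if D.Fits coin t y then ((y t).2.2 i : ℝ≥0∞) else 0) =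
      {coin | D.Fits coin t y}.indicator (fun _ => ((y t).2.2 i : ℝ≥0∞)) coin := fun coin => by
    simp [Set.indicator_apply]
  simp only [this]
  rw [lintegral_indicator MeasurableSet.of_discrete, lintegral_const, Measure.restrict_apply_univ,
    mul_comm]

theorem ae_trivial_use : ∀ᵐ ω ∂B.sampleMeasure, ∀ (t : Fin B.m) (i : Fin B.n) (l : ℕ),
    (t : ℕ) ≤ l → (ω (t, B.k₀)).1 i l = 0 := by
  filter_upwards [B.ae_sample] with ω hω t i l hl
  have hb : B.b t B.k₀ i l = 0 := B.b_eq_zero _ _ _ _ (by simp [B.supp_trivial])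
  rcases (hω t B.k₀).1 i l hl with h | h
  · exact h
  · rw [h, hb]

/-- On the left, coins are drawn independently of a genuine run of `π`. For fixed seed and coins the
simulated history has the law of that run, and in `B` the requests that fit earn at least the
simulated rewards. -/
theorem lintegral_fitReward_le {π : H.Policy} (hπ : π.Admissible) {δ : ℝ≥0} (hδ : δ ≤ 1)
    (r : Fin B.n) :
    ∫⁻ x, ∫⁻ coin, D.fitReward (D.orig r) coin (H.hist (fun t => π.act t x.1) x.2 H.m)
        ∂(Measure.pi fun _ => coinMeasure δ) ∂π.joint ≤
      ∫⁻ x, ∑ t : Fin B.m, (((B.hist (fun t => (D.thinPolicy π hδ).act t x.1) x.2 B.m t).2.2 r :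
        ℝ≥0) : ℝ≥0∞) ∂(D.thinPolicy π hδ).joint := by
  have := isProbabilityMeasure_coinMeasure hδ
  set κ := Measure.pi fun _ : Fin H.m => coinMeasure δ with hκ
  let P := ((π.S × (Fin H.m → Bool)) × H.Sample) × B.Sample
  let gB : P → B.Hist := fun x =>
    B.hist (D.thin (fun t => π.act t x.1.1.1) x.1.1.2 x.1.2) x.2 B.m
  let Y : P → H.Hist := fun x => D.simHist (fun t => π.act t x.1.1.1) x.1.2 (gB x) H.m
  have hgB : Measurable gB :=
    measurable_hist (S := (π.S × (Fin H.m → Bool)) × H.Sample)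
      (act := fun t x g => D.thin (fun t => π.act t x.1.1) x.1.2 x.2 t g)
      (D.measurable_thinPolicy hπ.1) B.m
  have hY : Measurable Y := (D.measurable_simHist hπ.1 H.m).comp
    ((show Measurable fun x : P => x.1.1.1 by fun_prop).prodMk
      ((show Measurable fun x : P => x.1.2 by fun_prop).prodMk hgB))
  have hF : Measurable fun x : P => D.fitReward (D.orig r) x.1.1.2 (Y x) :=
    (D.measurable_fitReward (D.orig r)).comp
      ((show Measurable fun x : P => x.1.1.2 by fun_prop).prodMk hY)
  have hhist := measurable_hist hπ.1 H.m
  have hG : Measurable fun q : (π.S × (Fin H.m → Bool)) × H.Sample =>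
      D.fitReward (D.orig r) q.1.2 (H.hist (fun t => π.act t q.1.1) q.2 H.m) :=
    (D.measurable_fitReward (D.orig r)).comp
      ((show Measurable fun q : (π.S × (Fin H.m → Bool)) × H.Sample => q.1.2 by fun_prop).prodMk
        (hhist.comp ((measurable_fst.comp measurable_fst).prodMk measurable_snd)))
  have h1 : ∫⁻ x, D.fitReward (D.orig r) x.1.1.2 (Y x)
        ∂(((π.σ.prod κ).prod H.sampleMeasure).prod B.sampleMeasure) ≤
      ∫⁻ x, ∑ t : Fin B.m, (((gB x t).2.2 r : ℝ≥0) : ℝ≥0∞)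
        ∂(((π.σ.prod κ).prod H.sampleMeasure).prod B.sampleMeasure) := by
    refine lintegral_mono_ae ?_
    have h2 : ∀ᵐ x ∂(((π.σ.prod κ).prod H.sampleMeasure).prod B.sampleMeasure),
        (∀ (t : Fin B.m) (k : Fin B.K), ¬ D.Hidden t k →
          D.lift t k (D.proj k (x.2 (t, k))) = x.2 (t, k)) ∧
        ∀ (t : Fin B.m) (i : Fin B.n) (l : ℕ), (t : ℕ) ≤ l → (x.2 (t, B.k₀)).1 i l = 0 :=
      Measure.quasiMeasurePreserving_snd.ae (D.ae_lift_proj.and ae_trivial_use)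
    filter_upwards [h2] with x hx
    have h3 : ∑ t : Fin B.m, (((gB x t).2.2 r : ℝ≥0) : ℝ≥0∞) =
        ∑ t : Fin H.m, (((gB x t).2.2 r : ℝ≥0) : ℝ≥0∞) := by
      rw [Fin.sum_univ_eq_sum_range (fun t => (((gB x t).2.2 r : ℝ≥0) : ℝ≥0∞)),
        Fin.sum_univ_eq_sum_range (fun t => (((gB x t).2.2 r : ℝ≥0) : ℝ≥0∞)), D.m_eq]
    rw [h3]
    refine Finset.sum_le_sum fun t _ => ?_
    split_ifs with hfit
    · exact_mod_cast D.reward_le_of_fits hx.1 hx.2 t hfit r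
    · exact zero_le
  refine le_trans (le_of_eq ?_) h1
  rw [lintegral_prod _ hF.aemeasurable, lintegral_prod _ (hF.lintegral_prod_right').aemeasurable]
  have h4 : ∀ z : π.S × (Fin H.m → Bool),
      ∫⁻ ω, ∫⁻ ω', D.fitReward (D.orig r) z.2 (Y ((z, ω), ω')) ∂B.sampleMeasure ∂H.sampleMeasure =
      ∫⁻ ω, D.fitReward (D.orig r) z.2 (H.hist (fun t => π.act t z.1) ω H.m)
        ∂H.sampleMeasure := by
    intro z
    have h5 : Measurable fun p : H.Sample × B.Sample =>
        D.fitReward (D.orig r) z.2 (Y ((z, p.1), p.2)) :=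
      hF.comp ((measurable_const.prodMk measurable_fst).prodMk measurable_snd)
    rw [← lintegral_prod _ h5.aemeasurable]
    have h6 := D.lintegral_simHist (δ := fun t => π.act t z.1) (coin := z.2)
      (fun t => (hπ.1 t).comp measurable_prodMk_left) (le_refl H.m)
      (f := fun y => D.fitReward (D.orig r) z.2 y)
      ((D.measurable_fitReward (D.orig r)).comp measurable_prodMk_left)
    rw [← h6]
    simp only [Y, gB, D.m_eq]
  simp only [h4]
  rw [lintegral_prod _ (hG.lintegral_prod_right').aemeasurable]
  have hG2 : Measurable fun q : (π.S × H.Sample) × (Fin H.m → Bool) =>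
      D.fitReward (D.orig r) q.2 (H.hist (fun t => π.act t q.1.1) q.1.2 H.m) :=
    (D.measurable_fitReward (D.orig r)).comp
      (measurable_snd.prodMk (hhist.comp measurable_fst))
  unfold Policy.joint
  rw [lintegral_prod _ (hG2.lintegral_prod_right').aemeasurable]
  refine lintegral_congr fun s => ?_
  -- After `h4` the history no longer depends on the coins, so they can be averaged for a given
  -- history.
  refine lintegral_lintegral_swap (f := fun ω coin =>
    D.fitReward (D.orig r) coin (H.hist (fun t => π.act t s) ω H.m)) ?_
  exact (hG2.comp (show Measurable fun p : H.Sample × (Fin H.m → Bool) => ((s, p.1), p.2) by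
    fun_prop)).aemeasurable

/-- The benchmark of `B` is almost as good as that of `H`, if the copies that are available make up
for almost all of the inventory of `H`. -/
theorem mul_OPT_le {δ : ℝ≥0} (hδ : δ ≤ 1) {d : ℕ} {c : ℝ} (hc : ∀ i, c ≤ H.c i)
    (hd : ∀ t k, (Finset.univ.filter fun i => H.b t k i t ≠ 0).card ≤ d)
    (hcap : ∀ (t : Fin H.m) i, (1 - δ / 2) * ((H.c i +
      ∑ l ∈ Finset.univ.filter (fun l : Fin H.m => l ≤ t), H.zeta i l : ℝ≥0) : ℝ) +
        (D.avail i t).card ≤ ∑ r ∈ D.avail i t, (B.c r : ℝ)) :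
    ENNReal.ofReal (1 - δ - d * Real.exp (-(δ ^ 2 * c / 16))) * H.OPT ≤ B.OPT := by
  set ρ := ENNReal.ofReal (1 - δ - d * Real.exp (-(δ ^ 2 * c / 16))) with hρ
  unfold Instance.OPT
  simp only [ENNReal.mul_iSup]
  refine iSup₂_le fun π hπ => ?_
  refine le_trans ?_ (le_iSup₂ (f := fun (π : B.Policy) (_ : π.Admissible) => π.value)
    (D.thinPolicy π hδ) (D.admissible_thinPolicy hπ hδ))
  rw [Policy.value_eq, Policy.value_eq]
  refine le_iInf fun r => ?_
  -- Copy `r` counts the rewards of `orig r`, so this type is the one to compare with.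
  refine (mul_le_mul_right (iInf_le _ (D.orig r)) ρ).trans ?_
  refine le_trans ?_ (D.lintegral_fitReward_le hπ hδ r)
  rw [← lintegral_const_mul]
  swap
  · refine Finset.measurable_sum _ fun t _ => ?_
    have hhist := measurable_hist hπ.1 H.m
    have : Measurable fun h : H.Hist => (((h t).2.2 (D.orig r) : ℝ≥0) : ℝ≥0∞) := by fun_prop
    exact this.comp hhist
  have hsample : ∀ᵐ x ∂π.joint, ∀ (t : Fin H.m) (k : Fin H.K),
      (∀ (i : Fin H.n) (l : ℕ), (t : ℕ) ≤ l →
        (x.2 (t, k)).1 i l = 0 ∨ (x.2 (t, k)).1 i l = H.b t k i l) ∧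
      ∀ (i : Fin H.n) (l l' : ℕ), (t : ℕ) ≤ l → l ≤ l' →
        (x.2 (t, k)).1 i l' ≤ (x.2 (t, k)).1 i l :=
    Measure.quasiMeasurePreserving_snd.ae H.ae_sample
  refine lintegral_mono_ae ?_
  filter_upwards [hsample, hπ.2] with x hx himp
  rw [lintegral_fitReward, Finset.mul_sum]
  -- For a fixed run of `π` only the coins decide what fits, so the factor is obtained request by
  -- request.
  refine Finset.sum_le_sum fun t _ => mul_le_mul_left ?_ _
  set h := H.hist (fun t => π.act t x.1) x.2 H.m with hh
  have hval : ∀ s : Fin H.m, h s = (H.chosen (fun t => π.act t x.1) x.2 s,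
      x.2 (s, H.chosen (fun t => π.act t x.1) x.2 s)) := fun s => by
    rw [hh, hist_apply _ _ s.isLt le_rfl]
  refine D.le_measure_fits hδ t h
    (fun i => ((H.c i + ∑ l ∈ Finset.univ.filter (fun l : Fin H.m => l ≤ t), H.zeta i l : ℝ≥0) : ℝ))
    (fun i => hcap t i) ?_ (hd _ _) ?_ ?_
  · intro i
    refine (hc i).trans ?_
    exact_mod_cast le_self_add
  · intro s hst i
    rw [hval s]
    rcases (hx s (H.chosen (fun t => π.act t x.1) x.2 s)).1 i t hst.le with h' | h' <;> rw [h']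
    · exact zero_le
    · exact H.b_le_one _ _ _ _
  · intro i hi
    rw [hval t] at hi
    -- Feasibility of `π` in `H` bounds the use of a needed type by the inventory that has arrived.
    have h1 := himp t i hi
    have h2 : ∑ s ∈ Finset.range t, (h s).2.1 i t =
        ∑ s ∈ Finset.range t, (H.hist (fun t => π.act t x.1) x.2 t s).2.1 i t := by
      refine Finset.sum_congr rfl fun s hs => ?_
      have hs := Finset.mem_range.1 hs
      rw [hh, hist_apply _ _ (hs.trans t.isLt) le_rfl, hist_apply _ _ hs t.isLt.le]
    rw [h2]
    exact_mod_cast le_add_self.trans h1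

end Copying

/-! ### Constants and conclusion -/

theorem Instance.cmin_le (H : Instance) (i : Fin H.n) : H.cmin ≤ H.c i :=
  ciInf_le (OrderBot.bddBelow _) i

/-- If the inventory that has arrived exceeds the inventory `T` of the available copies by at most the
threshold, then leaving one unit of each copy unused costs a small fraction of the inventory. -/
theorem capacity_bound {δ r T p N : ℝ} (hr : 0 < r) (hδ : 4 / r ≤ δ)
    (hrT : r ^ 2 ≤ T) (hp0 : 0 ≤ p) (hp : p ≤ r) (hN : N * r ≤ T) :
    (1 - δ / 2) * (T + p) + N ≤ T := by
  have hT : 0 ≤ T := (sq_nonneg r).trans hrT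
  have h1 : (1 - δ / 2) * (T + p) ≤ (1 - 2 / r) * (T + p) := by
    refine mul_le_mul_of_nonneg_right ?_ (by linarith)
    have : 4 / r = 2 * (2 / r) := by ring
    linarith
  -- Of the two shares `T / r` set aside by `δ ≥ 4 / r`, one covers the pending amount `p ≤ r ≤ T /
  -- r` and the other the `N` units left free.
  have h2 : N ≤ T / r := (le_div_iff₀ hr).2 hN
  have h3 : r ≤ T / r := (le_div_iff₀ hr).2 (by linarith [sq r])
  have h4 : (1 - 2 / r) * (T + p) = T + p - 2 * (T / r) - 2 * (p / r) := by ring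
  have h5 : 0 ≤ p / r := div_nonneg hp0 hr.le
  linarith

/-- Since `cd ≥ 2`, the logarithm is at least `1/4`. Losses of order `1 / √c` are thereby absorbed
into the main term. -/
theorem inv_sqrt_le_loss {c : ℝ} (hc : 2 ≤ c) {d : ℕ} (hd : 1 ≤ d) :
    1 / √c ≤ 2 * √(Real.log (c * d) / c) := by
  have hd' : (1 : ℝ) ≤ d := by exact_mod_cast hd
  have hc0 : 0 < c := by linarith
  have h1 : (1 : ℝ) / 4 ≤ Real.log (c * d) := by
    have h2 : Real.log 2 ≤ Real.log (c * d) := Real.log_le_log (by norm_num) (by nlinarith)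
    linarith [Real.log_two_gt_d9]
  have h2 : 1 / 2 / √c ≤ √(Real.log (c * d) / c) := by
    refine Real.le_sqrt_of_sq_le ?_
    rw [div_pow, Real.sq_sqrt hc0.le]
    refine div_le_div_of_nonneg_right ?_ hc0.le
    linarith
  have h3 : 1 / √c = 2 * (1 / 2 / √c) := by ring
  linarith

/-- With `δ = 8 √(log (cd) / c)` the exponent is `-4 log (cd)`. Already the first power of `1 /
(cd)` suffices: the union bound over `d` types then costs `1 / c ≤ 1 / √c`. -/
theorem failure_le {c : ℝ} (hc : 2 ≤ c) {d : ℕ} (hd : 1 ≤ d) :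
    d * Real.exp (-((8 * √(Real.log (c * d) / c)) ^ 2 * c / 16)) ≤
      2 * √(Real.log (c * d) / c) := by
  have hd' : (1 : ℝ) ≤ d := by exact_mod_cast hd
  have hc0 : 0 < c := by linarith
  have hcd : 1 ≤ c * d := by nlinarith
  have hlog : 0 ≤ Real.log (c * d) := Real.log_nonneg hcd
  have h1 : (8 * √(Real.log (c * d) / c)) ^ 2 * c / 16 = 4 * Real.log (c * d) := by
    rw [mul_pow, Real.sq_sqrt (div_nonneg hlog hc0.le)]
    field_simp
    ring
  have h2 : Real.exp (-(4 * Real.log (c * d))) ≤ 1 / (c * d) := by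
    rw [one_div, ← Real.exp_log (show 0 < c * (d : ℝ) by linarith), ← Real.exp_neg,
      Real.exp_log (show 0 < c * (d : ℝ) by linarith)]
    exact Real.exp_le_exp.2 (by linarith)
  have h3 : (d : ℝ) * Real.exp (-(4 * Real.log (c * d))) ≤ 1 / c := by
    refine (mul_le_mul_of_nonneg_left h2 (by linarith)).trans (le_of_eq ?_)
    field_simp
  have h4 : 1 / c ≤ 1 / √c := by
    refine one_div_le_one_div_of_le (Real.sqrt_pos.2 hc0) ?_
    exact Real.sqrt_le_iff.2 ⟨hc0.le, by nlinarith⟩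
  rw [h1]
  exact (h3.trans h4).trans (inv_sqrt_le_loss hc hd)

theorem sqrt_le_threshold {H : Instance} {c : ℝ} (hc : c ≤ H.cmin) : √c ≤ H.threshold := by
  unfold Instance.threshold
  rw [Real.coe_sqrt]
  exact Real.sqrt_le_sqrt hc

/-- The benchmark hardly suffers from the batching. -/
theorem mul_OPT_le_OPT_batched {F : Set Instance} {d : ℕ} (hd : 1 ≤ d) (hFd : UsesAtMost F d)
    {H : Instance} (hH : H ∈ F) {c : ℝ} (hc : 2 ≤ c) (hcH : c ≤ H.cmin) :
    ENNReal.ofReal (1 - 10 * √(Real.log (c * d) / c)) * H.OPT ≤ H.batched.inst.OPT := by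
  obtain ⟨D, hD⟩ : ∃ D, H.batched.Describes H.batches D := H.exists_describes H.batches
  set e := √(Real.log (c * d) / c) with he
  have he0 : 0 ≤ e := Real.sqrt_nonneg _
  have hc0 : 0 < c := by linarith
  -- If `8 e` is not a probability, the factor on the left is zero and nothing is claimed.
  by_cases h8 : 1 < 8 * e
  · rw [ENNReal.ofReal_of_nonpos (by linarith), zero_mul]
    exact zero_le
  -- The capacity bound needs `4 / √c ≤ δ`, and `1 / √c ≤ 2 e` gives this for `8 e`. The failure
  -- probability adds at most `2 e`, for a total of `10 e`.
  let δ : ℝ≥0 := ⟨8 * e, by positivity⟩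
  have hδv : (δ : ℝ) = 8 * e := rfl
  have hδ : δ ≤ 1 := by
    rw [← NNReal.coe_le_coe, hδv]
    exact not_lt.1 h8
  have hsc : 0 < √c := Real.sqrt_pos.2 hc0
  have hthr : √c ≤ H.threshold := sqrt_le_threshold hcH
  have hthr0 : (0 : ℝ) < H.threshold := hsc.trans_le hthr
  have hthr0' : 0 < H.threshold := by exact_mod_cast hthr0
  have hthr2 : (H.threshold : ℝ) ^ 2 = H.cmin := by
    unfold Instance.threshold
    rw [Real.coe_sqrt, Real.sq_sqrt (NNReal.coe_nonneg _)]
  have hthr1 : (1 : ℝ) ≤ H.threshold := by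
    have : (1 : ℝ) ≤ √c := Real.one_le_sqrt.2 (by linarith)
    linarith
  have hthrc : ∀ i, H.threshold ≤ H.c i := by
    intro i
    refine le_trans ?_ (H.cmin_le i)
    rw [← NNReal.coe_le_coe, ← hthr2]
    nlinarith
  have hmain := D.mul_OPT_le hδ (d := d) (c := c)
    (fun i => hcH.trans (by exact_mod_cast H.cmin_le i)) (fun t k => hFd H hH t k) ?_
  · refine le_trans (mul_le_mul_left (ENNReal.ofReal_le_ofReal ?_) _) hmain
    have := failure_le hc hd
    rw [hδv]
    linarith
  · intro t i
    have hsum : (∑ r ∈ D.avail i t, H.batched.inst.c r) + H.pending i (t + 1) =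
      H.c i + ∑ l ∈ Finset.univ.filter (fun l : Fin H.m => l ≤ t), H.zeta i l :=
      H.sum_c_add_pending hD i t
    rw [← hsum]
    push_cast
    have hle : ∀ r, H.threshold ≤ H.batched.inst.c r :=
      hD.le_c _ hthrc fun e he => H.le_size_of_mem_batchesTo (T := H.m) he
    refine capacity_bound hthr0 ?_ ?_ (NNReal.coe_nonneg _) ?_ ?_
    · have h1 := inv_sqrt_le_loss hc hd
      have h2 : 4 / (H.threshold : ℝ) ≤ 4 / √c :=
        div_le_div_of_nonneg_left (by norm_num) hsc hthr
      have h3 : 4 / √c = 4 * (1 / √c) := by ring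
      rw [hδv]
      linarith
    · have h1 : H.c i ≤ ∑ r ∈ D.avail i t, H.batched.inst.c r := by
        have := hD.sum_c i t
        unfold Copying.avail
        rw [this]
        exact le_self_add
      rw [hthr2]
      exact_mod_cast (H.cmin_le i).trans h1
    · exact_mod_cast (H.pending_lt hthr0' i _).le
    · rw [← nsmul_eq_mul]
      have := Finset.card_nsmul_le_sum (D.avail i t) (fun r => (H.batched.inst.c r : ℝ))
        (H.threshold : ℝ) fun r _ => by exact_mod_cast hle r
      exact this

theorem hasRatio_batching {F : Set Instance} {A : OnlineAlg} {α : ℝ → ℝ≥0} {d : ℕ} (hd : 1 ≤ d)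
    (hF : ClosedFamily F) (hFd : UsesAtMost F d) (hA : A.Consistent F)
    (hnw : ∀ H ∈ noReplPart F, (A.run H).NonWasteful)
    (hratio : ∀ x : ℝ, 0 < x → A.HasRatio (atLeast (noReplPart F) x) (α x)) {c : ℝ} (hc : 2 ≤ c) :
    A.batching.HasRatio (atLeast F c)
      (ENNReal.ofReal (α √c * (1 - 10 * √(Real.log (c * d) / c)))) := by
  rintro H ⟨hH, hcH⟩
  obtain ⟨D, hD⟩ : ∃ D, H.batched.Describes H.batches D := H.exists_describes H.batches
  have hsc : 0 < √c := Real.sqrt_pos.2 (by linarith)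
  have hthr : √c ≤ H.threshold := sqrt_le_threshold hcH
  have hthr0 : 0 < H.threshold := by exact_mod_cast hsc.trans_le hthr
  have hthrc : ∀ i, H.threshold ≤ H.c i := by
    intro i
    refine le_trans ?_ (H.cmin_le i)
    unfold Instance.threshold
    rw [NNReal.sqrt_le_iff_le_sq]
    have h1 : (1 : ℝ≥0) ≤ H.cmin := by
      rw [← NNReal.coe_le_coe]
      push_cast
      linarith
    exact le_self_pow₀ h1 (by norm_num)
  have hsize : ∀ e ∈ H.batches, H.threshold ≤ e.size := fun e he =>
    H.le_size_of_mem_batchesTo (T := H.m) he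
  have hB : H.batched.inst ∈ noReplPart F :=
    extend_mem hF ⟨hF.noRepl_mem H hH, rfl⟩ H.batches fun e he => hthr0.trans_le (hsize e he)
  -- Batches reach the threshold by construction, and the initial inventories do since `c_min ≥ 1`.
  -- So the ratio of ALG is invoked at `√c`.
  have hBmin : √c ≤ H.batched.inst.cmin := by
    refine hthr.trans ?_
    rw [NNReal.coe_le_coe]
    have : Nonempty (Fin H.batched.inst.n) := ⟨⟨0, H.batched.inst.n_pos⟩⟩
    exact le_ciInf fun r => hD.le_c _ hthrc hsize r
  obtain ⟨hadm, hval⟩ := hratio √c hsc H.batched.inst ⟨hB, hBmin⟩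
  refine ⟨A.admissible_batching hF hA hH hthr0 hadm (hnw _ hB), ?_⟩
  rw [ENNReal.ofReal_mul (NNReal.coe_nonneg _), ENNReal.ofReal_coe_nnreal, mul_assoc]
  refine (mul_le_mul_right (mul_OPT_le_OPT_batched hd hFd hH hc hcH) _).trans ?_
  exact hval.trans (A.value_le_batching hF hA hH hthr0 hD hadm.1)

/-- A ratio on all realisations carries over to stochastic replenishment. -/
theorem OnlineAlg.HasRatio.stoch {A : OnlineAlg} {F : Set Instance} {ρ : ℝ≥0∞}
    (h : A.HasRatio F ρ) (G : StochInstance) (hG : ∀ z, 0 < G.weight z → G.realize z ∈ F) :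
    ρ * G.OPT ≤ G.value A := by
  unfold StochInstance.OPT StochInstance.value
  rw [Finset.mul_sum]
  refine Finset.sum_le_sum fun z _ => ?_
  rw [mul_left_comm]
  by_cases hz : G.weight z = 0
  · simp [hz]
  · exact mul_le_mul_right (h _ (hG z (pos_iff_ne_zero.2 hz))).2 _

end OnlineAllocation

end

theorem theorem2p1 :
    ∃ C : ℝ, 0 < C ∧
      ∀ (F : Set OnlineAllocation.Instance) (ALG : OnlineAllocation.OnlineAlg) (α : ℝ → ℝ≥0)
        (d : ℕ),
        1 ≤ d →
        OnlineAllocation.ClosedFamily F →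
        OnlineAllocation.UsesAtMost F d →
        ALG.Consistent F →
        (∀ H ∈ OnlineAllocation.noReplPart F, (ALG.run H).NonWasteful) →
        (∀ x : ℝ, 0 < x →
          ALG.HasRatio (OnlineAllocation.atLeast (OnlineAllocation.noReplPart F) x) (α x)) →
        ∀ c : ℝ, 2 ≤ c →
          ALG.batching.HasRatio (OnlineAllocation.atLeast F c)
            (ENNReal.ofReal (α (Real.sqrt c) *
              (1 - C * Real.sqrt (Real.log (c * d) / c)))) ∧
          ∀ G : OnlineAllocation.StochInstance,
            (∀ z, 0 < G.weight z → G.realize z ∈ F) →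
            c ≤ (G.cmin : ℝ) →
            ENNReal.ofReal (α (Real.sqrt c) *
              (1 - C * Real.sqrt (Real.log (c * d) / c))) * G.OPT ≤ G.value ALG.batching := by
  refine ⟨10, by norm_num, fun F ALG α d hd hF hFd hA hnw hratio c hc => ?_⟩
  have h := OnlineAllocation.hasRatio_batching hd hF hFd hA hnw hratio hc
  exact ⟨h, fun G hG hcG => h.stoch G fun z hz => ⟨hG z hz, hcG⟩⟩
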